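/- Let $S$ be a finite set with $n=|S|\ge 7$ and let $d\in(0,1)$. For each integer $L\ge 0$ let $R$ be a tuple of $\lfloor (2n-1)^{dL}\rfloor$ words chosen uniformly at random (independently, repetitions allowed) from the reduced words of length $L$ in the letters $S\cup S^{-1}$, and let $G=\langle S\mid R\rangle$ be the resulting random group at density $d$ and length $L$. Then with probability tending to $1$ as $L\to\infty$ the group $G$ has property $F\mathcal C_2$: for every $\mathrm{CAT}(0)$ cube complex $X$ of dimension at most $2$ and every action of $G$ on $X$ by cubical isometries, there is a point of $X$ fixed by all of $G$. Here a cube complex is a union of embedded Euclidean unit cubes, any two of which are disjoint or glued along a common face; it is $\mathrm{CAT}(0)$ if it is (nonempty and) simply connected and the link of every vertex is a flag simplicial complex; a cubical isometry is an isometry of $X$ that maps cubes to cubes (equivalently, an automorphism of the cube complex). No local finiteness of $X$ is assumed. -/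

import Mathlib

universe u v

/-! ## Cube complexes -/

/-- A face of the combinatorial cube `{0,1}^k`: some coordinates are prescribed (`p i = some b`),
the other ones are free (`p i = none`). -/
def IsCubeFace {k : ℕ} (F : Set (Fin k → Bool)) : Prop :=
  ∃ p : Fin k → Option Bool, F = {x | ∀ i b, p i = some b → x i = b}

/-- `φ` identifies the vertices of the standard `k`-cube with vertices in `V`, in such a way that
the members of `cubes` inside the image are exactly the images of the faces of the cube. -/
def IsCubeChart {V : Type u} (cubes : Set (Set V)) {k : ℕ} (φ : (Fin k → Bool) → V) : Prop :=
  Function.Injective φ ∧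
    ∀ s ⊆ Set.range φ, s ∈ cubes ↔ ∃ F : Set (Fin k → Bool), IsCubeFace F ∧ s = φ '' F

/-- A cube complex with vertex set `V`: a union of Euclidean unit cubes, each of them embedded, any
two of which are disjoint or meet in a common face along which they are glued by an isometry.
A cube is recorded as the set of its vertices. No bound on the dimension and no local finiteness
is imposed. -/
structure CubeComplex (V : Type u) where
  /-- The vertex sets of the (closed) cubes. -/
  cubes : Set (Set V)
  singleton_mem : ∀ x : V, {x} ∈ cubes
  /-- Every cube is a copy of a standard cube `[0,1]^k`, with its faces. -/
  exists_chart : ∀ c ∈ cubes, ∃ (k : ℕ) (φ : (Fin k → Bool) → V),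
    IsCubeChart cubes φ ∧ Set.range φ = c
  /-- Two cubes which meet, meet in a cube (hence in a common face). -/
  inter_mem : ∀ c ∈ cubes, ∀ c' ∈ cubes, (c ∩ c').Nonempty → c ∩ c' ∈ cubes

namespace CubeComplex

variable {V : Type u} (X : CubeComplex V)

/-- All cubes have dimension at most `n`. -/
def DimLE (n : ℕ) : Prop :=
  ∀ (k : ℕ) (φ : (Fin k → Bool) → V), IsCubeChart X.cubes φ → k ≤ n

/-- The 1-skeleton. -/
def graph : SimpleGraph V where
  Adj x y := x ≠ y ∧ {x, y} ∈ X.cubes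
  symm := ⟨fun x y h => ⟨h.1.symm, by rw [Set.pair_comm]; exact h.2⟩⟩
  loopless := ⟨fun _ h => h.1 rfl⟩

/-- The link of the vertex `x`. Its vertices are the edges at `x`, recorded through their other
endpoints, and each cube `c` containing `x` contributes the simplex spanned by the edges of `c`
at `x` (the vertex `x` itself contributes the empty simplex). -/
def link (x : V) : Set (Set V) :=
  {N | ∃ c ∈ X.cubes, x ∈ c ∧ N = {a | a ∈ c ∧ X.graph.Adj x a}}

/-- Every link is a flag complex: finitely many vertices of the link which are pairwise joined by
an edge of the link span a simplex of the link. -/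
def LinksFlag : Prop :=
  ∀ (x : V) (N : Set V), N.Finite → (∀ a ∈ N, X.graph.Adj x a) →
    (∀ a ∈ N, ∀ b ∈ N, a ≠ b → {a, b} ∈ X.link x) → N ∈ X.link x

/-- Homotopy of edge paths relative to the endpoints: the congruence generated by inserting or
deleting backtracks and by pushing a path across a square. -/
inductive Homotopic : ∀ {x y : V}, X.graph.Walk x y → X.graph.Walk x y → Prop
  | refl {x y : V} (p : X.graph.Walk x y) : Homotopic p p
  | symm {x y : V} {p q : X.graph.Walk x y} : Homotopic p q → Homotopic q p
  | trans {x y : V} {p q r : X.graph.Walk x y} : Homotopic p q → Homotopic q r → Homotopic p r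
  | cons {x y z : V} (h : X.graph.Adj x y) {p q : X.graph.Walk y z} :
      Homotopic p q → Homotopic (SimpleGraph.Walk.cons h p) (SimpleGraph.Walk.cons h q)
  | backtrack {x y z : V} (h : X.graph.Adj x y) (p : X.graph.Walk x z) :
      Homotopic (SimpleGraph.Walk.cons h (SimpleGraph.Walk.cons h.symm p)) p
  | square {a b c d z : V} (hab : X.graph.Adj a b) (hbc : X.graph.Adj b c)
      (had : X.graph.Adj a d) (hdc : X.graph.Adj d c) (hsq : {a, b, c, d} ∈ X.cubes)
      (p : X.graph.Walk c z) :
      Homotopic (SimpleGraph.Walk.cons hab (SimpleGraph.Walk.cons hbc p))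
        (SimpleGraph.Walk.cons had (SimpleGraph.Walk.cons hdc p))

/-- Nonempty, connected, and with trivial (edge path) fundamental group. -/
def SimplyConnected : Prop :=
  X.graph.Connected ∧
    ∀ (x : V) (p : X.graph.Walk x x), X.Homotopic p SimpleGraph.Walk.nil

/-- A `CAT(0)` cube complex: simply connected, with flag links. -/
structure IsCAT0 : Prop where
  simplyConnected : X.SimplyConnected
  linksFlag : X.LinksFlag

/-! ### Geometric realization and automorphisms -/

open Classical in
/-- The point with coordinates `t ∈ [0,1]^k` of the cube with vertices `φ`, as a formal convex
combination of the vertices of that cube: the vertex `φ ε` has weight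
`∏ i, (t i if ε i = 1, and 1 - t i if ε i = 0)`. The coordinates are recovered from the weights
(`t i` is the total weight of the vertices with `ε i = 1`), and the points of a face of
the cube have the same weights whether computed in the face or in the cube. -/
noncomputable def point {k : ℕ} (φ : (Fin k → Bool) → V) (t : Fin k → ℝ) : V → ℝ :=
  fun x => ∑ ε : Fin k → Bool, if φ ε = x then ∏ i, (if ε i then t i else 1 - t i) else 0

/-- The geometric realization of `X`: the set of all points of all cubes of `X`. -/
def Realization : Type u :=
  {w : V → ℝ // ∃ (k : ℕ) (φ : (Fin k → Bool) → V) (t : Fin k → ℝ),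
    IsCubeChart X.cubes φ ∧ (∀ i, t i ∈ Set.Icc (0 : ℝ) 1) ∧ w = point φ t}

/-- Cubical isometries (automorphisms) of `X`, as permutations of the vertices which map cubes to
cubes, and whose inverses do so as well. -/
def Aut : Subgroup (Equiv.Perm V) where
  carrier := {g | ∀ c : Set V, g '' c ∈ X.cubes ↔ c ∈ X.cubes}
  one_mem' := fun c => by simp
  mul_mem' := by
    intro g h hg hh c
    have : (g * h : Equiv.Perm V) '' c = g '' (h '' c) := by
      rw [Set.image_image]; rfl
    rw [this]
    exact (hg _).trans (hh c)
  inv_mem' := by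
    intro g hg c
    have : g '' ((g⁻¹ : Equiv.Perm V) '' c) = c := by
      rw [Set.image_image]; simp
    rw [← hg, this]

theorem isCubeChart_comp {X : CubeComplex V} (g : X.Aut) {k : ℕ} {φ : (Fin k → Bool) → V}
    (h : IsCubeChart X.cubes φ) : IsCubeChart X.cubes (fun ε => (g : Equiv.Perm V) (φ ε)) := by
  refine ⟨(g : Equiv.Perm V).injective.comp h.1, fun s hs => ?_⟩
  have hs' : s = (g : Equiv.Perm V) '' ((g : Equiv.Perm V) ⁻¹' s) :=
    (Set.image_preimage_eq s (g : Equiv.Perm V).surjective).symm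
  have hsub : (g : Equiv.Perm V) ⁻¹' s ⊆ Set.range φ := by
    intro x hx
    obtain ⟨ε, hε⟩ := hs hx
    exact ⟨ε, (g : Equiv.Perm V).injective hε⟩
  have h1 : s ∈ X.cubes ↔ (g : Equiv.Perm V) ⁻¹' s ∈ X.cubes := by
    conv_lhs => rw [hs']
    exact g.2 _
  rw [h1, h.2 _ hsub]
  refine exists_congr fun F => and_congr_right fun _ => ?_
  have h2 : (fun ε => (g : Equiv.Perm V) (φ ε)) '' F = (g : Equiv.Perm V) '' (φ '' F) := by
    rw [Set.image_image]
  rw [h2]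
  constructor
  · intro e
    rw [← e]
    exact hs'
  · intro e
    rw [e]
    exact Set.preimage_image_eq _ (g : Equiv.Perm V).injective

theorem point_comp (g : Equiv.Perm V) {k : ℕ} (φ : (Fin k → Bool) → V) (t : Fin k → ℝ) :
    (fun x => point φ t (g⁻¹ x)) = point (fun ε => g (φ ε)) t := by
  funext x
  refine Finset.sum_congr rfl fun ε _ => ?_
  have key : φ ε = g⁻¹ x ↔ g (φ ε) = x := Equiv.Perm.eq_inv_iff_eq
  by_cases h : g (φ ε) = x
  · rw [if_pos h, if_pos (key.2 h)]
  · rw [if_neg h, if_neg (fun h' => h (key.1 h'))]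

/-- An automorphism moves the point with coordinates `t` of a cube to the point with the same
coordinates of the image cube. -/
instance : MulAction X.Aut X.Realization where
  smul g w := ⟨fun x => w.1 ((g : Equiv.Perm V)⁻¹ x), by
    obtain ⟨k, φ, t, hφ, ht, hw⟩ := w.2
    exact ⟨k, fun ε => (g : Equiv.Perm V) (φ ε), t, isCubeChart_comp g hφ, ht, by
      rw [hw, point_comp]⟩⟩
  one_smul w := Subtype.ext (funext fun x => rfl)
  mul_smul g h w := Subtype.ext (funext fun x => by
    change w.1 (((g * h : X.Aut) : Equiv.Perm V)⁻¹ x) =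
      w.1 ((h : Equiv.Perm V)⁻¹ ((g : Equiv.Perm V)⁻¹ x))
    rw [Subgroup.coe_mul, mul_inv_rev, Equiv.Perm.mul_apply])

end CubeComplex

/-- Property `FC_n`: every action by cubical isometries on a `CAT(0)` cube complex of dimension at
most `n` fixes a point of the complex. -/
def PropertyFC (n : ℕ) (G : Type v) [Group G] : Prop :=
  ∀ (V : Type u) (X : CubeComplex V), X.IsCAT0 → X.DimLE n →
    ∀ ρ : G →* X.Aut, ∃ p : X.Realization, ∀ g : G, ρ g • p = p

/-! ## Random groups -/

/-- Reduced words of length `L` in the letters `S ∪ S⁻¹`, where `(s, true)` is `s` and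
`(s, false)` is `s⁻¹`. -/
def ReducedWord (S : Type v) (L : ℕ) : Type v :=
  {w : List (S × Bool) // w.length = L ∧ FreeGroup.IsReduced w}

/-- The number `⌊(2n-1)^{dL}⌋` of relators at density `d` and length `L`, where `n = |S|`. -/
noncomputable def numRelators (S : Type v) [Fintype S] (d : ℝ) (L : ℕ) : ℕ :=
  ⌊(2 * (Fintype.card S : ℝ) - 1) ^ (d * (L : ℝ))⌋₊

/-- The possible tuples of relators at density `d` and length `L`. -/
abbrev Relators (S : Type v) [Fintype S] (d : ℝ) (L : ℕ) : Type v :=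
  Fin (numRelators S d L) → ReducedWord S L

/-- The group `⟨S ∣ R⟩` given by a tuple of words. -/
abbrev groupOfRelators {S : Type v} [Fintype S] {d : ℝ} {L : ℕ} (R : Relators S d L) : Type v :=
  PresentedGroup (Set.range fun i => FreeGroup.mk (R i).1)

/-- The probability that the group `⟨S ∣ R⟩` satisfies `Q`, for a uniformly random tuple `R` of
relators at density `d` and length `L`. -/
noncomputable def randomGroupProb (S : Type v) [Fintype S] (d : ℝ) (L : ℕ)
    (Q : ∀ (G : Type v) [Group G], Prop) : ℝ :=
  (Nat.card {R : Relators S d L // Q (groupOfRelators R)} : ℝ) / Nat.card (Relators S d L)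

/-- A random group on the generating set `S` at density `d` satisfies `Q` with overwhelming
probability. -/
def WithOverwhelmingProbability (S : Type v) [Fintype S] (d : ℝ)
    (Q : ∀ (G : Type v) [Group G], Prop) : Prop :=
  Filter.Tendsto (fun L : ℕ => randomGroupProb S d L Q) Filter.atTop (nhds 1)

/-! Write `q = 2n - 1` and `τ = q ^ (1 - d / 2)`, so `1 ≤ τ < q`. Fix a letter `s`; blocks are words
that start with `s` and may be followed by `s`, so they concatenate freely. Let `C` be a set of at
least `τ ^ ℓ` blocks of length `ℓ`. Up to constants, at least `τ ^ L` of the at most `q ^ L` reduced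
words of length `L` are a short power of another letter `t` followed by a product of members of `C`.
With about `q ^ (d * L)` relators, the expected number of relators of this shape is of order at
least `q ^ (d * L / 2)`. Since `ℓ` is bounded independently of `L`, only finitely many `C` matter,
and with probability tending to 1 each is hit, with padding by `t` and by `t⁻¹`. Then no halfspace
`h` is strictly shrunk by `τ ^ ℓ` blocks of length `ℓ`: a trivially acting word `t ^ r * v` with `v
• h ⊂ h` gives `t⁻ʳ • h ⊂ h`, the other padding gives `tʳ • h ⊂ h`, and these contradict each other
(`fewContractions_of_relators`).

On the geometric side, the 1-skeleton of a two-dimensional CAT(0) cube complex is bipartite and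
satisfies the quadrangle condition (`CubeComplex.IsCAT0.squareComplexGraph`). This yields convex
halfspaces, gates, a Helly property, and the absence of three pairwise crossing halfspaces.

Call `h` reversed if many framed words `w` (reduced, starting and ending with `s`) satisfy `w • h ⊂
hᶜ`. If neither `h` nor `hᶜ` is reversed, most framed words fix the wall of `h` or move it to a
crossing wall. As no three walls cross pairwise, most framed words then give at most two images of
the wall, and this forces a finite orbit (`orbit_finite_of_few_exceptions`). So a halfspace with
infinite orbit, or its complement, is reversed. Two reversals compose to a contraction, and
contractions are rare; hence the reversed halfspaces of infinite orbit form an invariant family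
whose complements meet pairwise. Helly gives a vertex outside all of them. Every halfspace
separating this vertex from a translate has finite orbit, so the vertex has a finite orbit
(`HalfspaceSystem.exists_orbit_finite`). A finite orbit yields an invariant cube
(`CubeComplex.exists_invariant_cube`), whose barycenter is fixed. -/

/-! ## Square systems and equivalence of edge paths -/

/-- `Sq a b c d` is meant to say that `a, b, c, d` are the consecutive vertices of a square.
A square is determined by two consecutive edges, and links contain no triangles. -/
structure SquareSystem {V : Type u} (Γ : SimpleGraph V) (Sq : V → V → V → V → Prop) : Prop where
  rotate : ∀ {a b c d}, Sq a b c d → Sq b c d a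
  reflect : ∀ {a b c d}, Sq a b c d → Sq a d c b
  adj : ∀ {a b c d}, Sq a b c d → Γ.Adj a b
  ne : ∀ {a b c d}, Sq a b c d → a ≠ c
  unique : ∀ {a b c c' d}, Sq a b c d → Sq a b c' d → c = c'
  not_triangle : ∀ {a b c d x y z}, Sq a b x c → Sq a c y d → Sq a b z d → False

/-- Paths are recorded as lists of vertices, starting from the endpoint. Two paths of the same
length are equivalent if they differ by pushes across squares. -/
inductive PathEquiv {V : Type u} (Sq : V → V → V → V → Prop) : List V → List V → Prop
  | single (v : V) : PathEquiv Sq [v] [v]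
  | cons (y : V) {p q : List V} : PathEquiv Sq p q → PathEquiv Sq (y :: p) (y :: q)
  | flip {y a u b : V} {p q r : List V} : Sq y a u b → PathEquiv Sq p (a :: u :: r) →
      PathEquiv Sq q (b :: u :: r) → PathEquiv Sq (y :: p) (y :: q)

namespace PathEquiv

variable {V : Type u} {Sq : V → V → V → V → Prop}

theorem refl : ∀ {p : List V}, p ≠ [] → PathEquiv Sq p p
  | [v], _ => single v
  | _ :: _ :: _, _ => cons _ (refl (List.cons_ne_nil _ _))

theorem ne_nil {p q : List V} (h : PathEquiv Sq p q) : p ≠ [] ∧ q ≠ [] := by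
  cases h <;> simp

theorem length_eq {p q : List V} (h : PathEquiv Sq p q) : p.length = q.length := by
  induction h with
  | single v => rfl
  | cons y _ ih => simp [ih]
  | flip _ _ _ ih1 ih2 => simp_all

theorem head?_eq {p q : List V} (h : PathEquiv Sq p q) : p.head? = q.head? := by
  cases h <;> rfl

theorem getLast?_eq {p q : List V} (h : PathEquiv Sq p q) : p.getLast? = q.getLast? := by
  induction h with
  | single v => rfl
  | cons y h ih => rw [List.getLast?_cons_of_ne_nil h.ne_nil.1, List.getLast?_cons_of_ne_nil h.ne_nil.2, ih]
  | flip hs h1 h2 ih1 ih2 =>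
    rw [List.getLast?_cons_of_ne_nil h1.ne_nil.1, List.getLast?_cons_of_ne_nil h2.ne_nil.1, ih1, ih2]
    simp only [List.getLast?_cons_cons]

variable {Γ : SimpleGraph V} (hS : SquareSystem Γ Sq)
include hS

theorem symm {p q : List V} (h : PathEquiv Sq p q) : PathEquiv Sq q p := by
  induction h with
  | single v => exact single v
  | cons y _ ih => exact cons y ih
  | flip hs h1 h2 _ _ => exact flip (hS.reflect hs) h2 h1

theorem cancel {y a : V} {r r' : List V} (h : PathEquiv Sq (y :: a :: r) (y :: a :: r')) :
    PathEquiv Sq (a :: r) (a :: r') := by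
  cases h with
  | cons _ h => exact h
  | flip hs h1 h2 =>
    have e1 := h1.head?_eq
    have e2 := h2.head?_eq
    simp only [List.head?_cons, Option.some.injEq] at e1 e2
    exact absurd (e1.symm.trans e2) (hS.ne (hS.rotate hs))

omit hS in
/-- Two equivalent paths whose last edges differ span a square. -/
theorem exists_square {y a b : V} {r r' : List V} (hab : a ≠ b)
    (h : PathEquiv Sq (y :: a :: r) (y :: b :: r')) :
    ∃ u s, Sq y a u b ∧ PathEquiv Sq (a :: r) (a :: u :: s) ∧
      PathEquiv Sq (b :: r') (b :: u :: s) := by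
  cases h with
  | cons _ h =>
    have e := h.head?_eq
    simp only [List.head?_cons, Option.some.injEq] at e
    exact absurd e hab
  | flip hs h1 h2 =>
    have e1 := h1.head?_eq
    have e2 := h2.head?_eq
    simp only [List.head?_cons, Option.some.injEq] at e1 e2
    subst e1 e2
    exact ⟨_, _, hs, h1, h2⟩

/-- This is where links without triangles enter. Two successive flips at `y` through the middle
vertex `b` either undo each other or force a third square at `b`, and the three squares form a
triangle in the link of `b`. -/
theorem trans {p q s : List V} (h1 : PathEquiv Sq p q) (h2 : PathEquiv Sq q s) :
    PathEquiv Sq p s := by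
  induction hn : p.length using Nat.strong_induction_on generalizing p q s with
  | _ n ih =>
  have IH : ∀ {p' q' s' : List V}, p'.length < n → PathEquiv Sq p' q' → PathEquiv Sq q' s' →
      PathEquiv Sq p' s' := fun hl g1 g2 => ih _ hl g1 g2 rfl
  cases h1 with
  | single v => exact h2
  | cons y g1 =>
    rename_i p q
    simp only [List.length_cons] at hn
    cases h2 with
    | single v => exact absurd rfl g1.ne_nil.2
    | cons _ g2 => exact cons y (IH (by omega) g1 g2)
    | flip hs g2 g3 => exact flip hs (IH (by omega) g1 g2) g3
  | flip hs g1 g1' =>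
    rename_i y a u b p q r
    simp only [List.length_cons] at hn
    have l1 := g1.length_eq
    have l1' := g1'.length_eq
    simp only [List.length_cons] at l1 l1'
    cases h2 with
    | single v => exact absurd rfl g1'.ne_nil.1
    | cons _ g2 =>
      have l2 := g2.length_eq
      exact flip hs g1 (IH (by omega) (g2.symm hS) g1')
    | flip hs' g2 g2' =>
      rename_i a' u' b' s r'
      have e : b = a' := by
        have := (g1'.head?_eq).symm.trans g2.head?_eq
        simpa using this
      subst e
      have l2 := g2.length_eq
      have l2' := g2'.length_eq
      simp only [List.length_cons] at l2 l2'
      have key : PathEquiv Sq (b :: u :: r) (b :: u' :: r') :=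
        IH (by simp only [List.length_cons]; omega) (g1'.symm hS) g2
      by_cases hab : a = b'
      · subst hab
        have hu : u = u' := hS.unique hs (hS.reflect hs')
        subst hu
        have key2 := cons a (key.cancel hS)
        exact cons y (IH (by omega) (IH (by omega) g1 key2) (g2'.symm hS))
      · have hu : u ≠ u' := by
          rintro rfl
          exact hab (hS.unique (hS.rotate (hS.rotate (hS.rotate hs))) (hS.reflect (hS.rotate hs')))
        obtain ⟨e, _, he, -, -⟩ := key.exists_square hu
        exact (hS.not_triangle he (hS.rotate hs')
          (hS.reflect (hS.rotate (hS.rotate (hS.rotate hs))))).elim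

end PathEquiv

/-! ### Reduced paths and the cancellation of backtracks -/

/-- Some path equivalent to `p` has `z` as its last but one vertex. -/
def Descends {V : Type u} (Sq : V → V → V → V → Prop) (p : List V) (z : V) : Prop :=
  ∃ y r, PathEquiv Sq p (y :: z :: r)

/-- No path equivalent to an initial segment of the path backtracks. -/
inductive ReducedPath {V : Type u} (Γ : SimpleGraph V) (Sq : V → V → V → V → Prop) :
    List V → Prop
  | single (v : V) : ReducedPath Γ Sq [v]
  | cons {y a : V} {p : List V} : ReducedPath Γ Sq (a :: p) → Γ.Adj y a →
      ¬ Descends Sq (a :: p) y → ReducedPath Γ Sq (y :: a :: p)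

open Classical in
/-- Extend a path by a vertex, and cancel the resulting backtrack if there is one. -/
noncomputable def extendPath {V : Type u} (Sq : V → V → V → V → Prop) (p : List V) (z : V) :
    List V :=
  if h : Descends Sq p z then z :: h.choose_spec.choose else z :: p

namespace SquareSystem

variable {V : Type u} {Γ : SimpleGraph V} {Sq : V → V → V → V → Prop} (hS : SquareSystem Γ Sq)
include hS

theorem descends_congr {p q : List V} (h : PathEquiv Sq p q) (z : V) :
    Descends Sq p z ↔ Descends Sq q z :=
  ⟨fun ⟨y, r, h'⟩ => ⟨y, r, (h.symm hS).trans hS h'⟩, fun ⟨y, r, h'⟩ => ⟨y, r, h.trans hS h'⟩⟩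

theorem descends_flip {y a u b : V} {r : List V} (hs : Sq y a u b)
    (h : Descends Sq (u :: r) b) : Descends Sq (a :: u :: r) y := by
  obtain ⟨x, s, h⟩ := h
  have e := h.head?_eq
  simp only [List.head?_cons, Option.some.injEq] at e
  subst e
  exact ⟨a, b :: s, .flip (hS.rotate hs) h (PathEquiv.refl (by simp))⟩

/-- If the flipped path could backtrack to `y`, the square at `b` witnessing this would be the given
one, so the initial segment ending at `u` would already descend to `a`. -/
theorem reducedPath_flip {y a u b : V} {r : List V} (hs : Sq y a u b)
    (h : ReducedPath Γ Sq (y :: a :: u :: r)) : ReducedPath Γ Sq (y :: b :: u :: r) := by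
  cases h with
  | cons h1 hya hy =>
    cases h1 with
    | cons h2 hau ha =>
      have hbu : Γ.Adj b u := (hS.adj (hS.rotate (hS.rotate hs))).symm
      refine .cons (.cons h2 hbu fun hb => hy (hS.descends_flip hs hb)) 
        (hS.adj (hS.reflect hs)) ?_
      rintro ⟨b', s, hb⟩
      have e := hb.head?_eq
      simp only [List.head?_cons, Option.some.injEq] at e
      subst e
      obtain ⟨e, s', he, k1, k2⟩ := hb.exists_square (hS.ne hs).symm
      have : e = a := hS.unique he (hS.reflect (hS.rotate (hS.rotate (hS.rotate hs))))
      subst this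
      exact ha ⟨_, _, k1⟩

theorem reducedPath_congr {p q : List V} (h : PathEquiv Sq p q) :
    ReducedPath Γ Sq p ↔ ReducedPath Γ Sq q := by
  have aux : ∀ {y : V} {p q : List V}, PathEquiv Sq p q →
      (ReducedPath Γ Sq p ↔ ReducedPath Γ Sq q) →
      ReducedPath Γ Sq (y :: p) → ReducedPath Γ Sq (y :: q) := by
    intro y p q h ih hr
    cases hr with
    | single => exact absurd rfl h.ne_nil.1
    | cons h1 h2 h3 =>
      cases q with
      | nil => exact absurd rfl h.ne_nil.2
      | cons b q =>
        have e := h.head?_eq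
        simp only [List.head?_cons, Option.some.injEq] at e
        subst e
        exact .cons (ih.1 h1) h2 fun k => h3 ((hS.descends_congr h _).2 k)
  induction h with
  | single v => rfl
  | cons y h ih => exact ⟨aux h ih, aux (h.symm hS) ih.symm⟩
  | flip hs h1 h2 ih1 ih2 =>
    exact ⟨fun k => aux (h2.symm hS) ih2.symm (hS.reducedPath_flip hs (aux h1 ih1 k)),
      fun k => aux (h1.symm hS) ih1.symm (hS.reducedPath_flip (hS.reflect hs) (aux h2 ih2 k))⟩

theorem extendPath_of_equiv {p r : List V} {y z : V} (h : PathEquiv Sq p (y :: z :: r)) :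
    PathEquiv Sq (extendPath Sq p z) (z :: r) := by
  have hd : Descends Sq p z := ⟨y, r, h⟩
  rw [extendPath, dif_pos hd]
  have aux : ∀ {x : V} {s : List V}, PathEquiv Sq (x :: z :: s) (y :: z :: r) →
      PathEquiv Sq (z :: s) (z :: r) := fun k => by
    have e := k.head?_eq
    simp only [List.head?_cons, Option.some.injEq] at e
    subst e
    exact k.cancel hS
  exact aux (((hd.choose_spec.choose_spec).symm hS).trans hS h)

omit hS in
theorem extendPath_of_not_descends {p : List V} {z : V} (h : ¬ Descends Sq p z) :
    extendPath Sq p z = z :: p := by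
  rw [extendPath, dif_neg h]

omit hS in
theorem head?_extendPath (p : List V) (z : V) : (extendPath Sq p z).head? = some z := by
  rw [extendPath]; split_ifs <;> rfl

theorem extendPath_congr {p q : List V} (h : PathEquiv Sq p q) (z : V) :
    PathEquiv Sq (extendPath Sq p z) (extendPath Sq q z) := by
  by_cases hd : Descends Sq q z
  · obtain ⟨y, r, hr⟩ := hd
    exact (hS.extendPath_of_equiv (h.trans hS hr)).trans hS ((hS.extendPath_of_equiv hr).symm hS)
  · have hd' : ¬ Descends Sq p z := fun k => hd ((hS.descends_congr h z).1 k)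
    rw [extendPath_of_not_descends hd, extendPath_of_not_descends hd']
    exact .cons z h

theorem reducedPath_extendPath {p : List V} {y z : V} (hp : ReducedPath Γ Sq p)
    (hy : p.head? = some y) (hyz : Γ.Adj y z) : ReducedPath Γ Sq (extendPath Sq p z) := by
  by_cases hd : Descends Sq p z
  · obtain ⟨x, r, hr⟩ := hd
    have h1 := (hS.reducedPath_congr hr).1 hp
    rw [hS.reducedPath_congr (hS.extendPath_of_equiv hr)]
    cases h1 with
    | cons h1 _ _ => exact h1
  · rw [extendPath_of_not_descends hd]
    cases p with
    | nil => simp at hy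
    | cons x p =>
      simp only [List.head?_cons, Option.some.injEq] at hy
      subst hy
      exact .cons hp hyz.symm hd

/-- If the step to `z` cancels, reducedness is what keeps the step back from cancelling once more.
-/
theorem extendPath_backtrack {p : List V} {y z : V} (hp : ReducedPath Γ Sq p)
    (hy : p.head? = some y) : PathEquiv Sq (extendPath Sq (extendPath Sq p z) y) p := by
  cases p with
  | nil => simp at hy
  | cons x p =>
  simp only [List.head?_cons, Option.some.injEq] at hy
  subst hy
  by_cases hd : Descends Sq (x :: p) z
  · obtain ⟨x', r, hr⟩ := hd
    have e := hr.head?_eq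
    simp only [List.head?_cons, Option.some.injEq] at e
    subst e
    have h1 := (hS.reducedPath_congr hr).1 hp
    have h2 := hS.extendPath_congr (hS.extendPath_of_equiv hr) x
    cases h1 with
    | cons _ _ h1 =>
      rw [extendPath_of_not_descends h1] at h2
      exact h2.trans hS (hr.symm hS)
  · rw [extendPath_of_not_descends hd]
    exact hS.extendPath_of_equiv (PathEquiv.refl (by simp))

/-- If both first steps cancel, the two descents span a square, necessarily the given one, so both
second steps cancel at `c`. If only one cancels, then along the other route exactly the second step
cancels. If neither does, nothing cancels and the results differ by a flip. -/
theorem extendPath_square {l : List V} {a b c d : V} (hs : Sq a b c d)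
    (ha : l.head? = some a) :
    PathEquiv Sq (extendPath Sq (extendPath Sq l b) c) (extendPath Sq (extendPath Sq l d) c) := by
  have aux : ∀ {b d : V}, Sq a b c d → Descends Sq l b → ¬ Descends Sq l d →
      PathEquiv Sq (extendPath Sq (extendPath Sq l b) c)
        (extendPath Sq (extendPath Sq l d) c) := by
    rintro b d hs ⟨a', r, hb⟩ hd
    have e := ha.symm.trans hb.head?_eq
    simp only [List.head?_cons, Option.some.injEq] at e
    subst e
    have h1 := hS.extendPath_congr (hS.extendPath_of_equiv hb) c
    have hc : ¬ Descends Sq (b :: r) c := fun h => hd <| by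
      obtain ⟨b', r', hr'⟩ := h
      have e := hr'.head?_eq
      simp only [List.head?_cons, Option.some.injEq] at e
      subst e
      exact ⟨a, c :: r', hb.trans hS (.flip hs hr' (PathEquiv.refl (by simp)))⟩
    rw [extendPath_of_not_descends hc] at h1
    rw [extendPath_of_not_descends hd]
    have h2 : PathEquiv Sq (d :: l) (d :: c :: b :: r) :=
      .flip (hS.rotate (hS.rotate (hS.rotate hs))) hb (PathEquiv.refl (by simp))
    exact h1.trans hS ((hS.extendPath_of_equiv h2).symm hS)
  by_cases hb : Descends Sq l b <;> by_cases hd : Descends Sq l d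
  · obtain ⟨a', r, hb⟩ := hb
    obtain ⟨a'', r', hd⟩ := hd
    have e := ha.symm.trans hb.head?_eq
    have e' := ha.symm.trans hd.head?_eq
    simp only [List.head?_cons, Option.some.injEq] at e e'
    subst e e'
    obtain ⟨u, s, hu, k1, k2⟩ :=
      ((hb.symm hS).trans hS hd).exists_square (hS.ne (hS.rotate hs))
    obtain rfl := hS.unique hu hs
    have g1 := hS.extendPath_of_equiv ((hS.extendPath_of_equiv hb).trans hS k1)
    have g2 := hS.extendPath_of_equiv ((hS.extendPath_of_equiv hd).trans hS k2)
    exact g1.trans hS (g2.symm hS)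
  · exact aux hs hb hd
  · exact (aux (hS.reflect hs) hd hb).symm hS
  · have aux2 : ∀ {b d : V}, Sq a b c d → ¬ Descends Sq l d → ¬ Descends Sq (b :: l) c := by
      rintro b d hs hd ⟨b', r', hr⟩
      cases l with
      | nil => simp at ha
      | cons a' l =>
      have e := hr.head?_eq
      simp only [List.head?_cons, Option.some.injEq] at e ha
      subst e ha
      obtain ⟨u, s, hu, k1, k2⟩ := hr.exists_square (hS.ne hs)
      have : u = d := hS.unique hu (hS.reflect (hS.rotate hs))
      subst this
      exact hd ⟨_, _, k1⟩
    rw [extendPath_of_not_descends hb, extendPath_of_not_descends hd,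
      extendPath_of_not_descends (aux2 hs hd), extendPath_of_not_descends (aux2 (hS.reflect hs) hb)]
    cases l with
    | nil => simp at ha
    | cons a' l =>
      simp only [List.head?_cons, Option.some.injEq] at ha
      subst ha
      exact .flip (hS.rotate (hS.rotate (hS.reflect hs)))
        (PathEquiv.refl (by simp)) (PathEquiv.refl (by simp))


end SquareSystem

/-- The result of successively extending the path `l` by the vertices of a walk. -/
noncomputable def extendWalk {V : Type u} {Γ : SimpleGraph V} (Sq : V → V → V → V → Prop) :
    ∀ {x y : V}, Γ.Walk x y → List V → List V
  | _, _, .nil, l => l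
  | _, _, .cons (v := z) _ p, l => extendWalk Sq p (extendPath Sq l z)

section

variable {V : Type u} {Γ : SimpleGraph V} {Sq : V → V → V → V → Prop}

theorem extendWalk_append {x y z : V} (p : Γ.Walk x y) (q : Γ.Walk y z) (l : List V) :
    extendWalk Sq (p.append q) l = extendWalk Sq q (extendWalk Sq p l) := by
  induction p generalizing l with
  | nil => rfl
  | cons h p ih => exact ih q _

theorem head?_extendWalk {x y : V} (p : Γ.Walk x y) {l : List V} (hl : l.head? = some x) :
    (extendWalk Sq p l).head? = some y := by
  induction p generalizing l with
  | nil => exact hl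
  | cons h p ih => exact ih (SquareSystem.head?_extendPath _ _)

variable (hS : SquareSystem Γ Sq)
include hS

theorem SquareSystem.extendWalk_congr {x y : V} (p : Γ.Walk x y) {l l' : List V}
    (h : PathEquiv Sq l l') : PathEquiv Sq (extendWalk Sq p l) (extendWalk Sq p l') := by
  induction p generalizing l l' with
  | nil => exact h
  | cons _ p ih => exact ih (hS.extendPath_congr h _)

theorem SquareSystem.reducedPath_extendWalk {x y : V} (p : Γ.Walk x y) {l : List V}
    (hl : ReducedPath Γ Sq l) (hx : l.head? = some x) :
    ReducedPath Γ Sq (extendWalk Sq p l) := by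
  induction p generalizing l with
  | nil => exact hl
  | cons h p ih =>
    exact ih (hS.reducedPath_extendPath hl hx h) (SquareSystem.head?_extendPath _ _)

end

/-! ### Homotopy invariance of normal forms -/

namespace CubeComplex

variable {V : Type u}

/-- `a, b, c, d` are the consecutive vertices of a square of `X`. -/
def IsSquare (X : CubeComplex V) (a b c d : V) : Prop :=
  X.graph.Adj a b ∧ X.graph.Adj b c ∧ X.graph.Adj c d ∧ X.graph.Adj d a ∧ a ≠ c ∧ b ≠ d ∧
    ({a, b, c, d} : Set V) ∈ X.cubes

variable {X : CubeComplex V} (hS : SquareSystem X.graph X.IsSquare)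
  (hdeg : ∀ {a b c d : V}, X.graph.Adj a b → X.graph.Adj b c → X.graph.Adj a d →
    X.graph.Adj d c → {a, b, c, d} ∈ X.cubes → b ≠ d → a ≠ c)

include hS hdeg

/-- Classes of reduced paths play the role of points of the universal cover: walks act on them by
`extendWalk`, and each elementary homotopy leaves the action unchanged. -/
theorem extendWalk_homotopic {x y : V} {p q : X.graph.Walk x y} (h : X.Homotopic p q)
    {l : List V} (hl : ReducedPath X.graph X.IsSquare l) (hx : l.head? = some x) :
    PathEquiv X.IsSquare (extendWalk X.IsSquare p l) (extendWalk X.IsSquare q l) := by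
  have hne : ∀ {l : List V}, ReducedPath X.graph X.IsSquare l → l ≠ [] := by
    rintro _ (_ | _) <;> simp
  induction h generalizing l with
  | refl p => exact .refl (hne (hS.reducedPath_extendWalk _ hl hx))
  | symm _ ih => exact (ih hl hx).symm hS
  | trans _ _ ih1 ih2 => exact (ih1 hl hx).trans hS (ih2 hl hx)
  | cons h _ ih =>
    exact ih (hS.reducedPath_extendPath hl hx h) (SquareSystem.head?_extendPath _ _)
  | backtrack h p => exact hS.extendWalk_congr p (hS.extendPath_backtrack hl hx)
  | @square a b c d z hab hbc had hdc hsq p =>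
    refine hS.extendWalk_congr p ?_
    -- `Homotopic.square` admits degenerate quadruples; `b = d` is harmless and `hdeg` rules out `a
    -- = c` otherwise.
    by_cases hbd : b = d
    · subst hbd
      exact .refl (by
        rw [Ne, ← List.head?_eq_none_iff, SquareSystem.head?_extendPath]; simp)
    · exact hS.extendPath_square
        ⟨hab, hbc, hdc.symm, had.symm, hdeg hab hbc had hdc hsq hbd, hbd, hsq⟩ hx

/-- Evaluate `p`, then `q` backwards, then `q`: contracting the first two legs leaves `q`,
contracting the last two leaves `p`. -/
theorem extendWalk_equiv (hX : X.SimplyConnected) {x y : V} (p q : X.graph.Walk x y) :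
    PathEquiv X.IsSquare (extendWalk X.IsSquare p [x]) (extendWalk X.IsSquare q [x]) := by
  have h1 := extendWalk_homotopic hS hdeg (hX.2 x (p.append q.reverse)) (.single x) rfl
  have h2 := hS.extendWalk_congr q h1
  have h3 := extendWalk_homotopic hS hdeg (hX.2 y (q.reverse.append q))
    (hS.reducedPath_extendWalk p (.single x) rfl) (head?_extendWalk p rfl)
  rw [extendWalk_append] at h2 h3
  exact (h3.symm hS).trans hS h2

end CubeComplex

/-! ### Distances read off from normal forms -/

/-- The connected graph `Γ`, with the squares `Sq`, is bipartite and satisfies the quadrangle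
condition. -/
structure SquareComplexGraph {V : Type u} (Γ : SimpleGraph V) (Sq : V → V → V → V → Prop) : Prop
    extends SquareSystem Γ Sq where
  connected : Γ.Connected
  dist_ne : ∀ (v : V) {a b : V}, Γ.Adj a b → Γ.dist v a ≠ Γ.dist v b
  quadrangle : ∀ (v : V) {a b d : V}, Γ.Adj a b → Γ.Adj a d → b ≠ d →
    Γ.dist v b < Γ.dist v a → Γ.dist v d < Γ.dist v a →
    ∃ c, Sq a b c d ∧ Γ.dist v c + 2 = Γ.dist v a

namespace SquareSystem

variable {V : Type u} {Γ : SimpleGraph V} {Sq : V → V → V → V → Prop} (hS : SquareSystem Γ Sq)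
include hS

theorem getLast?_extendPath {p : List V} {z : V} (hp : p ≠ []) :
    (extendPath Sq p z).getLast? = p.getLast? := by
  by_cases h : Descends Sq p z
  · obtain ⟨y, r, h⟩ := h
    rw [(hS.extendPath_of_equiv h).getLast?_eq, h.getLast?_eq, List.getLast?_cons_cons]
  · rw [extendPath_of_not_descends h, List.getLast?_cons_of_ne_nil hp]

theorem getLast?_extendWalk {x y : V} (p : Γ.Walk x y) {l : List V} (hl : l ≠ []) :
    (extendWalk Sq p l).getLast? = l.getLast? := by
  induction p generalizing l with
  | nil => rfl
  | @cons _ z _ h p ih =>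
    have : extendPath Sq l z ≠ [] := by
      rw [Ne, ← List.head?_eq_none_iff, head?_extendPath]; simp
    rw [extendWalk, ih this, hS.getLast?_extendPath hl]

theorem length_extendPath (p : List V) (z : V) :
    (extendPath Sq p z).length ≤ p.length + 1 := by
  by_cases h : Descends Sq p z
  · obtain ⟨y, r, h⟩ := h
    have h1 := (hS.extendPath_of_equiv h).length_eq
    have h2 := h.length_eq
    simp only [List.length_cons] at h1 h2
    omega
  · rw [extendPath_of_not_descends h, List.length_cons]

theorem length_extendWalk {x y : V} (p : Γ.Walk x y) (l : List V) :
    (extendWalk Sq p l).length ≤ l.length + p.length := by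
  induction p generalizing l with
  | nil => simp [extendWalk]
  | @cons _ z _ h p ih =>
    have h1 := ih (extendPath Sq l z)
    have h2 := hS.length_extendPath l z
    rw [extendWalk, SimpleGraph.Walk.length_cons]
    omega

theorem exists_walk_of_reducedPath {l : List V} (hl : ReducedPath Γ Sq l) {x y : V}
    (hy : l.head? = some y) (hx : l.getLast? = some x) :
    ∃ p : Γ.Walk x y, p.length + 1 = l.length ∧ PathEquiv Sq (extendWalk Sq p [x]) l := by
  induction hl generalizing y with
  | single v =>
    simp only [List.head?_cons, Option.some.injEq, List.getLast?_singleton] at hy hx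
    subst hy hx
    exact ⟨.nil, rfl, .single v⟩
  | @cons y' a p hp hya hd ih =>
    simp only [List.head?_cons, Option.some.injEq] at hy
    subst hy
    rw [List.getLast?_cons_cons] at hx
    obtain ⟨w, hw, he⟩ := ih rfl hx
    refine ⟨w.concat hya.symm, by simp [hw], ?_⟩
    rw [SimpleGraph.Walk.concat_eq_append, extendWalk_append]
    have := hS.extendPath_congr he y'
    rwa [extendPath_of_not_descends hd] at this

/-- Normal forms depend only on the endpoints and are no longer than any walk, so reduced paths are
geodesics. A further step changes their length by exactly one, which is bipartiteness; two different
descents from one vertex span a square, which is the quadrangle condition. -/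
theorem squareComplexGraph (hc : Γ.Connected)
    (he : ∀ {x y : V} (p q : Γ.Walk x y), PathEquiv Sq (extendWalk Sq p [x])
      (extendWalk Sq q [x])) : SquareComplexGraph Γ Sq := by
  have key : ∀ {l : List V}, ReducedPath Γ Sq l → ∀ {x y : V}, l.head? = some y →
      l.getLast? = some x → l.length = Γ.dist x y + 1 := by
    intro l hl x y hy hx
    obtain ⟨p, hp, hpl⟩ := hS.exists_walk_of_reducedPath hl hy hx
    obtain ⟨q, hq⟩ := hc.exists_walk_length_eq_dist x y
    have h1 := (he p q).length_eq
    have h2 := hS.length_extendWalk q [x]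
    have h3 := hpl.length_eq
    have h4 := SimpleGraph.dist_le p
    simp only [List.length_singleton] at h2
    omega
  have walk : ∀ x y : V, ∃ l, ReducedPath Γ Sq l ∧ l.head? = some y ∧ l.getLast? = some x := by
    intro x y
    obtain ⟨p⟩ := hc.preconnected x y
    exact ⟨extendWalk Sq p [x], hS.reducedPath_extendWalk p (.single x) rfl,
      head?_extendWalk p rfl, hS.getLast?_extendWalk p (by simp)⟩
  have ext : ∀ {x a b : V} {l : List V}, ReducedPath Γ Sq l → l.head? = some a →
      l.getLast? = some x → Γ.Adj a b → (Descends Sq l b ∧ Γ.dist x b + 1 = Γ.dist x a) ∨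
        Γ.dist x b = Γ.dist x a + 1 := by
    intro x a b l hl ha hx hab
    have hne : l ≠ [] := by rintro rfl; simp at ha
    have h1 := key hl ha hx
    have h2 := key (hS.reducedPath_extendPath hl ha hab) (head?_extendPath _ _)
      ((hS.getLast?_extendPath hne).trans hx)
    by_cases hd : Descends Sq l b
    · refine .inl ⟨hd, ?_⟩
      obtain ⟨y, r, hr⟩ := hd
      have h3 := (hS.extendPath_of_equiv hr).length_eq
      have h4 := hr.length_eq
      simp only [List.length_cons] at h3 h4
      omega
    · rw [extendPath_of_not_descends hd, List.length_cons] at h2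
      exact .inr (by omega)
  refine { hS with connected := hc, dist_ne := ?_, quadrangle := ?_ }
  · intro v a b hab
    obtain ⟨l, hl, ha, hx⟩ := walk v a
    rcases ext hl ha hx hab with h | h <;> omega
  · intro v a b d hab had hbd hb hd
    obtain ⟨l, hl, ha, hx⟩ := walk v a
    obtain ⟨⟨a1, r1, h1⟩, -⟩ : Descends Sq l b ∧ _ := by
      rcases ext hl ha hx hab with h | h
      · exact h
      · omega
    obtain ⟨⟨a2, r2, h2⟩, -⟩ : Descends Sq l d ∧ _ := by
      rcases ext hl ha hx had with h | h
      · exact h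
      · omega
    have e1 := ha.symm.trans h1.head?_eq
    have e2 := ha.symm.trans h2.head?_eq
    simp only [List.head?_cons, Option.some.injEq] at e1 e2
    subst e1 e2
    obtain ⟨u, s, hu, k1, -⟩ := ((h1.symm hS).trans hS h2).exists_square hbd
    refine ⟨u, hu, ?_⟩
    have k : PathEquiv Sq l (a :: b :: u :: s) := h1.trans hS (.cons a k1)
    have hr := (hS.reducedPath_congr k).1 hl
    have hr' : ReducedPath Γ Sq (u :: s) := by
      cases hr with
      | cons hr _ _ => cases hr with
        | cons hr _ _ => exact hr
    have g1 := key hl ha hx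
    have g2 := key hr' (x := v) rfl (by
      rw [← hx, k.getLast?_eq, List.getLast?_cons_cons, List.getLast?_cons_cons])
    have g3 := k.length_eq
    simp only [List.length_cons] at g2 g3
    omega

end SquareSystem

/-! ### Squares of a two-dimensional complex with flag links -/

namespace CubeComplex

variable {V : Type u} {X : CubeComplex V}

theorem adj_chart_iff {k : ℕ} {φ : (Fin k → Bool) → V} (hφ : IsCubeChart X.cubes φ)
    (ε ε' : Fin k → Bool) :
    X.graph.Adj (φ ε) (φ ε') ↔ ∃ i, ε' = Function.update ε i (!ε i) := by
  have himg : ({φ ε, φ ε'} : Set V) = φ '' {ε, ε'} := by rw [Set.image_pair]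
  have hsub : ({φ ε, φ ε'} : Set V) ⊆ Set.range φ := by
    rw [himg]; exact Set.image_subset_range _ _
  constructor
  · rintro ⟨hne, hc⟩
    obtain ⟨F, ⟨p, hp⟩, hF⟩ := (hφ.2 _ hsub).1 hc
    have hF' : F = {ε, ε'} := by
      rw [himg] at hF
      exact (hφ.1.image_injective hF).symm
    have hεF : ∀ i b, p i = some b → ε i = b := by
      have : ε ∈ F := by rw [hF']; simp
      rwa [hp] at this
    have hεF' : ∀ i b, p i = some b → ε' i = b := by
      have : ε' ∈ F := by rw [hF']; simp
      rwa [hp] at this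
    have hne' : ε ≠ ε' := fun h => hne (by rw [h])
    obtain ⟨i, hi⟩ := Function.ne_iff.1 hne'
    -- Changing a coordinate on which the two points differ stays in the face, so it must produce
    -- its only other vertex.
    have hmem : Function.update ε i (!ε i) ∈ F := by
      rw [hp]
      intro j b hj
      by_cases hji : j = i
      · subst hji
        exact absurd ((hεF j b hj).trans (hεF' j b hj).symm) hi
      · rw [Function.update_of_ne hji]
        exact hεF j b hj
    rw [hF'] at hmem
    rcases hmem with h | h
    · have := congrFun h i
      simp at this
    · exact ⟨i, h.symm⟩
  · rintro ⟨i, rfl⟩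
    refine ⟨fun h => ?_, ?_⟩
    · have := congrFun (hφ.1 h) i
      simp at this
    · refine (hφ.2 _ hsub).2 ⟨_, ⟨fun j => if j = i then none else some (ε j), rfl⟩, ?_⟩
      rw [himg]
      congr 1
      ext δ
      simp only [Set.mem_insert_iff, Set.mem_singleton_iff, Set.mem_ofPred_eq]
      constructor
      · rintro (rfl | rfl) j b hj
        · split_ifs at hj with h
          simpa using hj
        · split_ifs at hj with h
          rw [Function.update_of_ne h]
          simpa using hj
      · intro h
        have hj : ∀ j, j ≠ i → δ j = ε j := fun j hji => h j (ε j) (by simp [hji])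
        by_cases hi : δ i = ε i
        · left
          funext j
          by_cases hji : j = i
          · rw [hji, hi]
          · exact hj j hji
        · right
          funext j
          by_cases hji : j = i
          · subst hji
            rw [Function.update_self]
            revert hi
            cases δ j <;> cases ε j <;> simp
          · rw [Function.update_of_ne hji, hj j hji]

theorem ncard_neighbors_chart {k : ℕ} {φ : (Fin k → Bool) → V} (hφ : IsCubeChart X.cubes φ)
    (ε : Fin k → Bool) : {x | x ∈ Set.range φ ∧ X.graph.Adj (φ ε) x}.ncard = k := by
  have : {x | x ∈ Set.range φ ∧ X.graph.Adj (φ ε) x} =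
      (fun i => φ (Function.update ε i (!ε i))) '' (Set.univ : Set (Fin k)) := by
    ext x
    simp only [Set.mem_ofPred_eq, Set.image_univ, Set.mem_range]
    constructor
    · rintro ⟨⟨ε', rfl⟩, h⟩
      obtain ⟨i, rfl⟩ := (adj_chart_iff hφ _ _).1 h
      exact ⟨i, rfl⟩
    · rintro ⟨i, rfl⟩
      exact ⟨⟨_, rfl⟩, (adj_chart_iff hφ _ _).2 ⟨i, rfl⟩⟩
  rw [this, Set.ncard_image_of_injective, Set.ncard_univ, Nat.card_eq_fintype_card,
    Fintype.card_fin]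
  intro i j hij
  by_contra hne
  have := congrFun (hφ.1 hij) i
  rw [Function.update_self, Function.update_of_ne hne] at this
  simp at this

theorem ncard_range_chart {k : ℕ} {φ : (Fin k → Bool) → V} (hφ : IsCubeChart X.cubes φ) :
    (Set.range φ).ncard = 2 ^ k := by
  rw [← Set.image_univ, Set.ncard_image_of_injective _ hφ.1, Set.ncard_univ,
    Nat.card_eq_fintype_card]
  simp

/-- The number of vertices of a cube is a power of two. -/
theorem triple_notMem_cubes {a b c : V} (hab : a ≠ b) (hac : a ≠ c) (hbc : b ≠ c) :
    ({a, b, c} : Set V) ∉ X.cubes := by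
  intro h
  obtain ⟨k, φ, hφ, hr⟩ := X.exists_chart _ h
  have h1 := ncard_range_chart hφ
  rw [hr, Set.ncard_eq_three.2 ⟨a, b, c, hab, hac, hbc, rfl⟩] at h1
  rcases k with _ | _ | k
  · simp at h1
  · simp at h1
  · have := Nat.one_le_two_pow (n := k)
    rw [pow_succ, pow_succ] at h1
    omega

theorem IsSquare.pair_mem_link {a b c d : V} (h : X.IsSquare a b c d) :
    ({b, d} : Set V) ∈ X.link a := by
  obtain ⟨hab, hbc, hcd, hda, hac, hbd, hs⟩ := h
  refine ⟨_, hs, by simp, ?_⟩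
  obtain ⟨k, φ, hφ, hr⟩ := X.exists_chart _ hs
  have h4 : ({a, b, c, d} : Set V).ncard = 4 := by
    rw [Set.ncard_insert_of_notMem, Set.ncard_eq_three.2 ⟨b, c, d, hbc.ne, hbd, hcd.ne, rfl⟩]
    simp [hab.ne, hac, hda.ne.symm]
  have hk : k = 2 := by
    have h1 := ncard_range_chart hφ
    rw [hr, h4] at h1
    exact (Nat.pow_right_injective (le_refl 2) (h1.symm.trans (by norm_num : 4 = 2 ^ 2)))
  subst hk
  obtain ⟨ε, rfl⟩ : a ∈ Set.range φ := by rw [hr]; simp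
  have h2 := ncard_neighbors_chart hφ ε
  have hfin : {x | x ∈ Set.range φ ∧ X.graph.Adj (φ ε) x}.Finite :=
    (Set.finite_range φ).subset fun x hx => hx.1
  rw [hr] at h2 hfin
  refine Set.eq_of_subset_of_ncard_le ?_ ?_ hfin
  · rintro x (rfl | rfl)
    · exact ⟨by simp, hab⟩
    · exact ⟨by simp, hda.symm⟩
  · rw [h2, Set.ncard_pair hbd]

/-- Two squares sharing exactly the three vertices `a`, `b`, `d` would meet in a cube with three
vertices. A triangle in a link would, by flagness, be filled by a cube of dimension three. -/
theorem squareSystem (hX : X.LinksFlag) (hd : X.DimLE 2) :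
    SquareSystem X.graph X.IsSquare where
  rotate := by
    rintro a b c d ⟨h1, h2, h3, h4, h5, h6, h7⟩
    refine ⟨h2, h3, h4, h1, h6, h5.symm, ?_⟩
    convert h7 using 1
    ext; simp; tauto
  reflect := by
    rintro a b c d ⟨h1, h2, h3, h4, h5, h6, h7⟩
    refine ⟨h4.symm, h3.symm, h2.symm, h1.symm, h5, h6.symm, ?_⟩
    convert h7 using 1
    ext; simp; tauto
  adj := fun h => h.1
  ne := fun h => h.2.2.2.2.1
  unique := by
    rintro a b c c' d ⟨h1, h2, h3, h4, h5, h6, h7⟩ ⟨-, g2, g3, -, g5, -, g7⟩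
    by_contra hcc
    have h8 := X.inter_mem _ h7 _ g7 ⟨a, by simp, by simp⟩
    have : ({a, b, c, d} ∩ {a, b, c', d} : Set V) = {a, b, d} := by
      ext x
      simp only [Set.mem_inter_iff, Set.mem_insert_iff, Set.mem_singleton_iff]
      constructor
      · rintro ⟨h, h'⟩
        by_contra hx
        push Not at hx
        simp only [hx.1, hx.2.1, hx.2.2, false_or, or_false] at h h'
        exact hcc (h.symm.trans h')
      · tauto
    rw [this] at h8
    exact triple_notMem_cubes h1.ne h4.ne.symm h6 h8
  not_triangle := by
    intro a b c d x y z h1 h2 h3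
    have hbc := h1.2.2.2.2.2.1
    have hcd := h2.2.2.2.2.2.1
    have hbd := h3.2.2.2.2.2.1
    have hadj : ∀ e ∈ ({b, c, d} : Set V), X.graph.Adj a e := by
      rintro e (rfl | rfl | rfl)
      · exact h1.1
      · exact h2.1
      · exact h2.2.2.2.1.symm
    have k1 := h1.pair_mem_link
    have k2 := h2.pair_mem_link
    have k3 := h3.pair_mem_link
    have k1' := k1; have k2' := k2; have k3' := k3
    rw [Set.pair_comm] at k1' k2' k3'
    obtain ⟨s, hs, has, hN⟩ := hX a {b, c, d} (by simp) hadj (by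
      rintro e (rfl | rfl | rfl) f (rfl | rfl | rfl) hef <;>
        first | exact absurd rfl hef | assumption)
    obtain ⟨k, φ, hφ, rfl⟩ := X.exists_chart _ hs
    obtain ⟨ε, rfl⟩ := has
    have h5 := ncard_neighbors_chart hφ ε
    rw [← hN, Set.ncard_eq_three.2 ⟨b, c, d, hbc, hbd, hcd, rfl⟩] at h5
    have := hd k φ hφ
    omega

theorem IsCAT0.squareComplexGraph (hX : X.IsCAT0) (hd : X.DimLE 2) :
    SquareComplexGraph X.graph X.IsSquare := by
  have hS := squareSystem hX.linksFlag hd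
  refine hS.squareComplexGraph hX.simplyConnected.1
    (extendWalk_equiv hS ?_ hX.simplyConnected)
  rintro a b c d hab hbc had hdc hs hbd rfl
  refine triple_notMem_cubes (X := X) hab.ne had.ne hbd ?_
  convert hs using 1
  ext; simp; tauto

end CubeComplex

/-! ## Halfspaces -/

/-- The vertices closer to `b` than to `a`. -/
def halfspace {V : Type u} (Γ : SimpleGraph V) (a b : V) : Set V :=
  {v | Γ.dist v b < Γ.dist v a}

/-- The sides of all edges. -/
def halfspaces {V : Type u} (Γ : SimpleGraph V) : Set (Set V) :=
  {h | ∃ a b, Γ.Adj a b ∧ h = halfspace Γ a b}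

/-- A set of vertices which contains all geodesics between its points. -/
def GeodesicallyConvex {V : Type u} (Γ : SimpleGraph V) (C : Set V) : Prop :=
  ∀ x ∈ C, ∀ y ∈ C, ∀ e, Γ.dist x e + Γ.dist e y = Γ.dist x y → e ∈ C

/-- All four intersections of sides are nonempty. -/
def Crosses {V : Type u} (h k : Set V) : Prop :=
  (h ∩ k).Nonempty ∧ (h ∩ kᶜ).Nonempty ∧ (hᶜ ∩ k).Nonempty ∧ (hᶜ ∩ kᶜ).Nonempty

theorem GeodesicallyConvex.inter {V : Type u} {Γ : SimpleGraph V} {C D : Set V}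
    (hC : GeodesicallyConvex Γ C) (hD : GeodesicallyConvex Γ D) :
    GeodesicallyConvex Γ (C ∩ D) :=
  fun x hx y hy e he => ⟨hC x hx.1 y hy.1 e he, hD x hx.2 y hy.2 e he⟩

theorem GeodesicallyConvex.biInter {V : Type u} {Γ : SimpleGraph V} {S : Set (Set V)}
    (hS : ∀ s ∈ S, GeodesicallyConvex Γ s) : GeodesicallyConvex Γ (⋂ s ∈ S, s) := by
  intro x hx y hy e he
  simp only [Set.mem_iInter] at *
  exact fun s hs => hS s hs x (hx s hs) y (hy s hs) e he

namespace SquareComplexGraph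

variable {V : Type u} {Γ : SimpleGraph V} {Sq : V → V → V → V → Prop}
  (hG : SquareComplexGraph Γ Sq)
include hG

theorem dist_adj (v : V) {a b : V} (h : Γ.Adj a b) :
    Γ.dist v b = Γ.dist v a + 1 ∨ Γ.dist v b + 1 = Γ.dist v a := by
  have h1 := hG.dist_ne v h
  have h2 := hG.connected.dist_triangle (u := v) (v := a) (w := b)
  have h3 := hG.connected.dist_triangle (u := v) (v := b) (w := a)
  rw [SimpleGraph.dist_eq_one_iff_adj.2 h] at h2
  rw [SimpleGraph.dist_eq_one_iff_adj.2 h.symm] at h3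
  omega

theorem dist_adj' (v : V) {a b : V} (h : Γ.Adj a b) :
    Γ.dist b v = Γ.dist a v + 1 ∨ Γ.dist b v + 1 = Γ.dist a v := by
  rw [Γ.dist_comm (u := b), Γ.dist_comm (u := a)]
  exact hG.dist_adj v h

theorem exists_adj_closer {x y : V} (h : x ≠ y) :
    ∃ z, Γ.Adj x z ∧ Γ.dist z y + 1 = Γ.dist x y := by
  obtain ⟨p, hp⟩ := hG.connected.exists_walk_length_eq_dist x y
  cases p with
  | nil => exact absurd rfl h
  | @cons _ z _ hxz q =>
    refine ⟨z, hxz, ?_⟩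
    have h1 := SimpleGraph.dist_le q
    have h2 := hG.dist_adj' y hxz
    rw [SimpleGraph.Walk.length_cons] at hp
    omega

theorem compl_halfspace {a b : V} (h : Γ.Adj a b) : (halfspace Γ a b)ᶜ = halfspace Γ b a := by
  ext v
  have := hG.dist_adj v h
  simp only [halfspace, Set.mem_compl_iff, Set.mem_ofPred_eq]
  omega

theorem compl_mem_halfspaces {h : Set V} (hh : h ∈ halfspaces Γ) : hᶜ ∈ halfspaces Γ := by
  obtain ⟨a, b, hab, rfl⟩ := hh
  exact ⟨b, a, hab.symm, hG.compl_halfspace hab⟩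

omit hG in
theorem mem_halfspace_right {a b : V} (h : Γ.Adj a b) : b ∈ halfspace Γ a b := by
  simp only [halfspace, Set.mem_ofPred_eq, SimpleGraph.dist_self]
  rw [SimpleGraph.dist_eq_one_iff_adj.2 h.symm]
  omega

omit hG in
theorem notMem_halfspace_left (a b : V) : a ∉ halfspace Γ a b := by
  simp [halfspace]

/-- When both neighbours of `a` or of `b` are closer to `v`, the quadrangle condition fixes the
distance to the opposite corner; adjacency settles the remaining cases. -/
theorem halfspace_parallel {a b c d : V} (hs : Sq a b c d) :
    halfspace Γ a b = halfspace Γ d c := by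
  ext v
  simp only [halfspace, Set.mem_ofPred_eq]
  have e1 := hG.adj hs
  have e2 := hG.adj (hG.rotate hs)
  have e3 := hG.adj (hG.rotate (hG.rotate hs))
  have e4 := hG.adj (hG.rotate (hG.rotate (hG.rotate hs)))
  have hac := hG.ne hs
  have hbd := hG.ne (hG.rotate hs)
  have h1 := hG.dist_adj v e1
  have h2 := hG.dist_adj v e2
  have h3 := hG.dist_adj v e3
  have h4 := hG.dist_adj v e4
  have k1 : Γ.dist v b < Γ.dist v a → Γ.dist v d < Γ.dist v a → Γ.dist v c + 2 = Γ.dist v a := by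
    intro hb hd
    obtain ⟨e, he, hd⟩ := hG.quadrangle v e1 e4.symm hbd hb hd
    rwa [hG.unique hs he]
  have k2 : Γ.dist v a < Γ.dist v b → Γ.dist v c < Γ.dist v b → Γ.dist v d + 2 = Γ.dist v b := by
    intro hb hd
    obtain ⟨e, he, hd⟩ := hG.quadrangle v e1.symm e2 hac hb hd
    have : d = e := hG.unique (hG.reflect (hG.rotate hs)) he
    rwa [this]
  omega

/-- An edge which crosses a halfspace determines it. -/
theorem halfspace_eq_of_crossing {a b p q : V} (hab : Γ.Adj a b) (hpq : Γ.Adj p q)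
    (hp : p ∈ halfspace Γ a b) (hq : q ∉ halfspace Γ a b) :
    halfspace Γ a b = halfspace Γ q p := by
  induction hn : Γ.dist p b generalizing p q with
  | zero =>
    have hpb : p = b := hG.connected.dist_eq_zero_iff.1 hn
    subst hpb
    have h1 := hG.dist_adj q hab
    simp only [halfspace, Set.mem_ofPred_eq] at hq
    rw [SimpleGraph.dist_eq_one_iff_adj.2 hpq.symm] at h1 hq
    have : q = a := hG.connected.dist_eq_zero_iff.1 (by omega)
    rw [this]
  | succ k ih =>
    have hpb : p ≠ b := by
      rintro rfl
      simp at hn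
    obtain ⟨p', hpp', hp'⟩ := hG.exists_adj_closer hpb
    simp only [halfspace, Set.mem_ofPred_eq] at hp hq
    have h1 := hG.dist_adj p hab
    have h2 := hG.dist_adj q hab
    have h3 := hG.dist_adj p' hab
    have h4 := hG.dist_adj' a hpq
    have h5 := hG.dist_adj' b hpq
    have h6 := hG.dist_adj' a hpp'
    have hne : q ≠ p' := by
      rintro rfl
      omega
    -- Seen from `a`, both `q` and `p'` are closer than `p`; their square carries the crossing edge
    -- to a parallel one whose inner end is nearer to `b`.
    obtain ⟨r, hr, hrd⟩ := hG.quadrangle a hpq hpp' hne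
      (by rw [Γ.dist_comm (u := a), Γ.dist_comm (u := a)]; omega)
      (by rw [Γ.dist_comm (u := a), Γ.dist_comm (u := a)]; omega)
    rw [Γ.dist_comm (u := a), Γ.dist_comm (u := a)] at hrd
    have hqr := hG.adj (hG.rotate hr)
    have hrp := hG.adj (hG.rotate (hG.rotate hr))
    have h7 := hG.dist_adj' b hqr
    have h8 := hG.dist_adj r hab
    have := ih hrp.symm (by simp only [halfspace, Set.mem_ofPred_eq]; omega)
      (by simp only [halfspace, Set.mem_ofPred_eq]; omega) (by omega)
    rw [this]
    exact (hG.halfspace_parallel (hG.reflect (hG.rotate hr))).symm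

theorem eq_halfspace_of_crossing {h : Set V} (hh : h ∈ halfspaces Γ) {p q : V}
    (hpq : Γ.Adj p q) (hp : p ∈ h) (hq : q ∉ h) : h = halfspace Γ q p := by
  obtain ⟨a, b, hab, rfl⟩ := hh
  exact hG.halfspace_eq_of_crossing hab hpq hp hq

/-- A geodesic which enters a set contains an entering edge. -/
theorem exists_crossing_edge (h : Set V) {e x : V} (he : e ∉ h) (hx : x ∈ h) :
    ∃ q p, Γ.Adj q p ∧ q ∉ h ∧ p ∈ h ∧ Γ.dist e q + 1 + Γ.dist p x = Γ.dist e x := by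
  induction hn : Γ.dist e x generalizing e with
  | zero => exact absurd (hG.connected.dist_eq_zero_iff.1 hn ▸ hx) he
  | succ n ih =>
    have hex : e ≠ x := by
      rintro rfl
      exact he hx
    obtain ⟨z, hez, hz⟩ := hG.exists_adj_closer hex
    by_cases hzh : z ∈ h
    · exact ⟨e, z, hez, he, hzh, by rw [SimpleGraph.dist_self]; omega⟩
    · obtain ⟨q, p, h1, h2, h3, h4⟩ := ih hzh (by omega)
      refine ⟨q, p, h1, h2, h3, ?_⟩
      have h5 := hG.dist_adj' q hez
      have h6 := hG.connected.dist_triangle (u := e) (v := q) (w := x)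
      have h7 := hG.connected.dist_triangle (u := q) (v := p) (w := x)
      rw [SimpleGraph.dist_eq_one_iff_adj.2 h1] at h7
      omega

/-- A geodesic leaving and re-entering `h` could be shortened: the re-entering edge determines `h`,
so the other endpoint `y` is closer to the inner end of that edge. -/
theorem convex_halfspace {h : Set V} (hh : h ∈ halfspaces Γ) : GeodesicallyConvex Γ h := by
  intro x hx y hy e he
  by_contra heh
  obtain ⟨q, p, h1, h2, h3, h4⟩ := hG.exists_crossing_edge h heh hx
  have h5 := hG.eq_halfspace_of_crossing hh h1.symm h3 h2
  rw [h5] at hy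
  simp only [halfspace, Set.mem_ofPred_eq] at hy
  have t1 := hG.connected.dist_triangle (u := y) (v := p) (w := x)
  have t2 := hG.connected.dist_triangle (u := y) (v := e) (w := q)
  have c1 := Γ.dist_comm (u := x) (v := e)
  have c2 := Γ.dist_comm (u := e) (v := y)
  have c3 := Γ.dist_comm (u := x) (v := y)
  omega

/-- Convex sets have gates. -/
theorem exists_gate {C : Set V} (hC : GeodesicallyConvex Γ C) (hne : C.Nonempty) (y : V) :
    ∃ z ∈ C, ∀ w ∈ C, Γ.dist y w = Γ.dist y z + Γ.dist z w := by
  obtain ⟨z, hz, hmin⟩ : ∃ z ∈ C, ∀ w ∈ C, Γ.dist y z ≤ Γ.dist y w := by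
    obtain ⟨z, hz⟩ := exists_minimalFor_of_wellFoundedLT (· ∈ C) (Γ.dist y) hne
    refine ⟨z, hz.1, fun w hw => ?_⟩
    by_contra hlt
    exact hlt (hz.2 hw (by omega))
  refine ⟨z, hz, fun w => ?_⟩
  induction hn : Γ.dist z w using Nat.strong_induction_on generalizing w with
  | _ n ih =>
  intro hw
  by_cases hzw : w = z
  · subst hzw
    simp at hn
    omega
  have c1 := Γ.dist_comm (u := z) (v := w)
  obtain ⟨w', hww', hw'⟩ := hG.exists_adj_closer hzw
  have c2 := Γ.dist_comm (u := z) (v := w')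
  have hw'C : w' ∈ C := hC w hw z hz w' (by
    rw [SimpleGraph.dist_eq_one_iff_adj.2 hww']; omega)
  have h1 := ih _ (by omega) w' rfl hw'C
  rcases hG.dist_adj y hww'.symm with h2 | h2
  · omega
  exfalso
  have h3 := hmin w hw
  have hzw' : w' ≠ z := by
    rintro rfl
    omega
  obtain ⟨w'', hw'', hd''⟩ := hG.exists_adj_closer hzw'
  have c3 := Γ.dist_comm (u := z) (v := w'')
  have hw''C : w'' ∈ C := hC w' hw'C z hz w'' (by
    rw [SimpleGraph.dist_eq_one_iff_adj.2 hw'']; omega)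
  have h4 := ih _ (by omega) w'' rfl hw''C
  have hne : w ≠ w'' := by
    rintro rfl
    omega
  -- If `w` were closer to `y` than `w'`, the fourth vertex `e` of this square would lie in `C` by
  -- convexity, at distance `dist z w'` from `z` but too close to `y` for the induction hypothesis.
  obtain ⟨e, hs, he⟩ := hG.quadrangle y hww'.symm hw'' hne (by omega) (by omega)
  have a1 := hG.adj (hG.rotate hs)
  have a2 := hG.adj (hG.rotate (hG.rotate hs))
  have hww'' : Γ.dist w w'' = 2 := by
    have t := hG.connected.dist_triangle (u := w) (v := w') (w := w'')
    rw [SimpleGraph.dist_eq_one_iff_adj.2 hww', SimpleGraph.dist_eq_one_iff_adj.2 hw''] at t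
    have t' := hG.connected.dist_triangle (u := z) (v := w'') (w := w)
    have c := Γ.dist_comm (u := w'') (v := w)
    omega
  have heC : e ∈ C := hC w hw w'' hw''C e (by
    rw [SimpleGraph.dist_eq_one_iff_adj.2 a1, SimpleGraph.dist_eq_one_iff_adj.2 a2, hww''])
  have h5 := hmin e heC
  have t := hG.dist_adj z a2.symm
  have t2 := hG.dist_adj z a1
  have h6 := ih (Γ.dist z e) (by omega) e rfl heC
  omega

/-- A halfspace which separates a point from its gate in a convex set avoids the set. -/
theorem notMem_of_gate {C h : Set V} (hh : h ∈ halfspaces Γ) {y z : V}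
    (hz : ∀ w ∈ C, Γ.dist y w = Γ.dist y z + Γ.dist z w) (hy : y ∈ h) (hzh : z ∉ h) :
    ∀ w ∈ C, w ∉ h :=
  fun w hw hwh => hzh (hG.convex_halfspace hh y hy w hwh z (hz w hw).symm)

/-- Such a halfspace is determined by an edge it crosses on a fixed geodesic from `x` to `y`. -/
theorem finite_separating (x y : V) : {h ∈ halfspaces Γ | x ∈ h ∧ y ∉ h}.Finite := by
  induction hn : Γ.dist x y generalizing x with
  | zero =>
    have := hG.connected.dist_eq_zero_iff.1 hn
    subst this
    convert Set.finite_empty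
    ext h
    simp only [Set.mem_ofPred_eq, Set.mem_empty_iff_false, iff_false]
    tauto
  | succ n ih =>
    have hxy : x ≠ y := by
      rintro rfl
      simp at hn
    obtain ⟨z, hxz, hz⟩ := hG.exists_adj_closer hxy
    refine ((ih z (by omega)).union (Set.finite_singleton (halfspace Γ z x))).subset ?_
    rintro h ⟨hh, hx, hy⟩
    by_cases hzh : z ∈ h
    · exact .inl ⟨hh, hzh, hy⟩
    · exact .inr (hG.eq_halfspace_of_crossing hh hxz hx hzh)

theorem exists_separating {x y : V} (hxy : x ≠ y) : ∃ h ∈ halfspaces Γ, x ∉ h ∧ y ∈ h := by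
  obtain ⟨z, hxz, hz⟩ := hG.exists_adj_closer hxy
  refine ⟨halfspace Γ x z, ⟨x, z, hxz, rfl⟩, notMem_halfspace_left _ _, ?_⟩
  simp only [halfspace, Set.mem_ofPred_eq]
  have c1 := Γ.dist_comm (u := y) (v := x)
  have c2 := Γ.dist_comm (u := y) (v := z)
  omega

/-- Halfspaces whose complements meet pairwise inside a convex set `C` have complements with a
common point in `C`, if each point of `C` lies in only finitely many of the halfspaces. -/
theorem helly {C : Set V} (hC : GeodesicallyConvex Γ C) (hne : C.Nonempty) {S : Set (Set V)}
    (hS : S ⊆ halfspaces Γ) (hfin : ∀ y ∈ C, {h ∈ S | y ∈ h}.Finite)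
    (hpair : ∀ h ∈ S, ∀ k ∈ S, (C ∩ (hᶜ ∩ kᶜ)).Nonempty) : ∃ y ∈ C, ∀ h ∈ S, y ∉ h := by
  -- Minimize the number of members of `S` containing the point: passing to the gate in `C ∩ hᶜ`
  -- leaves `h` and enters no other member.
  obtain ⟨y, hy, hmin⟩ := exists_minimalFor_of_wellFoundedLT (· ∈ C)
    (fun y => {h ∈ S | y ∈ h}.ncard) hne
  refine ⟨y, hy, fun h hh hyh => ?_⟩
  obtain ⟨z, hz, hgate⟩ := hG.exists_gate
    (hC.inter (hG.convex_halfspace (hG.compl_mem_halfspaces (hS hh))))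
    (by obtain ⟨w, hw⟩ := hpair h hh h hh; exact ⟨w, hw.1, hw.2.1⟩) y
  have hlt : {k ∈ S | z ∈ k} ⊂ {k ∈ S | y ∈ k} := by
    refine ⟨?_, fun hsub => hz.2 (hsub ⟨hh, hyh⟩ : h ∈ {k ∈ S | z ∈ k}).2⟩
    rintro k ⟨hk, hzk⟩
    refine ⟨hk, ?_⟩
    by_contra hyk
    obtain ⟨w, hwC, hwh, hwk⟩ := hpair h hh k hk
    exact hG.notMem_of_gate (hG.compl_mem_halfspaces (hS hk)) hgate hyk
      (fun h => h hzk) w ⟨hwC, hwh⟩ hwk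
  have h1 := Set.ncard_lt_ncard hlt (hfin y hy)
  have h2 := hmin hz.1 h1.le
  simp only at h2
  omega

end SquareComplexGraph

/-! ### Boundaries of halfspaces and crossing triples -/

/-- The vertices outside `h` which have a neighbour in `h`. -/
def outerBoundary {V : Type u} (Γ : SimpleGraph V) (h : Set V) : Set V :=
  {p | p ∉ h ∧ ∃ q ∈ h, Γ.Adj p q}

namespace SquareComplexGraph

variable {V : Type u} {Γ : SimpleGraph V} {Sq : V → V → V → V → Prop}
  (hG : SquareComplexGraph Γ Sq)
include hG

theorem exists_edge_in {A : Set V} (hA : GeodesicallyConvex Γ A) (h : Set V)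
    (h1 : (A ∩ h).Nonempty) (h2 : (A ∩ hᶜ).Nonempty) :
    ∃ q p, Γ.Adj q p ∧ q ∈ A ∧ p ∈ A ∧ q ∉ h ∧ p ∈ h := by
  obtain ⟨x, hxA, hx⟩ := h1
  obtain ⟨e, heA, he⟩ := h2
  obtain ⟨q, p, hqp, hq, hp, hd⟩ := hG.exists_crossing_edge h he hx
  have t1 := hG.connected.dist_triangle (u := q) (v := p) (w := x)
  have t2 := hG.connected.dist_triangle (u := e) (v := q) (w := x)
  have t3 := hG.connected.dist_triangle (u := e) (v := q) (w := p)
  have t4 := hG.connected.dist_triangle (u := e) (v := p) (w := x)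
  rw [SimpleGraph.dist_eq_one_iff_adj.2 hqp] at t1 t3
  exact ⟨q, p, hqp, hA e heA x hxA q (by omega), hA e heA x hxA p (by omega), hq, hp⟩

/-- It is enough to advance one edge `p e` along a geodesic to `p'`. The neighbour `q'` of `p'` in
`h` also lies on the side of `e`, so the quadrangle condition based at `q'` gives a square that
pushes the edge from `p` into `h` along to `e`. -/
theorem convex_outerBoundary {h : Set V} (hh : h ∈ halfspaces Γ) :
    GeodesicallyConvex Γ (outerBoundary Γ h) := by
  have step : ∀ {p p' e : V}, p ∈ outerBoundary Γ h → p' ∈ outerBoundary Γ h → Γ.Adj p e →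
      Γ.dist e p' + 1 = Γ.dist p p' → e ∈ outerBoundary Γ h := by
    rintro p p' e ⟨hp, q, hq, hpq⟩ ⟨hp', q', hq', hpq'⟩ hpe hd
    have heh : e ∉ h := hG.convex_halfspace (hG.compl_mem_halfspaces hh) p hp p' hp' e (by
      rw [SimpleGraph.dist_eq_one_iff_adj.2 hpe]; omega)
    refine ⟨heh, ?_⟩
    have e1 := hG.eq_halfspace_of_crossing hh hpq.symm hq hp
    have e2 := hG.eq_halfspace_of_crossing hh hpq'.symm hq' hp'
    have hk : halfspace Γ p e ∈ halfspaces Γ := ⟨p, e, hpe, rfl⟩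
    have hp'k : p' ∈ halfspace Γ p e := by
      simp only [halfspace, Set.mem_ofPred_eq]
      rw [Γ.dist_comm (u := p'), Γ.dist_comm (u := p')]
      omega
    have hq'k : q' ∈ halfspace Γ p e := by
      by_contra hq'k
      have e3 := hG.eq_halfspace_of_crossing hk hpq' hp'k hq'k
      have : p ∈ hᶜ := hp
      rw [e2, hG.compl_halfspace hpq', ← e3] at this
      exact notMem_halfspace_left _ _ this
    have hne : q ≠ e := by
      rintro rfl
      exact heh hq
    obtain ⟨f, hf, -⟩ := hG.quadrangle q' hpq hpe hne (by rw [e1] at hq'; exact hq') hq'k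
    refine ⟨f, ?_, (hG.adj (hG.rotate (hG.rotate hf))).symm⟩
    rw [e1, hG.halfspace_parallel hf]
    exact mem_halfspace_right (hG.adj (hG.rotate (hG.rotate hf))).symm
  intro x hx y hy e he
  induction hn : Γ.dist x e generalizing x with
  | zero => exact hG.connected.dist_eq_zero_iff.1 hn ▸ hx
  | succ n ih =>
    have hxe : x ≠ e := by
      rintro rfl
      simp at hn
    obtain ⟨z, hxz, hz⟩ := hG.exists_adj_closer hxe
    have t1 := hG.connected.dist_triangle (u := z) (v := e) (w := y)
    have t2 := hG.dist_adj' y hxz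
    exact ih z (step hx hy hxz (by omega)) (by omega) (by omega)

theorem exists_square_of_crosses {h k : Set V} (hh : h ∈ halfspaces Γ) (hk : k ∈ halfspaces Γ)
    {p q r : V} (hpq : Γ.Adj p q) (hpr : Γ.Adj p r) (hph : p ∉ h) (hqh : q ∈ h) (hpk : p ∉ k)
    (hrk : r ∈ k) (hne : h ≠ k) (hhk : (h ∩ k).Nonempty) :
    ∃ e, Sq p q e r ∧ e ∈ h ∧ e ∈ k := by
  have e1 := hG.eq_halfspace_of_crossing hh hpq.symm hqh hph
  have e2 := hG.eq_halfspace_of_crossing hk hpr.symm hrk hpk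
  have hqr : q ≠ r := by
    rintro rfl
    exact hne (e1.trans e2.symm)
  obtain ⟨v, hvh, hvk⟩ := hhk
  rw [e1] at hvh
  rw [e2] at hvk
  obtain ⟨e, he, -⟩ := hG.quadrangle v hpq hpr hqr hvh hvk
  refine ⟨e, he, ?_, ?_⟩
  · rw [e1, hG.halfspace_parallel he]
    exact mem_halfspace_right (hG.adj (hG.rotate (hG.rotate he))).symm
  · rw [e2, hG.halfspace_parallel (hG.reflect he)]
    exact mem_halfspace_right (hG.adj (hG.rotate he))

theorem exists_mem_outerBoundary {h A : Set V} (hA : GeodesicallyConvex Γ A)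
    (h1 : (A ∩ h).Nonempty) (h2 : (A ∩ hᶜ).Nonempty) : (outerBoundary Γ h ∩ A).Nonempty := by
  obtain ⟨q, p, hqp, hqA, hpA, hq, hp⟩ := hG.exists_edge_in hA h h1 h2
  exact ⟨q, ⟨hq, p, hp, hqp⟩, hqA⟩

/-- No three halfspaces cross pairwise. -/
theorem not_three_crossing {h₁ h₂ h₃ : Set V} (m₁ : h₁ ∈ halfspaces Γ) (m₂ : h₂ ∈ halfspaces Γ)
    (m₃ : h₃ ∈ halfspaces Γ) (c₁₂ : Crosses h₁ h₂) (c₁₃ : Crosses h₁ h₃)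
    (c₂₃ : Crosses h₂ h₃) : False := by
  have hC := hG.convex_outerBoundary m₁
  have meet : ∀ {k : Set V}, k ∈ halfspaces Γ → (h₁ ∩ k).Nonempty → (h₁ᶜ ∩ k).Nonempty →
      (outerBoundary Γ h₁ ∩ k).Nonempty := fun hk k1 k2 =>
    hG.exists_mem_outerBoundary (hG.convex_halfspace hk) (by rwa [Set.inter_comm])
      (by rwa [Set.inter_comm])
  -- The gate in the boundary of a point of `k ∩ l` stays in both halfspaces, as each of them meets
  -- the boundary.
  have meet2 : ∀ {k l : Set V}, k ∈ halfspaces Γ → l ∈ halfspaces Γ →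
      (outerBoundary Γ h₁ ∩ k).Nonempty → (outerBoundary Γ h₁ ∩ l).Nonempty →
      (k ∩ l).Nonempty → (outerBoundary Γ h₁ ∩ l ∩ k).Nonempty := by
    rintro k l hk hl ⟨a, ha, hak⟩ ⟨b, hb, hbl⟩ ⟨v, hvk, hvl⟩
    obtain ⟨z, hz, hgate⟩ := hG.exists_gate hC ⟨a, ha⟩ v
    refine ⟨z, ⟨hz, ?_⟩, ?_⟩
    · by_contra hzl
      exact hG.notMem_of_gate hl hgate hvl hzl b hb hbl
    · by_contra hzk
      exact hG.notMem_of_gate hk hgate hvk hzk a ha hak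
  have m₂' := hG.compl_mem_halfspaces m₂
  have m₃' := hG.compl_mem_halfspaces m₃
  have a1 := meet m₂ c₁₂.1 c₁₂.2.2.1
  have a2 := meet m₂' c₁₂.2.1 c₁₂.2.2.2
  have a3 := meet m₃ c₁₃.1 c₁₃.2.2.1
  have a4 := meet m₃' c₁₃.2.1 c₁₃.2.2.2
  have b1 := hG.exists_mem_outerBoundary (hC.inter (hG.convex_halfspace m₃))
    (meet2 m₂ m₃ a1 a3 c₂₃.1) (meet2 m₂' m₃ a2 a3 c₂₃.2.2.1)
  have b2 := hG.exists_mem_outerBoundary (hC.inter (hG.convex_halfspace m₃'))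
    (meet2 m₂ m₃' a1 a4 c₂₃.2.1) (meet2 m₂' m₃' a2 a4 c₂₃.2.2.2)
  rw [← Set.inter_assoc] at b1 b2
  -- The vertex `p` has a neighbour across each of the three walls; the three squares at `p` then
  -- form a triangle in its link.
  obtain ⟨p, ⟨p3, q3, hq3, hpq3⟩, ⟨p2, q2, hq2, hpq2⟩, p1, q1, hq1, hpq1⟩ :=
    hG.exists_mem_outerBoundary ((hG.convex_outerBoundary m₂).inter hC) b1 b2
  have ne : ∀ {h k : Set V}, Crosses h k → h ≠ k := by
    rintro h k hc rfl
    obtain ⟨x, hx, hx'⟩ := hc.2.1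
    exact hx' hx
  obtain ⟨_, s12, -⟩ := hG.exists_square_of_crosses m₁ m₂ hpq1 hpq2 p1 hq1 p2 hq2 (ne c₁₂) c₁₂.1
  obtain ⟨_, s23, -⟩ := hG.exists_square_of_crosses m₂ m₃ hpq2 hpq3 p2 hq2 p3 hq3 (ne c₂₃) c₂₃.1
  obtain ⟨_, s13, -⟩ := hG.exists_square_of_crosses m₁ m₃ hpq1 hpq3 p1 hq1 p3 hq3 (ne c₁₃) c₁₃.1
  exact hG.not_triangle s12 s23 s13

end SquareComplexGraph

/-! ## Invariant cubes -/

section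

variable {V : Type u} {K : Type v} [Group K] [MulAction K V] {Γ : SimpleGraph V}

theorem dist_smul_of_adj (hc : Γ.Connected)
    (hadj : ∀ (g : K) (x y : V), Γ.Adj x y → Γ.Adj (g • x) (g • y)) (g : K) (x y : V) :
    Γ.dist (g • x) (g • y) = Γ.dist x y := by
  have le : ∀ (g : K) (x y : V), Γ.dist (g • x) (g • y) ≤ Γ.dist x y := by
    intro g x y
    obtain ⟨p, hp⟩ := hc.exists_walk_length_eq_dist x y
    let f : Γ →g Γ := ⟨fun v => g • v, fun {a b} h => hadj g a b h⟩
    have := SimpleGraph.dist_le (p.map f)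
    rwa [SimpleGraph.Walk.length_map, hp] at this
  refine (le g x y).antisymm ?_
  have := le g⁻¹ (g • x) (g • y)
  rwa [inv_smul_smul, inv_smul_smul] at this

theorem preimage_mem_halfspaces (hc : Γ.Connected)
    (hadj : ∀ (g : K) (x y : V), Γ.Adj x y → Γ.Adj (g • x) (g • y)) (g : K) {h : Set V}
    (hh : h ∈ halfspaces Γ) : (fun x => g • x) ⁻¹' h ∈ halfspaces Γ := by
  obtain ⟨a, b, hab, rfl⟩ := hh
  refine ⟨g⁻¹ • a, g⁻¹ • b, hadj _ _ _ hab, ?_⟩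
  ext v
  simp only [halfspace, Set.mem_preimage, Set.mem_ofPred_eq]
  rw [← dist_smul_of_adj hc hadj g v, ← dist_smul_of_adj hc hadj g v, smul_inv_smul, smul_inv_smul]

/-- The halfspaces which separate two points of `Y`. -/
def wallsOf (Γ : SimpleGraph V) (Y : Set V) : Set (Set V) :=
  {h ∈ halfspaces Γ | (Y ∩ h).Nonempty ∧ (Y ∩ hᶜ).Nonempty}

/-- The halfspace `h` has minimal trace on `Y`. -/
def MinimalIn (Γ : SimpleGraph V) (Y h : Set V) : Prop :=
  ∀ k ∈ wallsOf Γ Y, Y ∩ k ⊆ h → Y ∩ h ⊆ k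

theorem preimage_mem_wallsOf (hc : Γ.Connected)
    (hadj : ∀ (g : K) (x y : V), Γ.Adj x y → Γ.Adj (g • x) (g • y)) {Y : Set V}
    (hY : ∀ (g : K), ∀ y ∈ Y, g • y ∈ Y) (g : K) {h : Set V} (hh : h ∈ wallsOf Γ Y) :
    (fun x => g • x) ⁻¹' h ∈ wallsOf Γ Y := by
  obtain ⟨h1, ⟨x, hx, hxh⟩, ⟨y, hy, hyh⟩⟩ := hh
  exact ⟨preimage_mem_halfspaces hc hadj g h1, ⟨g⁻¹ • x, hY _ _ hx, by simpa using hxh⟩,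
    ⟨g⁻¹ • y, hY _ _ hy, by simpa using hyh⟩⟩

theorem MinimalIn.preimage (hc : Γ.Connected)
    (hadj : ∀ (g : K) (x y : V), Γ.Adj x y → Γ.Adj (g • x) (g • y)) {Y : Set V}
    (hY : ∀ (g : K), ∀ y ∈ Y, g • y ∈ Y) (g : K) {h : Set V} (hh : MinimalIn Γ Y h) :
    MinimalIn Γ Y ((fun x => g • x) ⁻¹' h) := by
  intro k hk hkh x hx
  have h1 := hh _ (preimage_mem_wallsOf hc hadj hY g⁻¹ hk) (by
    rintro z ⟨hz, hzk⟩
    have := hkh ⟨hY g⁻¹ z hz, hzk⟩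
    simpa using this)
  have h2 := h1 ⟨hY g x hx.1, hx.2⟩
  simpa using h2

end

section

variable {V : Type u} {K : Type v} [Group K] [MulAction K V] {Γ : SimpleGraph V}
  {Sq : V → V → V → V → Prop}

/-- A convex invariant set with finitely many walls contains one all of whose walls are minimal
on both sides. -/
theorem SquareComplexGraph.exists_minimal_invariant (hG : SquareComplexGraph Γ Sq)
    (hadj : ∀ (g : K) (x y : V), Γ.Adj x y → Γ.Adj (g • x) (g • y)) {Y : Set V}
    (hY : ∀ (g : K), ∀ y ∈ Y, g • y ∈ Y) (hC : GeodesicallyConvex Γ Y) (hne : Y.Nonempty)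
    (hfin : (wallsOf Γ Y).Finite) :
    ∃ Z : Set V, (∀ (g : K), ∀ y ∈ Z, g • y ∈ Z) ∧ GeodesicallyConvex Γ Z ∧ Z.Nonempty ∧
      (wallsOf Γ Z).Finite ∧ ∀ h ∈ wallsOf Γ Z, MinimalIn Γ Z h → MinimalIn Γ Z hᶜ := by
  have hc := hG.connected
  induction hn : (wallsOf Γ Y).ncard using Nat.strong_induction_on generalizing Y with
  | _ n ih =>
  by_cases hall : ∀ h ∈ wallsOf Γ Y, MinimalIn Γ Y h → MinimalIn Γ Y hᶜ
  · exact ⟨Y, hY, hC, hne, hfin, hall⟩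
  push Not at hall
  obtain ⟨h₀, hw₀, hm₀, hm₀'⟩ := hall
  -- All halfspaces minimal on one side only are cut off at once, so that what remains is invariant;
  -- `h₀` no longer gives a wall of it.
  set S : Set (Set V) := {h ∈ wallsOf Γ Y | MinimalIn Γ Y h ∧ ¬ MinimalIn Γ Y hᶜ} with hS
  have compl_mem : ∀ {h : Set V}, h ∈ wallsOf Γ Y → hᶜ ∈ wallsOf Γ Y := fun hh =>
    ⟨hG.compl_mem_halfspaces hh.1, hh.2.2, by rw [compl_compl]; exact hh.2.1⟩
  obtain ⟨y, hyY, hy⟩ := hG.helly hC hne (S := S) (fun h hh => hh.1.1)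
    (fun y _ => hfin.subset fun h hh => hh.1.1) (by
      intro h hh k hk
      by_contra hemp
      -- By minimality of `k` this inclusion becomes an equality of traces, so `hᶜ` would be minimal
      -- too.
      have hsub : Y ∩ hᶜ ⊆ k := fun z hz => by
        by_contra hzk
        exact hemp ⟨z, hz.1, hz.2, hzk⟩
      have hsub' := hk.2.1 _ (compl_mem hh.1) hsub
      refine hh.2.2 fun l hl hlh => ?_
      have := hk.2.1 l hl fun z hz => hsub ⟨hz.1, hlh hz⟩
      exact fun z hz => this ⟨hz.1, hsub hz⟩)
  set Z : Set V := {y ∈ Y | ∀ h ∈ S, y ∉ h} with hZ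
  have hZC : GeodesicallyConvex Γ Z := by
    intro a ha b hb e he
    exact ⟨hC a ha.1 b hb.1 e he, fun h hh => hG.convex_halfspace
      (hG.compl_mem_halfspaces hh.1.1) a (ha.2 h hh) b (hb.2 h hh) e he⟩
  have hsub : wallsOf Γ Z ⊂ wallsOf Γ Y := by
    refine ⟨fun h hh => ⟨hh.1, ?_, ?_⟩, fun hsub => ?_⟩
    · obtain ⟨x, hx, hxh⟩ := hh.2.1
      exact ⟨x, hx.1, hxh⟩
    · obtain ⟨x, hx, hxh⟩ := hh.2.2
      exact ⟨x, hx.1, hxh⟩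
    · obtain ⟨x, hx, hxh⟩ := (hsub hw₀).2.1
      exact hx.2 h₀ ⟨hw₀, hm₀, hm₀'⟩ hxh
  refine ih _ (hn ▸ Set.ncard_lt_ncard hsub hfin) ?_ hZC ⟨y, hyY, hy⟩ (hfin.subset hsub.1) rfl
  rintro g z ⟨hzY, hz⟩
  refine ⟨hY g z hzY, fun h hh hgz => hz ((fun x => g • x) ⁻¹' h) ⟨?_, ?_, ?_⟩ hgz⟩
  · exact preimage_mem_wallsOf hc hadj hY g hh.1
  · exact hh.2.1.preimage hc hadj hY g
  · intro hm
    refine hh.2.2 ?_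
    have := MinimalIn.preimage hc hadj hY g⁻¹ hm
    convert this using 1
    ext x
    simp

/-- In a convex set all of whose walls are minimal on both sides, any two walls cross. -/
theorem SquareComplexGraph.walls_cross (hG : SquareComplexGraph Γ Sq) {Z : Set V}
    (hC : GeodesicallyConvex Γ Z) (hfin : (wallsOf Γ Z).Finite)
    (hmin : ∀ h ∈ wallsOf Γ Z, MinimalIn Γ Z h → MinimalIn Γ Z hᶜ) {h k : Set V}
    (hh : h ∈ wallsOf Γ Z) (hk : k ∈ wallsOf Γ Z) (hne' : k ≠ hᶜ) :
    (Z ∩ (h ∩ k)).Nonempty := by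
  have compl_mem : ∀ {h : Set V}, h ∈ wallsOf Γ Z → hᶜ ∈ wallsOf Γ Z := fun hh =>
    ⟨hG.compl_mem_halfspaces hh.1, hh.2.2, by rw [compl_compl]; exact hh.2.1⟩
  -- Take `k` minimal inside `h`. Then `kᶜ` is minimal as well and its trace contains that of `hᶜ`;
  -- so `h` and `k` have the same trace.
  have all : ∀ h ∈ wallsOf Γ Z, MinimalIn Γ Z h := by
    intro h hh
    obtain ⟨k, ⟨hk, hkh⟩, hkm⟩ := Set.Finite.exists_minimalFor (fun k => Z ∩ k)
      {k ∈ wallsOf Γ Z | Z ∩ k ⊆ h} (hfin.subset fun k hk => hk.1)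
      ⟨h, hh, Set.inter_subset_right⟩
    have hkmin : MinimalIn Γ Z k := fun l hl hlk x hx => by
      have := hkm ⟨hl, fun z hz => hkh ⟨hz.1, hlk hz⟩⟩ (fun z hz => ⟨hz.1, hlk hz⟩) hx
      exact this.2
    have h1 := hmin k hk hkmin _ (compl_mem hh) fun z hz hzk => hz.2 (hkh ⟨hz.1, hzk⟩)
    intro l hl hlh x hx
    by_contra hxl
    by_cases hxk : x ∈ k
    · refine hxl (hkmin l hl ?_ ⟨hx.1, hxk⟩)
      intro z hz
      by_contra hzk
      exact h1 ⟨hz.1, hzk⟩ (hlh hz)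
    · exact h1 ⟨hx.1, hxk⟩ hx.2
  -- Nested traces are equal by minimality, and one edge of `Z` crossing both halfspaces determines
  -- both.
  have eq_of : ∀ {k l : Set V}, k ∈ wallsOf Γ Z → l ∈ wallsOf Γ Z → Z ∩ k ⊆ l → k = l := by
    intro k l hk hl hkl
    have hlk := all l hl k hk hkl
    obtain ⟨q, p, hqp, hqZ, hpZ, hq, hp⟩ := hG.exists_edge_in hC k hk.2.1 hk.2.2
    rw [hG.eq_halfspace_of_crossing hk.1 hqp.symm hp hq]
    exact (hG.eq_halfspace_of_crossing hl.1 hqp.symm (hkl ⟨hpZ, hp⟩)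
      fun hql => hq (hlk ⟨hqZ, hql⟩)).symm
  by_contra hemp
  exact hne' (eq_of hk (compl_mem hh) fun z hz hzh => hemp ⟨z, hz.1, hzh, hz.2⟩)

/-- The intersection of all halfspaces containing `O` has finitely many walls, since each separates
two points of `O`. Trim it until its walls cross pairwise. At most two walls are then left and they
separate the vertices, so what remains is a vertex, an edge or a square. -/
theorem CubeComplex.exists_invariant_cube {X : CubeComplex V}
    (hG : SquareComplexGraph X.graph X.IsSquare)
    (hadj : ∀ (g : K) (x y : V), X.graph.Adj x y → X.graph.Adj (g • x) (g • y)) {O : Set V}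
    (hO : ∀ (g : K), ∀ y ∈ O, g • y ∈ O) (hne : O.Nonempty) (hfin : O.Finite) :
    ∃ c ∈ X.cubes, ∀ (g : K), ∀ y ∈ c, g • y ∈ c := by
  have hc := hG.connected
  set T : Set (Set V) := {h ∈ halfspaces X.graph | O ⊆ h} with hT
  obtain ⟨Z, hZ, hC, hZne, hZfin, hmin⟩ := hG.exists_minimal_invariant (K := K) hadj
    (Y := ⋂ h ∈ T, h) (by
      intro g y hy
      simp only [Set.mem_iInter] at hy ⊢
      intro h hh
      exact hy ((fun x => g • x) ⁻¹' h) ⟨preimage_mem_halfspaces hc hadj g hh.1,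
        fun z hz => hh.2 (hO g z hz)⟩)
    (GeodesicallyConvex.biInter fun h hh => hG.convex_halfspace hh.1)
    (hne.mono fun z hz => by
      simp only [Set.mem_iInter]
      exact fun h hh => hh.2 hz)
    (by
      refine (hfin.biUnion fun x _ => hfin.biUnion fun y _ => hG.finite_separating x y).subset ?_
      rintro h ⟨hh, ⟨a, ha, hah⟩, ⟨b, hb, hbh⟩⟩
      simp only [Set.mem_iInter] at ha hb
      have h1 : ¬ O ⊆ h := fun hs => hbh (hb h ⟨hh, hs⟩)
      have h2 : ¬ O ⊆ hᶜ := fun hs => ha hᶜ ⟨hG.compl_mem_halfspaces hh, hs⟩ hah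
      obtain ⟨y, hy, hyh⟩ := Set.not_subset.1 h1
      obtain ⟨x, hx, hxh⟩ := Set.not_subset.1 h2
      simp only [Set.mem_iUnion]
      exact ⟨x, hx, y, hy, hh, not_not.1 hxh, hyh⟩)
  suffices hZc : Z ∈ X.cubes from ⟨Z, hZc, hZ⟩
  have compl_mem : ∀ {h : Set V}, h ∈ wallsOf X.graph Z → hᶜ ∈ wallsOf X.graph Z := fun hh =>
    ⟨hG.compl_mem_halfspaces hh.1, hh.2.2, by rw [compl_compl]; exact hh.2.1⟩
  have sep : ∀ x ∈ Z, ∀ y ∈ Z, x ≠ y → ∃ h ∈ wallsOf X.graph Z, x ∉ h ∧ y ∈ h := by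
    intro x hx y hy hxy
    obtain ⟨h, hh, hxh, hyh⟩ := hG.exists_separating hxy
    exact ⟨h, ⟨hh, ⟨y, hy, hyh⟩, ⟨x, hx, hxh⟩⟩, hxh, hyh⟩
  by_cases hw : (wallsOf X.graph Z).Nonempty
  swap
  · obtain ⟨z, hz⟩ := hZne
    have : Z = {z} := by
      refine Set.eq_singleton_iff_unique_mem.2 ⟨hz, fun y hy => ?_⟩
      by_contra hyz
      obtain ⟨h, hh, -⟩ := sep y hy z hz hyz
      exact hw ⟨h, hh⟩
    rw [this]
    exact X.singleton_mem z
  obtain ⟨h, hh⟩ := hw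
  by_cases hk : ∃ k ∈ wallsOf X.graph Z, k ≠ h ∧ k ≠ hᶜ
  swap
  · push Not at hk
    obtain ⟨q, p, hqp, hqZ, hpZ, hq, hp⟩ := hG.exists_edge_in hC h hh.2.1 hh.2.2
    have uniq : ∀ x ∈ Z, ∀ y ∈ Z, (x ∈ h ↔ y ∈ h) → x = y := by
      intro x hx y hy hxy
      by_contra hne
      obtain ⟨k, hk', hxk, hyk⟩ := sep x hx y hy hne
      by_cases hkh : k = h
      · subst hkh
        exact hxk (hxy.2 hyk)
      · have := hk k hk' hkh
        subst this
        exact hxk fun hxh => hyk (hxy.1 hxh)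
    have : Z = {q, p} := by
      ext z
      simp only [Set.mem_insert_iff, Set.mem_singleton_iff]
      constructor
      · intro hz
        by_cases hzh : z ∈ h
        · exact .inr (uniq z hz p hpZ (by tauto))
        · exact .inl (uniq z hz q hqZ (by tauto))
      · rintro (rfl | rfl) <;> assumption
    rw [this]
    exact hqp.2
  · obtain ⟨k, hk, hkh, hkh'⟩ := hk
    have cross := fun {h k : Set V} (hh : h ∈ wallsOf X.graph Z) (hk : k ∈ wallsOf X.graph Z)
      (_ : k ≠ h) (h2 : k ≠ hᶜ) => hG.walls_cross hC hZfin hmin hh hk h2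
    have cross4 : ∀ {h k : Set V}, h ∈ wallsOf X.graph Z → k ∈ wallsOf X.graph Z → k ≠ h →
        k ≠ hᶜ → (Z ∩ (h ∩ k)).Nonempty ∧ (Z ∩ (h ∩ kᶜ)).Nonempty ∧ (Z ∩ (hᶜ ∩ k)).Nonempty ∧
        (Z ∩ (hᶜ ∩ kᶜ)).Nonempty := by
      intro h k hh hk h1 h2
      have h3 : kᶜ ≠ h := fun e => h2 (by rw [← e, compl_compl])
      have h4 : kᶜ ≠ hᶜ := fun e => h1 (compl_injective e)
      exact ⟨cross hh hk h1 h2, cross hh (compl_mem hk) h3 h4,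
        cross (compl_mem hh) hk h2 (by rwa [compl_compl]),
        cross (compl_mem hh) (compl_mem hk) h4 (by rwa [compl_compl])⟩
    have crosses : ∀ {h k : Set V}, h ∈ wallsOf X.graph Z → k ∈ wallsOf X.graph Z → k ≠ h →
        k ≠ hᶜ → Crosses h k := by
      intro h k hh hk h1 h2
      obtain ⟨a, b, c, d⟩ := cross4 hh hk h1 h2
      exact ⟨a.mono Set.inter_subset_right, b.mono Set.inter_subset_right,
        c.mono Set.inter_subset_right, d.mono Set.inter_subset_right⟩
    have uniq : ∀ x ∈ Z, ∀ y ∈ Z, (x ∈ h ↔ y ∈ h) → (x ∈ k ↔ y ∈ k) → x = y := by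
      intro x hx y hy hxy hxy'
      by_contra hne
      obtain ⟨l, hl, hxl, hyl⟩ := sep x hx y hy hne
      by_cases e1 : l = h
      · subst e1; exact hxl (hxy.2 hyl)
      by_cases e2 : l = hᶜ
      · subst e2; exact hxl fun hxh => hyl (hxy.1 hxh)
      by_cases e3 : l = k
      · subst e3; exact hxl (hxy'.2 hyl)
      by_cases e4 : l = kᶜ
      · subst e4; exact hxl fun hxh => hyl (hxy'.1 hxh)
      exact hG.not_three_crossing hh.1 hk.1 hl.1 (crosses hh hk hkh hkh') (crosses hh hl e1 e2)
        (crosses hk hl e3 e4)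
    obtain ⟨c1, c2, c3, c4⟩ := cross4 hh hk hkh hkh'
    obtain ⟨p, q, hpq, hp, hq, hph, hqh⟩ := hG.exists_edge_in
      (hC.inter (hG.convex_halfspace (compl_mem hk).1)) h
      (by rwa [Set.inter_assoc, Set.inter_comm kᶜ])
      (by rwa [Set.inter_assoc, Set.inter_comm kᶜ])
    obtain ⟨p', r, hpr, hp', hr, hpk, hrk⟩ := hG.exists_edge_in
      (hC.inter (hG.convex_halfspace (compl_mem hh).1)) k (by rwa [Set.inter_assoc])
      (by rwa [Set.inter_assoc])
    have hpp' : p' = p := uniq p' hp'.1 p hp.1 (iff_of_false hp'.2 hph) (iff_of_false hpk hp.2)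
    subst hpp'
    obtain ⟨e, he, heh, hek⟩ := hG.exists_square_of_crosses hh.1 hk.1 hpq hpr hph hqh hpk hrk
      hkh.symm (crosses hh hk hkh hkh').1
    obtain ⟨s, hs, hsh, hsk⟩ := c1
    have heZ : e ∈ Z := by
      have a1 := he.2.1
      have a2 := he.2.2.1
      have hqr : q ≠ r := he.2.2.2.2.2.1
      have t : X.graph.dist q r = 2 := by
        have t := hc.dist_triangle (u := q) (v := e) (w := r)
        rw [SimpleGraph.dist_eq_one_iff_adj.2 a1, SimpleGraph.dist_eq_one_iff_adj.2 a2] at t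
        have t1 := hc.pos_dist_of_ne hqr
        have t2 := hG.dist_adj q a2
        rw [SimpleGraph.dist_eq_one_iff_adj.2 a1] at t2
        omega
      exact hC q hq.1 r hr.1 e (by
        rw [SimpleGraph.dist_eq_one_iff_adj.2 a1, SimpleGraph.dist_eq_one_iff_adj.2 a2, t])
    have : Z = {p', q, e, r} := by
      ext z
      simp only [Set.mem_insert_iff, Set.mem_singleton_iff]
      constructor
      · intro hz
        by_cases hzh : z ∈ h <;> by_cases hzk : z ∈ k
        · exact .inr (.inr (.inl (uniq z hz e heZ (by tauto) (by tauto))))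
        · exact .inr (.inl (uniq z hz q hq.1 (by tauto) (iff_of_false hzk hq.2)))
        · exact .inr (.inr (.inr (uniq z hz r hr.1 (iff_of_false hzh hr.2) (by tauto))))
        · exact .inl (uniq z hz p' hp.1 (iff_of_false hzh hph) (iff_of_false hzk hpk))
      · rintro (rfl | rfl | rfl | rfl)
        · exact hp.1
        · exact hq.1
        · exact heZ
        · exact hr.1
    rw [this]
    exact he.2.2.2.2.2.2

end

/-! ## Combinatorics of reduced words -/

section Words

open FreeGroup

variable {S : Type v}

/-- The inverse of a letter. -/
def invLetter (a : S × Bool) : S × Bool := (a.1, !a.2)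

theorem invLetter_invLetter (a : S × Bool) : invLetter (invLetter a) = a := by
  simp [invLetter]

theorem mk_invLetter (a : S × Bool) : mk [invLetter a] = (mk [a])⁻¹ := by
  simp [invLetter, inv_mk, invRev]

theorem rel_iff_ne_invLetter {a b : S × Bool} : (a.1 = b.1 → a.2 = b.2) ↔ b ≠ invLetter a := by
  obtain ⟨a, x⟩ := a
  obtain ⟨b, y⟩ := b
  cases x <;> cases y <;> simp [invLetter, eq_comm]

theorem isReduced_cons_append {a c : S × Bool} {l : List (S × Bool)}
    (hl : (l ++ [c]).head? = some a) {b : S × Bool} (h : IsReduced (l ++ [c]))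
    (hb : a ≠ invLetter b) : IsReduced (b :: l ++ [c]) := by
  cases l with
  | nil =>
    obtain rfl : c = a := by simpa using hl
    simpa [isReduced_cons_cons] using rel_iff_ne_invLetter.2 hb
  | cons d l =>
    obtain rfl : d = a := by simpa using hl
    simp only [List.cons_append, isReduced_cons_cons]
    exact ⟨rel_iff_ne_invLetter.2 hb, h⟩

/-- Words which start with `s` and may be followed by `s`. -/
def IsBlock (s : S × Bool) (w : List (S × Bool)) : Prop :=
  IsReduced (w ++ [s]) ∧ (w ++ [s]).head? = some s

/-- Reduced words starting and ending with `s`. -/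
def IsFramed (s : S × Bool) (w : List (S × Bool)) : Prop :=
  IsReduced w ∧ w.head? = some s ∧ w.getLast? = some s

/-- The blocks of length `ℓ`. -/
def blocks (s : S × Bool) (ℓ : ℕ) : Set (List (S × Bool)) := {w | w.length = ℓ ∧ IsBlock s w}

/-- The framed words of length `ℓ`. -/
def frames (s : S × Bool) (ℓ : ℕ) : Set (List (S × Bool)) := {w | w.length = ℓ ∧ IsFramed s w}

theorem blocks_finite [Finite S] (s : S × Bool) (ℓ : ℕ) : (blocks s ℓ).Finite :=
  (List.finite_length_eq _ ℓ).subset fun _ h => h.1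

theorem frames_finite [Finite S] (s : S × Bool) (ℓ : ℕ) : (frames s ℓ).Finite :=
  (List.finite_length_eq _ ℓ).subset fun _ h => h.1

theorem isReduced_split {c : S × Bool} {l₁ l₂ : List (S × Bool)} :
    IsReduced (l₁ ++ c :: l₂) ↔ IsReduced (l₁ ++ [c]) ∧ IsReduced (c :: l₂) :=
  List.isChain_split

theorem IsBlock.append {s : S × Bool} {u v : List (S × Bool)} (hu : IsBlock s u)
    (hv : IsBlock s v) : IsBlock s (u ++ v) := by
  obtain ⟨v', hv'⟩ : ∃ v', v ++ [s] = s :: v' := List.head?_eq_some_iff.1 hv.2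
  unfold IsBlock
  rw [List.append_assoc, hv']
  refine ⟨isReduced_split.2 ⟨hu.1, hv' ▸ hv.1⟩, ?_⟩
  have := hu.2
  simpa [List.head?_append] using this

theorem IsFramed.exists_eq_append {s : S × Bool} {w : List (S × Bool)} (h : IsFramed s w) :
    ∃ v, w = v ++ [s] := by
  simpa [List.getLast?_eq_some_iff] using h.2.2

theorem IsFramed.append_connector {s : S × Bool} {w y : List (S × Bool)} (h : IsFramed s w)
    (hy : IsReduced (s :: y ++ [s])) : IsBlock s (w ++ y) := by
  obtain ⟨v, rfl⟩ := h.exists_eq_append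
  refine ⟨?_, ?_⟩
  · simpa using isReduced_split.2 ⟨h.1, hy⟩
  · rw [List.append_assoc, List.head?_append, h.2.1]
    rfl

theorem IsFramed.isBlock {s : S × Bool} {w : List (S × Bool)} (h : IsFramed s w) :
    IsBlock s w := by
  simpa using h.append_connector (y := []) (by simp [isReduced_cons_cons])

theorem IsBlock.append_framed {s : S × Bool} {x w : List (S × Bool)} (hx : IsBlock s x)
    (hw : IsFramed s w) : IsFramed s (x ++ w) := by
  obtain ⟨w', rfl⟩ : ∃ w', w = s :: w' := List.head?_eq_some_iff.1 hw.2.1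
  refine ⟨isReduced_split.2 ⟨hx.1, hw.1⟩, ?_, ?_⟩
  · have := hx.2
    simpa [List.head?_append] using this
  · rw [List.getLast?_append, hw.2.2]
    rfl

theorem exists_letter_notMem [Fintype S] (hS : 7 ≤ Fintype.card S) (A : Finset (S × Bool))
    (hA : A.card ≤ 6) : ∃ c, c ∉ A := by
  by_contra! h
  have : A = Finset.univ := Finset.eq_univ_iff_forall.2 h
  rw [this, Finset.card_univ, Fintype.card_prod, Fintype.card_bool] at hA
  omega

open Classical in
/-- The words `w` of length `k` such that `s :: w` is reduced. -/
noncomputable def continuations [Fintype S] : ℕ → S × Bool → Finset (List (S × Bool))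
  | 0, _ => {[]}
  | k + 1, s => (Finset.univ.erase (invLetter s)).biUnion fun a =>
      (continuations k a).image (List.cons a)

theorem mem_continuations [Fintype S] {k : ℕ} {s : S × Bool} {w : List (S × Bool)} :
    w ∈ continuations k s ↔ w.length = k ∧ IsReduced (s :: w) := by
  induction k generalizing s w with
  | zero =>
    simp only [continuations, Finset.mem_singleton, List.length_eq_zero_iff]
    exact ⟨by rintro rfl; simp, And.left⟩
  | succ k ih =>
    cases w with
    | nil => simp [continuations]
    | cons a w =>
      simp only [continuations, Finset.mem_biUnion, Finset.mem_erase, Finset.mem_univ, and_true,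
        Finset.mem_image, ih, List.cons.injEq, List.length_cons, isReduced_cons_cons,
        rel_iff_ne_invLetter]
      constructor
      · rintro ⟨b, hb, w', ⟨h1, h2⟩, rfl, rfl⟩
        exact ⟨by omega, hb, h2⟩
      · rintro ⟨h1, hb, h2⟩
        exact ⟨a, hb, w, ⟨by omega, h2⟩, rfl, rfl⟩

theorem card_continuations [Fintype S] (k : ℕ) (s : S × Bool) :
    (continuations k s).card = (2 * Fintype.card S - 1) ^ k := by
  classical
  induction k generalizing s with
  | zero => simp [continuations]
  | succ k ih =>
    rw [continuations, Finset.card_biUnion]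
    · rw [Finset.sum_congr rfl fun a _ => by
        rw [Finset.card_image_of_injective _ (List.cons_injective), ih], Finset.sum_const,
        Finset.card_erase_of_mem (Finset.mem_univ _), Finset.card_univ, Fintype.card_prod,
        Fintype.card_bool, smul_eq_mul, pow_succ, mul_comm, mul_comm 2]
    · intro a _ b _ hab
      rw [Function.onFun, Finset.disjoint_left]
      simp only [Finset.mem_image]
      rintro _ ⟨x, _, rfl⟩ ⟨y, _, h⟩
      exact hab (List.cons.inj h).1.symm

/-- Any continuation of `s` of length `k` can be closed up by a connecting letter `e` and a final
`s`, whence the three extra letters. -/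
theorem pow_le_ncard_frames [Fintype S] (hS : 7 ≤ Fintype.card S) (s : S × Bool) (k : ℕ) :
    (2 * Fintype.card S - 1) ^ k ≤ (frames s (k + 3)).ncard := by
  classical
  have hconn : ∀ r ∈ continuations k s, ∃ e, IsFramed s (s :: r ++ [e, s]) := by
    intro r hr
    rw [mem_continuations] at hr
    obtain ⟨v, a, hv⟩ : ∃ v a, s :: r = v ++ [a] :=
      ⟨_, _, (List.dropLast_append_getLast (List.cons_ne_nil s r)).symm⟩
    obtain ⟨e, he⟩ := exists_letter_notMem hS {invLetter a, invLetter s}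
      (Finset.card_le_two.trans (by norm_num))
    simp only [Finset.mem_insert, Finset.mem_singleton, not_or] at he
    refine ⟨e, ?_, by simp, by
      rw [show s :: r ++ [e, s] = (s :: r ++ [e]) ++ [s] by simp, List.getLast?_concat]⟩
    have := hr.2
    rw [hv] at this ⊢
    rw [List.append_assoc]
    refine isReduced_split.2 ⟨this, ?_⟩
    change IsReduced [a, e, s]
    simp only [isReduced_cons_cons, rel_iff_ne_invLetter]
    refine ⟨he.1, fun h => he.2 ?_, by simp⟩
    rw [h, invLetter_invLetter]
  have : Nonempty (S × Bool) := ⟨s⟩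
  choose! e he using hconn
  rw [← card_continuations k s, ← Set.ncard_coe_finset]
  refine Set.ncard_le_ncard_of_injOn (fun r => s :: r ++ [e r, s]) ?_ ?_ (frames_finite s _)
  · intro r hr
    refine ⟨?_, he r hr⟩
    have := (mem_continuations.1 hr).1
    simp [this]
  · intro r hr r' hr' h
    have h1 := (mem_continuations.1 hr).1
    have h2 := (mem_continuations.1 hr').1
    have := (List.append_inj h (by simp [h1, h2])).1
    exact (List.cons.inj this).2

/-- Many concatenations `w ++ v` with `w ∈ A` of length `a` and `v ∈ B w`. -/
theorem mul_le_ncard_append {α : Type*} {A : Set (List α)} {a : ℕ} (hA : ∀ w ∈ A, w.length = a)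
    (hfin : A.Finite) {B : List α → Set (List α)} {C : Set (List α)} (hC : C.Finite)
    (hsub : ∀ w ∈ A, ∀ v ∈ B w, w ++ v ∈ C) {c : ℝ} (hB : ∀ w ∈ A, c ≤ (B w).ncard) :
    A.ncard * c ≤ C.ncard := by
  classical
  have h1 : ∀ w ∈ A, (B w).ncard ≤ (hC.toFinset.filter fun x => x.take a = w).card := by
    intro w hw
    rw [← Set.ncard_coe_finset]
    refine Set.ncard_le_ncard_of_injOn (fun v => w ++ v) ?_ ?_ (Finset.finite_toSet _)
    · intro v hv
      simpa [← hA w hw] using hsub w hw v hv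
    · intro v _ v' _ h
      exact List.append_cancel_left h
  have h2 : ∑ w ∈ hfin.toFinset, (hC.toFinset.filter fun x => x.take a = w).card
      ≤ hC.toFinset.card := by
    rw [← Finset.card_biUnion]
    · exact Finset.card_le_card (Finset.biUnion_subset.2 fun w _ => Finset.filter_subset _ _)
    · intro x _ y _ hxy
      rw [Function.onFun, Finset.disjoint_left]
      simp only [Finset.mem_filter]
      rintro z ⟨_, h⟩ ⟨_, h'⟩
      exact hxy (h.symm.trans h')
  rw [Set.ncard_eq_toFinset_card _ hfin, Set.ncard_eq_toFinset_card _ hC, ← nsmul_eq_mul,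
    ← Finset.sum_const]
  refine le_trans ?_ (Nat.cast_le.2 h2)
  push_cast
  refine Finset.sum_le_sum fun w hw => (hB w (by simpa using hw)).trans ?_
  exact_mod_cast h1 w (by simpa using hw)

end Words

/-! ## Walls moved to crossing walls by most words -/

section Walls

open FreeGroup

variable {S : Type v} {W : Type u} [MulAction (FreeGroup S) W]

theorem isReduced_replicate_append {c s a : S × Bool} {u : List (S × Bool)}
    (hu : IsReduced (u ++ [s])) (ha : (u ++ [s]).head? = some a) (hca : a ≠ invLetter c) (m : ℕ) :
    IsReduced (List.replicate (m + 1) c ++ u ++ [s]) ∧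
      (List.replicate (m + 1) c ++ u ++ [s]).head? = some c := by
  induction m with
  | zero => exact ⟨isReduced_cons_append ha hu hca, rfl⟩
  | succ m ih =>
    refine ⟨?_, rfl⟩
    rw [List.replicate_succ, List.cons_append]
    refine isReduced_cons_append ih.2 ih.1 ?_
    intro h
    have := congrArg Prod.snd h
    simp [invLetter] at this

/-- The same prefix serves all three words, so equal values of the extended words give equal values
of the original ones. It is `s` followed by a power of a letter avoiding the four possible
cancellations. -/
theorem exists_extension [Fintype S] (hS : 7 ≤ Fintype.card S) (s : S × Bool) {i m : ℕ}
    {u₁ u₂ u₃ : List (S × Bool)}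
    (h₁ : u₁.length = i ∧ IsReduced (u₁ ++ [s])) (h₂ : u₂.length = i ∧ IsReduced (u₂ ++ [s]))
    (h₃ : u₃.length = i ∧ IsReduced (u₃ ++ [s])) :
    ∃ z, ∀ u ∈ [u₁, u₂, u₃], (z ++ u).length = i + m + 2 ∧ IsBlock s (z ++ u) := by
  classical
  have head : ∀ u : List (S × Bool), ∃ a, (u ++ [s]).head? = some a := fun u => by
    cases u <;> simp
  choose a ha using head
  obtain ⟨c, hc⟩ := exists_letter_notMem hS
    {invLetter s, invLetter (a u₁), invLetter (a u₂), invLetter (a u₃)}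
    (Finset.card_le_four.trans (by norm_num))
  simp only [Finset.mem_insert, Finset.mem_singleton, not_or] at hc
  refine ⟨s :: List.replicate (m + 1) c, ?_⟩
  have key : ∀ u : List (S × Bool), u.length = i ∧ IsReduced (u ++ [s]) → c ≠ invLetter (a u) →
      (s :: List.replicate (m + 1) c ++ u).length = i + m + 2 ∧
        IsBlock s (s :: List.replicate (m + 1) c ++ u) := by
    intro u hu hcu
    have h := isReduced_replicate_append hu.2 (ha u)
      (fun e => hcu (by rw [e, invLetter_invLetter])) m
    refine ⟨?_, isReduced_cons_append h.2 h.1 hc.1, rfl⟩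
    simp [hu.1]
    omega
  simp only [List.mem_cons, List.not_mem_nil, or_false]
  rintro u (rfl | rfl | rfl)
  exacts [key _ h₁ hc.2.1, key _ h₂ hc.2.2.1, key _ h₃ hc.2.2.2]

/-- The images of `J` under the words of length `i` which may be followed by `s`. -/
def wordValues (s : S × Bool) (J : W) (i : ℕ) : Set W :=
  {v | ∃ u : List (S × Bool), (u.length = i ∧ IsReduced (u ++ [s])) ∧ v = mk u • J}

theorem wordValues_finite [Finite S] (s : S × Bool) (J : W) (i : ℕ) :
    (wordValues s J i).Finite := by
  refine ((List.finite_length_eq (S × Bool) i).image fun u => mk u • J).subset ?_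
  rintro _ ⟨u, hu, rfl⟩
  exact ⟨u, hu.1, rfl⟩

theorem exists_stationary {α : Type*} (f : ℕ → Set α) (hfin : ∀ m, (f m).Finite)
    (hmono : ∀ m, m ≤ 3 → f m ⊆ f (m + 1)) (h0 : (f 0).Nonempty)
    (hcard : ∀ m, m ≤ 4 → (f m).ncard ≤ 4) : ∃ m, m ≤ 3 ∧ f (m + 1) = f m := by
  by_contra! h
  have : ∀ m, m ≤ 4 → m + 1 ≤ (f m).ncard := by
    intro m
    induction m with
    | zero => exact fun _ => (Set.ncard_pos (hfin 0)).2 h0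
    | succ m ih =>
      intro hm
      have := ih (by omega)
      have h2 := Set.ncard_lt_ncard ((hmono m (by omega)).ssubset_of_ne
        (h m (by omega)).symm) (hfin _)
      omega
  have := this 4 le_rfl
  have := hcard 4 le_rfl
  omega

theorem orbit_finite_of_letters {Y : Type*} [MulAction (FreeGroup S) Y] {J : Y} {Ω : Set Y}
    (hΩ : Ω.Finite) (hJ : J ∈ Ω) (hmul : ∀ (a : S × Bool), ∀ v ∈ Ω, mk [a] • v ∈ Ω) :
    (MulAction.orbit (FreeGroup S) J).Finite := by
  refine hΩ.subset ?_
  rintro _ ⟨g, rfl⟩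
  induction g using Quot.inductionOn with
  | h w =>
  change mk w • J ∈ Ω
  induction w with
  | nil => simpa [← one_eq_mk] using hJ
  | cons a w ih =>
    have : mk (a :: w) = mk [a] * mk w := by simp [mul_mk]
    rw [this, mul_smul]
    exact hmul a _ ih

/-- If all blocks of length `21` move `J` to one of two places, its orbit is finite. -/
theorem orbit_finite_of_two_values [Fintype S] (hS : 7 ≤ Fintype.card S) (s : S × Bool)
    {J H K : W} (h : ∀ x ∈ blocks s 21, mk x • J = H ∨ mk x • J = K) :
    (MulAction.orbit (FreeGroup S) J).Finite := by
  classical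
  -- The length 21 is 19 plus the two letters that a common prefix needs at least; among three
  -- blocks with two values, two agree.
  have three : ∀ {i : ℕ} {u₁ u₂ u₃ : List (S × Bool)}, i ≤ 19 →
      (u₁.length = i ∧ IsReduced (u₁ ++ [s])) → (u₂.length = i ∧ IsReduced (u₂ ++ [s])) →
      (u₃.length = i ∧ IsReduced (u₃ ++ [s])) →
      mk u₁ • J = mk u₂ • J ∨ mk u₁ • J = mk u₃ • J ∨ mk u₂ • J = mk u₃ • J := by
    intro i u₁ u₂ u₃ hi h₁ h₂ h₃
    obtain ⟨z, hz⟩ := exists_extension hS s (m := 19 - i) h₁ h₂ h₃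
    have val : ∀ u ∈ [u₁, u₂, u₃], mk z • mk u • J = H ∨ mk z • mk u • J = K := by
      intro u hu
      rw [← mul_smul, mul_mk]
      exact h _ ⟨by rw [(hz u hu).1]; omega, (hz u hu).2⟩
    have hinj := MulAction.injective (β := W) (mk z)
    rcases val u₁ (by simp) with e₁ | e₁ <;> rcases val u₂ (by simp) with e₂ | e₂ <;>
      rcases val u₃ (by simp) with e₃ | e₃ <;>
      first
      | exact .inl (hinj (e₁.trans e₂.symm))
      | exact .inr (.inl (hinj (e₁.trans e₃.symm)))
      | exact .inr (.inr (hinj (e₂.trans e₃.symm)))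
  have card_le : ∀ i, i ≤ 19 → (wordValues s J i).ncard ≤ 2 := by
    intro i hi
    by_contra! hlt
    obtain ⟨_, _, _, ⟨u₁, h₁, rfl⟩, ⟨u₂, h₂, rfl⟩, ⟨u₃, h₃, rfl⟩, n₁, n₂, n₃⟩ :=
      (Set.two_lt_ncard_iff (wordValues_finite s J i)).1 hlt
    rcases three hi h₁ h₂ h₃ with e | e | e
    exacts [n₁ e, n₂ e, n₃ e]
  -- Of three letters put before `u`, two, say `c` and `d`, give the same value; then `c⁻¹ * d`
  -- fixes `mk u • J` and can be inserted in front without changing it.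
  have avoid : ∀ i, i ≤ 18 → ∀ v ∈ wordValues s J i, ∀ a : S × Bool, ∃ (b : S × Bool)
      (u : List (S × Bool)), b ≠ a ∧ (b :: u).length = i + 2 ∧ IsReduced (b :: u ++ [s]) ∧
        v = mk (b :: u) • J := by
    rintro i hi _ ⟨u, hu, rfl⟩ a
    obtain ⟨t, ht⟩ : ∃ t, (u ++ [s]).head? = some t := by cases u <;> simp
    obtain ⟨c₁, h₁⟩ := exists_letter_notMem hS {invLetter a, invLetter t}
      (Finset.card_le_two.trans (by norm_num))
    obtain ⟨c₂, h₂⟩ := exists_letter_notMem hS {invLetter a, invLetter t, c₁}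
      (Finset.card_le_three.trans (by norm_num))
    obtain ⟨c₃, h₃⟩ := exists_letter_notMem hS {invLetter a, invLetter t, c₁, c₂}
      (Finset.card_le_four.trans (by norm_num))
    simp only [Finset.mem_insert, Finset.mem_singleton, not_or] at h₁ h₂ h₃
    have red : ∀ c, c ≠ invLetter t → IsReduced (c :: u ++ [s]) := fun c hc =>
      isReduced_cons_append ht hu.2 fun e => hc (by rw [e, invLetter_invLetter])
    have build : ∀ c d, c ≠ invLetter a → d ≠ invLetter t → d ≠ c →
        mk (c :: u) • J = mk (d :: u) • J → ∃ (b : S × Bool)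
      (u' : List (S × Bool)), b ≠ a ∧ (b :: u').length = i + 2 ∧ IsReduced (b :: u' ++ [s]) ∧
        mk u • J = mk (b :: u') • J := by
      intro c d hca hdt hdc e
      refine ⟨invLetter c, d :: u, fun e => hca (by rw [← e, invLetter_invLetter]),
        by simp [hu.1], isReduced_cons_append rfl (red d hdt) (by rwa [invLetter_invLetter]), ?_⟩
      have e1 : mk (c :: u) = mk [c] * mk u := by simp [mul_mk]
      have e2 : mk (invLetter c :: d :: u) = mk [invLetter c] * mk (d :: u) := by simp [mul_mk]
      rw [e2, mul_smul, ← e, e1, mul_smul, mk_invLetter, inv_smul_smul]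
    have len : ∀ c : S × Bool, (c :: u).length = i + 1 := fun c => by simp [hu.1]
    rcases three (i := i + 1) (by omega) ⟨len c₁, red c₁ h₁.2⟩ ⟨len c₂, red c₂ h₂.2.1⟩
      ⟨len c₃, red c₃ h₃.2.1⟩ with e | e | e
    · exact build c₁ c₂ h₁.1 h₂.2.1 h₂.2.2 e
    · exact build c₁ c₃ h₁.1 h₃.2.1 h₃.2.2.1 e
    · exact build c₂ c₃ h₂.1 h₃.2.1 h₃.2.2.2 e
  have two : ∀ i, i ≤ 18 → wordValues s J i ⊆ wordValues s J (i + 2) := by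
    intro i hi v hv
    obtain ⟨b, u, -, h1, h2, h3⟩ := avoid i hi v hv s
    exact ⟨b :: u, ⟨h1, h2⟩, h3⟩
  have letter : ∀ i, i ≤ 18 → ∀ a : S × Bool, ∀ v ∈ wordValues s J i,
      mk [a] • v ∈ wordValues s J (i + 3) := by
    intro i hi a v hv
    obtain ⟨b, u, hb, h1, h2, rfl⟩ := avoid i hi v hv (invLetter a)
    refine ⟨a :: b :: u, ⟨by rw [List.length_cons, h1], isReduced_cons_append rfl h2 hb⟩, ?_⟩
    rw [← mul_smul, mul_mk]
    rfl
  have two' : ∀ i, i ≤ 16 → wordValues s J i ⊆ wordValues s J (i + 4) := fun i hi =>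
    (two i (by omega)).trans (two (i + 2) (by omega))
  -- These sets have at most four elements and increase, so they repeat by `m = 4`, where the
  -- lengths are still at most 17. A letter maps `f m` into `f (m + 1)`: lengths go from `4 * m` to
  -- `4 * m + 3` and on to `4 * m + 5`, and from `4 * m + 1` to `4 * m + 4`.
  let f : ℕ → Set W := fun m => wordValues s J (4 * m) ∪ wordValues s J (4 * m + 1)
  obtain ⟨m, hm, hf⟩ := exists_stationary f
    (fun m => (wordValues_finite s J _).union (wordValues_finite s J _))
    (fun m hm => Set.union_subset_union (two' _ (by omega)) (two' _ (by omega)))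
    ⟨J, .inl ⟨[], ⟨rfl, by simp⟩, by simp [← one_eq_mk]⟩⟩
    (fun m hm => (Set.ncard_union_le _ _).trans
      (Nat.add_le_add (card_le _ (by omega)) (card_le _ (by omega))))
  have base : J ∈ f m := by
    have hJ : ∀ l, l ≤ 3 → J ∈ wordValues s J (4 * l) := by
      intro l
      induction l with
      | zero => exact fun _ => ⟨[], ⟨rfl, by simp⟩, by simp [← one_eq_mk]⟩
      | succ l ih => exact fun hl => two' (4 * l) (by omega) (ih (by omega))
    exact .inl (hJ m hm)
  refine orbit_finite_of_letters (Ω := f m)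
    ((wordValues_finite s J _).union (wordValues_finite s J _)) base ?_
  intro a v hv
  rw [← hf]
  rcases hv with hv | hv
  · exact .inr (two (4 * m + 3) (by omega) (letter (4 * m) (by omega) a v hv))
  · exact .inl (letter (4 * m + 1) (by omega) a v hv)

/-- A wall which most framed words of two consecutive lengths leave invariant or move to a
crossing wall has a finite orbit, if no three walls cross. -/
theorem orbit_finite_of_few_exceptions [Fintype S] (hS : 7 ≤ Fintype.card S) (s : S × Bool)
    {τ : ℝ} (hτ : 1 ≤ τ) {k : ℕ} (hk : 8 * τ ^ (k + 27) ≤ ((2 * Fintype.card S - 1 : ℕ) : ℝ) ^ k)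
    {H : W} {Cr : W → W → Prop} (hCr : ∀ (g : FreeGroup S) (A B : W), Cr A B → Cr (g • A) (g • B))
    (hrank : ∀ A B C, Cr A B → Cr A C → Cr B C → False)
    (h1 : ({w ∈ frames s (k + 24) | mk w • H ≠ H ∧ ¬ Cr H (mk w • H)}.ncard : ℝ) <
      4 * τ ^ (k + 27))
    (h2 : ({w ∈ frames s (2 * (k + 24)) | mk w • H ≠ H ∧ ¬ Cr H (mk w • H)}.ncard : ℝ) <
      4 * τ ^ (2 * (k + 24) + 3)) :
    (MulAction.orbit (FreeGroup S) H).Finite := by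
  have hτ0 : 0 < τ := by linarith
  set b := k + 24 with hb
  set E₁ := {w ∈ frames s b | mk w • H ≠ H ∧ ¬ Cr H (mk w • H)} with hE₁
  set E₂ := {w ∈ frames s (2 * b) | mk w • H ≠ H ∧ ¬ Cr H (mk w • H)} with hE₂
  have fin₁ : E₁.Finite := (frames_finite s _).subset fun _ h => h.1
  have fin₂ : E₂.Finite := (frames_finite s _).subset fun _ h => h.1
  -- Most framed words send `H` to one of two places. If few words make it cross its image, `K = H`
  -- will do; otherwise `K` comes from one such word.
  have hK : ∃ K : W, ({w ∈ frames s b | mk w • H ≠ H ∧ mk w • H ≠ K}.ncard : ℝ) <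
      8 * τ ^ (k + 27) := by
    set M := {w ∈ frames s b | mk w • H ≠ H ∧ Cr H (mk w • H)} with hM
    have finM : M.Finite := (frames_finite s _).subset fun _ h => h.1
    by_cases hMc : (M.ncard : ℝ) < τ ^ (k + 27)
    · refine ⟨H, lt_of_le_of_lt (b := (E₁.ncard : ℝ) + M.ncard) ?_ ?_⟩
      · have : {w ∈ frames s b | mk w • H ≠ H ∧ mk w • H ≠ H} ⊆ E₁ ∪ M := by
          rintro w ⟨hw, hw', -⟩
          by_cases hc : Cr H (mk w • H)
          · exact .inr ⟨hw, hw', hc⟩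
          · exact .inl ⟨hw, hw', hc⟩
        exact_mod_cast (Set.ncard_le_ncard this (fin₁.union finM)).trans (Set.ncard_union_le _ _)
      · have : 0 < τ ^ (k + 27) := by positivity
        linarith
    push Not at hMc
    -- Pigeonhole over the first halves of the exceptional words of length `2 * b`; the exponent `2
    -- * b + 3` is `(k + 27) + b`.
    obtain ⟨w₁, hw₁, hbad⟩ : ∃ w₁ ∈ M,
        ({w ∈ frames s b | w₁ ++ w ∈ E₂}.ncard : ℝ) < 4 * τ ^ b := by
      by_contra! hall
      have := mul_le_ncard_append (A := M) (a := b) (fun w hw => hw.1.1) finM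
        (B := fun w₁ => {w ∈ frames s b | w₁ ++ w ∈ E₂}) fin₂ (fun w hw v hv => hv.2) hall
      have h3 : τ ^ (k + 27) * (4 * τ ^ b) ≤ M.ncard * (4 * τ ^ b) := by gcongr
      have h4 : τ ^ (k + 27) * (4 * τ ^ b) = 4 * τ ^ (2 * b + 3) := by
        rw [show 2 * b + 3 = (k + 27) + b by omega, pow_add]
        ring
      linarith
    refine ⟨(mk w₁)⁻¹ • H, lt_of_le_of_lt
      (b := (E₁.ncard : ℝ) + {w ∈ frames s b | w₁ ++ w ∈ E₂}.ncard) ?_ ?_⟩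
    · have : {w ∈ frames s b | mk w • H ≠ H ∧ mk w • H ≠ (mk w₁)⁻¹ • H} ⊆
          E₁ ∪ {w ∈ frames s b | w₁ ++ w ∈ E₂} := by
        rintro w ⟨hw, hw', hw''⟩
        by_contra hn
        simp only [Set.mem_union, hE₁, hE₂, Set.mem_ofPred_eq, not_or, not_and, not_not] at hn
        obtain ⟨n1, n2⟩ := hn
        have hmul : mk (w₁ ++ w) • H = mk w₁ • mk w • H := by rw [← mul_smul, mul_mk]
        have c1 := n1 hw hw'
        have c2 : Cr H (mk (w₁ ++ w) • H) := by
          refine n2 hw ⟨?_, hw₁.1.2.isBlock.append_framed hw.2⟩ ?_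
          · rw [List.length_append, hw.1, hw₁.1.1]
            omega
          · rw [hmul]
            intro e
            exact hw'' (by rw [eq_inv_smul_iff, e])
        rw [hmul] at c2
        -- The walls `H`, `w₁ • H` and `w₁ • w • H` would cross pairwise.
        exact hrank _ _ _ hw₁.2.2 c2 (hCr _ _ _ c1)
      exact_mod_cast (Set.ncard_le_ncard this (fin₁.union ((frames_finite s _).subset
        fun _ h => h.1))).trans (Set.ncard_union_le _ _)
    · have : τ ^ b ≤ τ ^ (k + 27) := pow_le_pow_right₀ hτ (by omega)
      linarith
  obtain ⟨K, hK⟩ := hK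
  set E := {w ∈ frames s b | mk w • H ≠ H ∧ mk w • H ≠ K} with hE
  -- Here `b = 21 + (k + 3)`. Otherwise each of the at least `q ^ k` suffixes would occur in a
  -- different member of `E`, which is too small.
  obtain ⟨w', hw', hgood⟩ : ∃ w' ∈ frames s (k + 3), ∀ x ∈ blocks s 21, x ++ w' ∉ E := by
    by_contra! hall
    choose! x hx hxE using hall
    have hle : (frames s (k + 3)).ncard ≤ E.ncard := by
      refine Set.ncard_le_ncard_of_injOn (fun w => x w ++ w) hxE ?_
        ((frames_finite s _).subset fun _ h => h.1)
      intro w hw v hv e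
      exact (List.append_inj e ((hx w hw).1.trans (hx v hv).1.symm)).2
    have h3 : ((2 * Fintype.card S - 1 : ℕ) : ℝ) ^ k ≤ E.ncard := by
      exact_mod_cast (pow_le_ncard_frames hS s k).trans hle
    linarith
  have hJ := orbit_finite_of_two_values hS s (J := mk w' • H) (H := H) (K := K) (by
    intro x hx
    by_contra! hn
    refine hgood x hx ⟨⟨?_, hx.2.append_framed hw'.2⟩, ?_⟩
    · rw [List.length_append, hx.1, hw'.1]
      omega
    · rw [← mul_mk, mul_smul]
      exact hn)
  rwa [MulAction.orbit_smul] at hJ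

end Walls

/-! ## Actions preserving a system of halfspaces of rank two -/

section Core

open FreeGroup

open scoped Pointwise

/-- The properties of the halfspaces of a two-dimensional `CAT(0)` cube complex needed to find
a finite orbit. -/
structure HalfspaceSystem (G : Type v) {V : Type u} [Group G] [MulAction G V]
    (ℋ : Set (Set V)) : Prop where
  compl_mem : ∀ h ∈ ℋ, hᶜ ∈ ℋ
  smul_mem : ∀ (g : G), ∀ h ∈ ℋ, g • h ∈ ℋ
  finite_separating : ∀ x y, {h ∈ ℋ | x ∈ h ∧ y ∉ h}.Finite
  exists_separating : ∀ x y, x ≠ y → ∃ h ∈ ℋ, x ∉ h ∧ y ∈ h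
  not_three_crossing : ∀ h₁ ∈ ℋ, ∀ h₂ ∈ ℋ, ∀ h₃ ∈ ℋ,
    Crosses h₁ h₂ → Crosses h₁ h₃ → Crosses h₂ h₃ → False
  helly : ∀ T ⊆ ℋ, (∀ y, {h ∈ T | y ∈ h}.Finite) →
    (∀ h ∈ T, ∀ k ∈ T, (hᶜ ∩ kᶜ).Nonempty) → ∃ y, ∀ h ∈ T, y ∉ h

theorem smul_ssubset_smul {G V : Type*} [Group G] [MulAction G V] {h k : Set V} (hk : h ⊂ k)
    (g : G) : g • h ⊂ g • k :=
  ⟨Set.smul_set_mono hk.1, fun e => hk.2 (Set.smul_set_subset_smul_set_iff.1 e)⟩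

theorem Crosses.compl_left {V : Type u} {h k : Set V} (hc : Crosses h k) : Crosses hᶜ k := by
  unfold Crosses at *
  rw [compl_compl]
  tauto

theorem Crosses.symm {V : Type u} {h k : Set V} (hc : Crosses h k) : Crosses k h := by
  unfold Crosses at *
  rw [Set.inter_comm k h, Set.inter_comm k, Set.inter_comm kᶜ, Set.inter_comm kᶜ]
  tauto

theorem Crosses.smul {G V : Type*} [Group G] [MulAction G V] {h k : Set V} (hc : Crosses h k)
    (g : G) : Crosses (g • h) (g • k) := by
  unfold Crosses at *
  simp only [← Set.smul_set_compl, ← Set.smul_set_inter, Set.smul_set_nonempty]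
  exact hc

/-- The wall bounding a halfspace: the halfspace together with its complement. -/
def wall {V : Type u} (h : Set V) : Set (Set V) := {h, hᶜ}

theorem smul_wall {G V : Type*} [Group G] [MulAction G V] (g : G) (h : Set V) :
    g • wall h = wall (g • h) := by
  simp only [wall, ← Set.image_smul, Set.image_pair]
  simp only [Set.image_smul, Set.smul_set_compl]

theorem eq_or_eq_compl_of_wall_eq {V : Type u} {h k : Set V} (e : wall h = wall k) :
    k = h ∨ k = hᶜ := by
  have : k ∈ wall h := e ▸ Set.mem_insert _ _
  simpa [wall] using this

theorem wall_compl {V : Type u} (h : Set V) : wall hᶜ = wall h := by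
  rw [wall, compl_compl, Set.pair_comm]
  rfl

/-- Two walls bounding crossing halfspaces. -/
def WallsCross {V : Type u} (ℋ : Set (Set V)) (A B : Set (Set V)) : Prop :=
  ∃ h ∈ ℋ, ∃ k ∈ ℋ, A = wall h ∧ B = wall k ∧ Crosses h k

theorem WallsCross.crosses {V : Type u} {ℋ : Set (Set V)} {h k : Set V}
    (hc : WallsCross ℋ (wall h) (wall k)) : Crosses h k := by
  obtain ⟨h', -, k', -, e, e', hc⟩ := hc
  rcases eq_or_eq_compl_of_wall_eq e with rfl | rfl <;>
    rcases eq_or_eq_compl_of_wall_eq e' with rfl | rfl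
  · exact hc
  · simpa using hc.symm.compl_left.symm
  · simpa using hc.compl_left
  · simpa using hc.compl_left.symm.compl_left.symm

theorem orbit_finite_of_wall {G V : Type*} [Group G] [MulAction G V] {h : Set V}
    (hf : (MulAction.orbit G (wall h)).Finite) : (MulAction.orbit G h).Finite := by
  refine (Set.Finite.sUnion hf ?_).subset ?_
  · rintro _ ⟨g, rfl⟩
    change (g • wall h).Finite
    rw [smul_wall]
    exact (Set.finite_singleton _).insert _
  · rintro _ ⟨g, rfl⟩
    refine ⟨g • wall h, ⟨g, rfl⟩, ?_⟩
    rw [smul_wall]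
    exact Set.mem_insert _ _

theorem orbit_compl_finite {G V : Type*} [Group G] [MulAction G V] {h : Set V}
    (hf : (MulAction.orbit G h).Finite) : (MulAction.orbit G hᶜ).Finite := by
  refine (hf.image compl).subset ?_
  rintro _ ⟨g, rfl⟩
  exact ⟨g • h, ⟨g, rfl⟩, Set.smul_set_compl.symm⟩

variable {S : Type v} {V : Type u} [MulAction (FreeGroup S) V]

/-- Many framed words of length `b` or `2 * b` map `h` into its complement. -/
def IsReversed (s : S × Bool) (τ : ℝ) (b : ℕ) (h : Set V) : Prop :=
  ∃ ℓ, (ℓ = b ∨ ℓ = 2 * b) ∧ τ ^ (ℓ + 3) ≤ ({w ∈ frames s ℓ | mk w • h ⊂ hᶜ}.ncard : ℝ)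

/-- Few blocks of length at most `Λ` shrink `h`. -/
def FewContractions (s : S × Bool) (τ : ℝ) (Λ : ℕ) (h : Set V) : Prop :=
  ∀ ℓ, 1 ≤ ℓ → ℓ ≤ Λ → ({w ∈ blocks s ℓ | mk w • h ⊂ h}.ncard : ℝ) < τ ^ ℓ

/-- Words which may be inserted, together with their inverses, between two letters `s`. -/
def IsConnector (s : S × Bool) (y : List (S × Bool)) : Prop :=
  IsReduced (s :: y ++ [s]) ∧ IsReduced (s :: invRev y ++ [s]) ∧ y.length ≤ 3

/-- The composites are distinct blocks, at least `τ ^ (ℓ₁ + ℓ₂ + 6)` in number, of length `ℓ₁ + ℓ₂ +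
2 * y.length ≤ 4 * b + 6`. The surplus 3 in the exponents of `IsReversed` pays for connectors of
length at most 3. -/
theorem FewContractions.not_composite [Finite S] {s : S × Bool} {τ : ℝ} (hτ : 1 ≤ τ) {b : ℕ}
    (hb : 1 ≤ b) {h : Set V} (hN : FewContractions s τ (4 * b + 6) h) {y : List (S × Bool)}
    (hy : IsConnector s y) {ℓ₁ ℓ₂ : ℕ} (h₁ : ℓ₁ = b ∨ ℓ₁ = 2 * b) (h₂ : ℓ₂ = b ∨ ℓ₂ = 2 * b)
    {A B : Set (List (S × Bool))} (hA : A ⊆ frames s ℓ₁) (hB : B ⊆ frames s ℓ₂)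
    (hAc : τ ^ (ℓ₁ + 3) ≤ (A.ncard : ℝ)) (hBc : τ ^ (ℓ₂ + 3) ≤ (B.ncard : ℝ)) :
    ¬ ∀ w₁ ∈ A, ∀ w₂ ∈ B, mk (w₁ ++ invRev y ++ (w₂ ++ y)) • h ⊂ h := by
  intro hall
  have hlen := hy.2.2
  have key := mul_le_ncard_append (A := (fun w => w ++ invRev y) '' A) (a := ℓ₁ + y.length)
    (B := fun _ => (fun w => w ++ y) '' B)
    (C := {w ∈ blocks s (ℓ₁ + ℓ₂ + 2 * y.length) | mk w • h ⊂ h}) (c := (B.ncard : ℝ))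
    (by
      rintro _ ⟨w, hw, rfl⟩
      simp [(hA hw).1])
    (((frames_finite s ℓ₁).subset hA).image _)
    ((blocks_finite s _).subset fun _ h => h.1)
    (by
      rintro _ ⟨w, hw, rfl⟩ _ ⟨v, hv, rfl⟩
      refine ⟨⟨?_, ((hA hw).2.append_connector hy.2.1).append
        ((hB hv).2.append_connector hy.1)⟩, hall w hw v hv⟩
      simp only [List.length_append, invRev_length, (hA hw).1, (hB hv).1]
      omega)
    (by
      rintro _ -
      rw [Set.ncard_image_of_injective _ fun _ _ h => List.append_cancel_right h])
  rw [Set.ncard_image_of_injective _ fun _ _ h => List.append_cancel_right h] at key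
  have hlt := hN (ℓ₁ + ℓ₂ + 2 * y.length) (by omega) (by omega)
  have h3 : τ ^ (ℓ₁ + 3) * τ ^ (ℓ₂ + 3) ≤ (A.ncard : ℝ) * B.ncard := by gcongr
  rw [← pow_add] at h3
  have h4 : τ ^ (ℓ₁ + ℓ₂ + 2 * y.length) ≤ τ ^ (ℓ₁ + 3 + (ℓ₂ + 3)) :=
    pow_le_pow_right₀ hτ (by omega)
  linarith

/-- A halfspace and a translate of its complement under a connector are not both reversed. -/
theorem IsReversed.not_smul_compl [Finite S] {s : S × Bool} {τ : ℝ} (hτ : 1 ≤ τ) {b : ℕ}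
    (hb : 1 ≤ b) {h : Set V} (hN : FewContractions s τ (4 * b + 6) hᶜ) {y : List (S × Bool)}
    (hy : IsConnector s y) (hr : IsReversed s τ b h) : ¬ IsReversed s τ b (mk y • hᶜ) := by
  obtain ⟨ℓ₁, hℓ₁, hc₁⟩ := hr
  rintro ⟨ℓ₂, hℓ₂, hc₂⟩
  refine hN.not_composite hτ hb hy hℓ₁ hℓ₂ (fun _ h => h.1) (fun _ h => h.1) hc₁ hc₂ ?_
  rintro w₁ ⟨-, hw₁⟩ w₂ ⟨-, hw₂⟩
  simp only [← mul_mk, ← inv_mk, mul_smul]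
  rw [← Set.smul_set_compl, compl_compl] at hw₂
  -- The composite moves `hᶜ` strictly into `w₁ • h`, and that lies in `hᶜ`.
  have h1 := smul_ssubset_smul (smul_ssubset_smul hw₂ (mk y)⁻¹) (mk w₁)
  rw [inv_smul_smul] at h1
  exact h1.trans hw₁

theorem isConnector_nil (s : S × Bool) : IsConnector s [] := by
  simp [IsConnector, isReduced_cons_cons]

/-- The complements of two reversed halfspaces meet. -/
theorem IsReversed.compl_inter_compl_nonempty [Finite S] {s : S × Bool} {τ : ℝ} (hτ : 1 ≤ τ)
    {b : ℕ} (hb : 1 ≤ b) {h k : Set V} (hN : FewContractions s τ (4 * b + 6) h)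
    (hh : IsReversed s τ b h) (hk : IsReversed s τ b k) : (hᶜ ∩ kᶜ).Nonempty := by
  obtain ⟨ℓ₁, hℓ₁, hc₁⟩ := hh
  obtain ⟨ℓ₂, hℓ₂, hc₂⟩ := hk
  by_contra hemp
  have hhk : hᶜ ⊆ k := fun x hx => by
    by_contra hxk
    exact hemp ⟨x, hx, hxk⟩
  have hkh : kᶜ ⊆ h := fun x hx => by
    by_contra hxk
    exact hemp ⟨x, hxk, hx⟩
  refine hN.not_composite hτ hb (isConnector_nil s) hℓ₂ hℓ₁ (fun _ h => h.1) (fun _ h => h.1)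
    hc₂ hc₁ ?_
  rintro w₁ ⟨-, hw₁⟩ w₂ ⟨-, hw₂⟩
  simp only [invRev_empty, List.append_nil, ← mul_mk, mul_smul]
  exact (smul_ssubset_smul (hw₂.trans_subset hhk) (mk w₁)).trans (hw₁.trans_subset hkh)

/-- If neither `h` nor its complement is reversed, then `h` has a finite orbit. -/
theorem orbit_finite_of_not_isReversed [Fintype S] (hS : 7 ≤ Fintype.card S) {s : S × Bool}
    {τ : ℝ} (hτ : 1 ≤ τ) {k : ℕ}
    (hk : 8 * τ ^ (k + 27) ≤ ((2 * Fintype.card S - 1 : ℕ) : ℝ) ^ k) {ℋ : Set (Set V)}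
    (hH : HalfspaceSystem (FreeGroup S) ℋ)
    (hN : ∀ h ∈ ℋ, FewContractions s τ (4 * (k + 24) + 6) h) {h : Set V} (hh : h ∈ ℋ)
    (h1 : ¬ IsReversed s τ (k + 24) h) (h2 : ¬ IsReversed s τ (k + 24) hᶜ) :
    (MulAction.orbit (FreeGroup S) h).Finite := by
  have key : ∀ ℓ, (ℓ = k + 24 ∨ ℓ = 2 * (k + 24)) →
      ({w ∈ frames s ℓ | mk w • wall h ≠ wall h ∧
        ¬ WallsCross ℋ (wall h) (mk w • wall h)}.ncard : ℝ) < 4 * τ ^ (ℓ + 3) := by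
    intro ℓ hℓ
    have a1 : ({w ∈ frames s ℓ | mk w • h ⊂ hᶜ}.ncard : ℝ) < τ ^ (ℓ + 3) := by
      by_contra! hc
      exact h1 ⟨ℓ, hℓ, hc⟩
    have a2 : ({w ∈ frames s ℓ | mk w • hᶜ ⊂ hᶜᶜ}.ncard : ℝ) < τ ^ (ℓ + 3) := by
      by_contra! hc
      exact h2 ⟨ℓ, hℓ, hc⟩
    have a3 : ∀ h' ∈ ℋ, ({w ∈ frames s ℓ | mk w • h' ⊂ h'}.ncard : ℝ) < τ ^ (ℓ + 3) := by
      intro h' hh'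
      have hle : {w ∈ frames s ℓ | mk w • h' ⊂ h'}.ncard ≤
          {w ∈ blocks s ℓ | mk w • h' ⊂ h'}.ncard :=
        Set.ncard_le_ncard (fun w hw => ⟨⟨hw.1.1, hw.1.2.isBlock⟩, hw.2⟩)
          ((blocks_finite s ℓ).subset fun _ h => h.1)
      have hlt := hN h' hh' ℓ (by omega) (by omega)
      have hle' : τ ^ ℓ ≤ τ ^ (ℓ + 3) := pow_le_pow_right₀ hτ (by omega)
      exact lt_of_le_of_lt (Nat.cast_le.2 hle) (hlt.trans_le hle')
    have a4 := a3 h hh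
    have a5 := a3 hᶜ (hH.compl_mem h hh)
    have hsub : {w ∈ frames s ℓ | mk w • wall h ≠ wall h ∧
        ¬ WallsCross ℋ (wall h) (mk w • wall h)} ⊆
        ({w ∈ frames s ℓ | mk w • h ⊂ hᶜ} ∪ {w ∈ frames s ℓ | mk w • hᶜ ⊂ hᶜᶜ}) ∪
        ({w ∈ frames s ℓ | mk w • h ⊂ h} ∪ {w ∈ frames s ℓ | mk w • hᶜ ⊂ hᶜ}) := by
      rintro w ⟨hw, hne, hnc⟩
      rw [smul_wall] at hne hnc
      have e1 : mk w • h ≠ h := fun e => hne (by rw [e])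
      have e2 : mk w • h ≠ hᶜ := fun e => hne (by rw [e, wall_compl])
      have e3 : mk w • hᶜ ≠ h := fun e => hne (by
        rw [← wall_compl (mk w • h), ← Set.smul_set_compl, e])
      have e4 : mk w • hᶜ ≠ hᶜ := fun e => hne (by
        rw [← wall_compl (mk w • h), ← Set.smul_set_compl, e, wall_compl])
      by_contra hn
      simp only [Set.mem_union, Set.mem_ofPred_eq, not_or, hw, true_and, compl_compl] at hn
      obtain ⟨⟨n1, n2⟩, n3, n4⟩ := hn
      -- The failure of each of the four nestings produces one of the four quarters needed for
      -- crossing; this is the origin of the factor 4.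
      have aux : ∀ {p r : Set V}, p ≠ r → ¬ p ⊂ r → (rᶜ ∩ p).Nonempty := by
        intro p r hpr hss
        by_contra hemp
        exact hss (LE.le.ssubset_of_ne (fun x hx => by
          by_contra hxr
          exact hemp ⟨x, hxr, hx⟩) hpr)
      refine hnc ⟨h, hh, mk w • h, hH.smul_mem _ h hh, rfl, rfl, ?_, ?_, aux e1 n3, ?_⟩
      · simpa using aux e2 n1
      · simpa [Set.smul_set_compl] using aux e4 n4
      · simpa [Set.smul_set_compl] using aux e3 n2
    have hfin : ∀ p : List (S × Bool) → Prop, {w ∈ frames s ℓ | p w}.Finite := fun p =>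
      (frames_finite s ℓ).subset fun _ h => h.1
    have h6 := (Set.ncard_le_ncard hsub (((hfin _).union (hfin _)).union
      ((hfin _).union (hfin _)))).trans ((Set.ncard_union_le _ _).trans
        (Nat.add_le_add (Set.ncard_union_le _ _) (Set.ncard_union_le _ _)))
    have h7 := Nat.cast_le (α := ℝ).2 h6
    push_cast at h7
    linarith
  refine orbit_finite_of_wall (orbit_finite_of_few_exceptions hS s hτ hk (Cr := WallsCross ℋ)
    ?_ ?_ (key _ (.inl rfl)) (key _ (.inr rfl)))
  · rintro g _ _ ⟨h, hh, k, hk, rfl, rfl, hc⟩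
    exact ⟨g • h, hH.smul_mem g h hh, g • k, hH.smul_mem g k hk, smul_wall _ _, smul_wall _ _,
      hc.smul g⟩
  · rintro _ _ C ⟨h, hh, k, hk, rfl, rfl, hc⟩ ⟨h', hh', l, hl, e, rfl, hc'⟩ hkl
    refine hH.not_three_crossing h hh k hk l hl hc ?_ hkl.crosses
    rcases eq_or_eq_compl_of_wall_eq e with rfl | rfl
    · exact hc'
    · simpa using hc'.compl_left

end Core

/-! ### A vertex with finite orbit -/

section FiniteOrbit

open FreeGroup

open scoped Pointwise

variable {S : Type v} {V : Type u} [MulAction (FreeGroup S) V]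

theorem isConnector_singleton {s t : S × Bool} (h : s.1 ≠ t.1) : IsConnector s [t] := by
  simp [IsConnector, isReduced_cons_cons, invRev, h, h.symm]

/-- The letter `s` alone is not a connector, because `s s⁻¹ s` is not reduced; this word recovers it
as `t⁻¹ (t s t) t⁻¹`. -/
theorem isConnector_conj {s t : S × Bool} (h : s.1 ≠ t.1) : IsConnector s [t, s, t] := by
  simp [IsConnector, isReduced_cons_cons, invRev, h, h.symm]

theorem IsConnector.invRev {s : S × Bool} {y : List (S × Bool)} (h : IsConnector s y) :
    IsConnector s (FreeGroup.invRev y) := by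
  refine ⟨h.2.1, ?_, ?_⟩
  · rw [invRev_invRev]
    exact h.1
  · rw [invRev_length]
    exact h.2.2

/-- A set which is invariant under all connectors is invariant under the free group. -/
theorem smul_mem_of_connectors {Y : Type*} [MulAction (FreeGroup S) Y] [Nontrivial S]
    {s : S × Bool} {T : Set Y} (hT : ∀ y, IsConnector s y → ∀ h ∈ T, mk y • h ∈ T)
    (g : FreeGroup S) : ∀ h ∈ T, g • h ∈ T := by
  obtain ⟨t, ht⟩ := exists_ne s.1
  have hst : s.1 ≠ (t, true).1 := ht.symm
  have hst' : s.1 ≠ (t, false).1 := ht.symm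
  have letter : ∀ a : S × Bool, ∀ h ∈ T, mk [a] • h ∈ T := by
    intro a h hh
    by_cases has : s.1 = a.1
    · have e1 : mk [((t, true) : S × Bool)] = (mk [(t, false)])⁻¹ := by
        simp [inv_mk, FreeGroup.invRev]
      have key : ∀ z : FreeGroup S, (∀ h ∈ T, z • h ∈ T) →
          ∀ h ∈ T, ((mk [((t, false) : S × Bool)]) * z * mk [((t, false) : S × Bool)]) • h ∈ T ∧
          ((mk [((t, true) : S × Bool)]) * z * mk [((t, true) : S × Bool)]) • h ∈ T := by
        intro z hz h hh
        simp only [mul_smul]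
        exact ⟨hT _ (isConnector_singleton hst') _ (hz _ (hT _ (isConnector_singleton hst') _ hh)),
          hT _ (isConnector_singleton hst) _ (hz _ (hT _ (isConnector_singleton hst) _ hh))⟩
      have e2 : mk [((t, true) : S × Bool), s, (t, true)] =
          mk [(t, true)] * mk [s] * mk [(t, true)] := by simp [mul_mk]
      by_cases hb : s.2 = a.2
      · obtain rfl : s = a := Prod.ext has hb
        have := (key _ (hT _ (isConnector_conj hst)) h hh).1
        rw [e2, e1] at this
        rwa [show ∀ p x : FreeGroup S, p * (p⁻¹ * x * p⁻¹) * p = x from fun p x => by group] at this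
      · obtain rfl : a = invLetter s := by
          by_contra hne
          exact hb (rel_iff_ne_invLetter.2 hne has)
        have := (key _ (hT _ (isConnector_conj hst).invRev) h hh).2
        rw [← inv_mk, e2, e1] at this
        rw [mk_invLetter]
        rwa [show ∀ p x : FreeGroup S, p⁻¹ * (p⁻¹ * x * p⁻¹)⁻¹ * p⁻¹ = x⁻¹ from
          fun p x => by group] at this
    · exact hT _ (isConnector_singleton has) h hh
  induction g using Quot.inductionOn with
  | h w =>
  change ∀ h ∈ T, mk w • h ∈ T
  induction w with
  | nil => intro h hh; simpa [← one_eq_mk] using hh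
  | cons a w ih =>
    intro h hh
    have : mk (a :: w) = mk [a] * mk w := by simp [mul_mk]
    rw [this, mul_smul]
    exact letter a _ (ih h hh)

/-- A point such that all halfspaces separating it from its translates have finite orbits has a
finite orbit. -/
theorem HalfspaceSystem.orbit_point_finite [Finite S] {ℋ : Set (Set V)}
    (hH : HalfspaceSystem (FreeGroup S) ℋ) {y : V}
    (hy : ∀ h ∈ ℋ, ∀ g : FreeGroup S, y ∈ h → g • y ∉ h →
      (MulAction.orbit (FreeGroup S) h).Finite) :
    (MulAction.orbit (FreeGroup S) y).Finite := by
  -- Following a word letter by letter, any halfspace separating `y` from a translate is a translate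
  -- of one in `C₀`. So the finite set `C` contains them all.
  set C₀ : Set (Set V) := ⋃ a : S × Bool, {h ∈ ℋ | y ∈ h ∧ FreeGroup.mk [a] • y ∉ h} with hC₀
  set C : Set (Set V) := ⋃ h ∈ C₀, MulAction.orbit (FreeGroup S) h with hC
  have finC₀ : C₀.Finite := Set.finite_iUnion fun a => hH.finite_separating _ _
  have finC : C.Finite := by
    refine finC₀.biUnion fun h hh => ?_
    obtain ⟨a, h1, h2, h3⟩ := Set.mem_iUnion.1 hh
    exact hy h h1 _ h2 h3
  have smulC : ∀ g : FreeGroup S, ∀ h ∈ C, g • h ∈ C := by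
    intro g h hh
    simp only [hC, Set.mem_iUnion] at hh ⊢
    obtain ⟨k, hk, hkh⟩ := hh
    exact ⟨k, hk, MulAction.mem_orbit_of_mem_orbit g hkh⟩
  have sepC : ∀ g : FreeGroup S, ∀ h ∈ ℋ, y ∈ h → g • y ∉ h → h ∈ C := by
    intro g
    induction g using Quot.inductionOn with
    | h w =>
    change ∀ h ∈ ℋ, y ∈ h → FreeGroup.mk w • y ∉ h → h ∈ C
    induction w with
    | nil =>
      intro h _ h1 h2
      exact absurd h1 (by simpa [← one_eq_mk] using h2)
    | cons a w ih =>
      intro h hh h1 h2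
      have e : FreeGroup.mk (a :: w) = FreeGroup.mk [a] * FreeGroup.mk w := by simp [mul_mk]
      rw [e, mul_smul] at h2
      by_cases h3 : FreeGroup.mk [a] • y ∈ h
      · have := ih ((FreeGroup.mk [a])⁻¹ • h) (hH.smul_mem _ h hh)
          (Set.mem_inv_smul_set_iff.2 h3) (fun h4 => h2 (Set.mem_inv_smul_set_iff.1 h4))
        simpa only [smul_inv_smul] using smulC (FreeGroup.mk [a]) _ this
      · exact Set.mem_biUnion (Set.mem_iUnion.2 ⟨a, hh, h1, h3⟩) (MulAction.mem_orbit_self h)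
  -- An orbit point is determined by the members of `C` that contain it.
  refine Set.Finite.of_finite_image (f := fun z => {h ∈ C | z ∈ h})
    (finC.finite_subsets.subset ?_) ?_
  · rintro _ ⟨z, -, rfl⟩
    exact fun h hh => hh.1
  · rintro _ ⟨g, rfl⟩ _ ⟨g', rfl⟩ heq
    by_contra hne
    obtain ⟨h, hh, h1, h2⟩ := hH.exists_separating _ _ hne
    simp only at h1 h2 heq
    have hk : hᶜ ∈ C := by
      by_cases h3 : g' • g⁻¹ • g • y ∈ h
      · have := sepC (g⁻¹ * g') (g⁻¹ • hᶜ) (hH.smul_mem _ _ (hH.compl_mem h hh))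
          (Set.mem_inv_smul_set_iff.2 h1) (fun h4 => by
            rw [Set.mem_inv_smul_set_iff, mul_smul, smul_inv_smul] at h4
            exact h4 h2)
        simpa using smulC g _ this
      · rw [inv_smul_smul] at h3
        exact absurd h2 h3
    have : hᶜ ∈ {h ∈ C | g • y ∈ h} := ⟨hk, h1⟩
    rw [heq] at this
    exact this.2 h2

/-- If few blocks shrink halfspaces, some point has a finite orbit. -/
theorem HalfspaceSystem.exists_orbit_finite [Fintype S] (hS : 7 ≤ Fintype.card S)
    {s : S × Bool} {τ : ℝ} (hτ : 1 ≤ τ) {k : ℕ}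
    (hk : 8 * τ ^ (k + 27) ≤ ((2 * Fintype.card S - 1 : ℕ) : ℝ) ^ k) {ℋ : Set (Set V)}
    (hH : HalfspaceSystem (FreeGroup S) ℋ)
    (hN : ∀ h ∈ ℋ, FewContractions s τ (4 * (k + 24) + 6) h) :
    ∃ y : V, (MulAction.orbit (FreeGroup S) y).Finite := by
  have : Nontrivial S := Fintype.one_lt_card_iff_nontrivial.1 (by omega)
  set b := k + 24 with hb
  have dichotomy : ∀ h ∈ ℋ, (MulAction.orbit (FreeGroup S) h).Infinite →
      ¬ IsReversed s τ b h → IsReversed s τ b hᶜ := by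
    intro h hh hinf h1
    by_contra h2
    exact hinf (orbit_finite_of_not_isReversed hS hτ hk hH hN hh h1 h2)
  set T : Set (Set V) := {h ∈ ℋ | IsReversed s τ b h ∧
    (MulAction.orbit (FreeGroup S) h).Infinite} with hT
  -- If a connector moved `h` to a halfspace that is not reversed, the complement of the image would
  -- be reversed, contrary to `IsReversed.not_smul_compl`.
  have smulT : ∀ g : FreeGroup S, ∀ h ∈ T, g • h ∈ T := by
    refine smul_mem_of_connectors (s := s) ?_
    rintro y hy h ⟨hh, hr, hinf⟩
    have hinf' : (MulAction.orbit (FreeGroup S) (FreeGroup.mk y • h)).Infinite := by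
      rwa [MulAction.orbit_smul]
    refine ⟨hH.smul_mem _ h hh, ?_, hinf'⟩
    by_contra hn
    have h2 := dichotomy _ (hH.smul_mem _ h hh) hinf' hn
    rw [← Set.smul_set_compl] at h2
    exact hr.not_smul_compl hτ (by omega) (hN _ (hH.compl_mem h hh)) hy h2
  -- For local finiteness: a word `w` reversing a halfspace through `x` moves `x` out of it, and
  -- only finitely many `w` are involved.
  obtain ⟨y, hy⟩ := hH.helly T (fun h hh => hh.1) (by
    intro x
    have : {h ∈ T | x ∈ h} ⊆ ⋃ w ∈ frames s b ∪ frames s (2 * b),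
        {h ∈ ℋ | x ∈ h ∧ FreeGroup.mk w • x ∉ h} := by
      rintro h ⟨⟨hh, ⟨ℓ, hℓ, hc⟩, -⟩, hx⟩
      have hpos : 0 < {w ∈ frames s ℓ | FreeGroup.mk w • h ⊂ hᶜ}.ncard := by
        have : (0 : ℝ) < τ ^ (ℓ + 3) := by positivity
        exact_mod_cast this.trans_le hc
      obtain ⟨w, hw, hwh⟩ := (Set.ncard_pos ((frames_finite s ℓ).subset fun _ h => h.1)).1 hpos
      refine Set.mem_biUnion (x := w) ?_ ⟨hh, hx, hwh.1 (Set.smul_mem_smul_set hx)⟩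
      rcases hℓ with rfl | rfl
      · exact .inl hw
      · exact .inr hw
    refine Set.Finite.subset ?_ this
    exact ((frames_finite s _).union (frames_finite s _)).biUnion
      fun w _ => hH.finite_separating _ _) (by
    intro h hh k hk
    exact hh.2.1.compl_inter_compl_nonempty hτ (by omega) (hN h hh.1) hk.2.1)
  refine ⟨y, hH.orbit_point_finite fun h hh g h1 h2 => ?_⟩
  by_contra hinf
  by_cases hr : IsReversed s τ b h
  · exact hy h ⟨hh, hr, hinf⟩ h1
  -- By invariance `y` avoids `g⁻¹ • hᶜ`, so `g • y` lies in `h` after all.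
  · have h3 : hᶜ ∈ T := ⟨hH.compl_mem h hh, dichotomy h hh hinf hr, fun hf => hinf (by
      simpa using orbit_compl_finite hf)⟩
    refine hy _ (smulT g⁻¹ _ h3) ?_
    rw [Set.mem_inv_smul_set_iff]
    exact h2

end FiniteOrbit

/-! ## Relators containing many blocks -/

section Relators

open FreeGroup

open scoped Pointwise

/-- Concatenations of `m` members of `C`. -/
def blockProducts {α : Type*} (C : Set (List α)) : ℕ → Set (List α)
  | 0 => {[]}
  | m + 1 => {w | ∃ u ∈ C, ∃ v ∈ blockProducts C m, w = u ++ v}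

variable {S : Type v}

theorem length_of_mem_blockProducts {α : Type*} {C : Set (List α)} {ℓ : ℕ}
    (hC : ∀ w ∈ C, w.length = ℓ) {m : ℕ} {w : List α} (hw : w ∈ blockProducts C m) :
    w.length = ℓ * m := by
  induction m generalizing w with
  | zero =>
    obtain rfl : w = [] := hw
    simp
  | succ m ih =>
    obtain ⟨u, hu, v, hv, rfl⟩ := hw
    rw [List.length_append, hC u hu, ih hv, mul_add, mul_one, add_comm]

theorem pow_le_ncard_blockProducts {α : Type*} [Finite α] {C : Set (List α)} {ℓ : ℕ}
    (hC : ∀ w ∈ C, w.length = ℓ) {c : ℝ} (hc0 : 0 ≤ c) (hc : c ≤ C.ncard) (m : ℕ) :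
    c ^ m ≤ (blockProducts C m).ncard := by
  induction m with
  | zero => simp [blockProducts]
  | succ m ih =>
    have := mul_le_ncard_append hC ((List.finite_length_eq α ℓ).subset hC)
      (B := fun _ => blockProducts C m) (C := blockProducts C (m + 1))
      ((List.finite_length_eq α (ℓ * (m + 1))).subset fun w hw =>
        length_of_mem_blockProducts hC hw)
      (fun w hw v hv => ⟨w, hw, v, hv, rfl⟩) (fun _ _ => ih)
    rw [pow_succ, mul_comm]
    refine le_trans ?_ this
    gcongr

theorem isBlock_of_mem_blockProducts {s : S × Bool} {C : Set (List (S × Bool))}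
    (hC : ∀ w ∈ C, IsBlock s w) {m : ℕ} {w : List (S × Bool)} (hw : w ∈ blockProducts C m) :
    IsBlock s w := by
  induction m generalizing w with
  | zero =>
    obtain rfl : w = [] := hw
    exact ⟨by simp, rfl⟩
  | succ m ih =>
    obtain ⟨u, hu, v, hv, rfl⟩ := hw
    exact (hC u hu).append (ih hv)

theorem smul_subset_of_mem_blockProducts {V : Type u} [MulAction (FreeGroup S) V] {h : Set V}
    {C : Set (List (S × Bool))} (hC : ∀ w ∈ C, mk w • h ⊂ h) {m : ℕ} {w : List (S × Bool)}
    (hw : w ∈ blockProducts C m) : mk w • h ⊆ h := by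
  induction m generalizing w with
  | zero =>
    obtain rfl : w = [] := hw
    simp [← one_eq_mk]
  | succ m ih =>
    obtain ⟨u, hu, v, hv, rfl⟩ := hw
    rw [← mul_mk, mul_smul]
    exact (Set.smul_set_mono (ih hv)).trans (hC u hu).1

theorem smul_ssubset_of_mem_blockProducts {V : Type u} [MulAction (FreeGroup S) V] {h : Set V}
    {C : Set (List (S × Bool))} (hC : ∀ w ∈ C, mk w • h ⊂ h) {m : ℕ} (hm : 1 ≤ m)
    {w : List (S × Bool)} (hw : w ∈ blockProducts C m) : mk w • h ⊂ h := by
  obtain ⟨m, rfl⟩ : ∃ m', m = m' + 1 := ⟨m - 1, by omega⟩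
  obtain ⟨u, hu, v, hv, rfl⟩ := hw
  rw [← mul_mk, mul_smul]
  exact (Set.smul_set_mono (smul_subset_of_mem_blockProducts hC hv)).trans_ssubset (hC u hu)

/-- Words of length `L` consisting of fewer than `ℓ` letters `t`, followed by words of length `ℓ`
from `C`. -/
def paddedProducts (t : S × Bool) (C : Set (List (S × Bool))) (ℓ L : ℕ) :
    Set (List (S × Bool)) :=
  (fun v => List.replicate (L % ℓ) t ++ v) '' blockProducts C (L / ℓ)

theorem length_of_mem_paddedProducts {t : S × Bool} {C : Set (List (S × Bool))} {ℓ L : ℕ}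
    (hC : ∀ w ∈ C, w.length = ℓ) {w : List (S × Bool)} (hw : w ∈ paddedProducts t C ℓ L) :
    w.length = L := by
  obtain ⟨v, hv, rfl⟩ := hw
  rw [List.length_append, List.length_replicate, length_of_mem_blockProducts hC hv]
  exact Nat.mod_add_div L ℓ

theorem isReduced_of_mem_paddedProducts {s t : S × Bool} (hst : s.1 ≠ t.1)
    {C : Set (List (S × Bool))} {ℓ L : ℕ} (hC : C ⊆ blocks s ℓ) {w : List (S × Bool)}
    (hw : w ∈ paddedProducts t C ℓ L) : IsReduced w := by
  obtain ⟨v, hv, rfl⟩ := hw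
  have hv' := isBlock_of_mem_blockProducts (fun w hw => (hC hw).2) hv
  cases L % ℓ with
  | zero => exact hv'.1.infix (List.prefix_append _ _).isInfix
  | succ r =>
    exact (isReduced_replicate_append hv'.1 hv'.2 (fun e => hst (by rw [e]; rfl)) r).1.infix
      (List.prefix_append _ _).isInfix

/-- The padding occupies fewer than `Λ` letters, so it costs at most the factor `τ ^ Λ`, independent
of `L`. -/
theorem pow_le_ncard_paddedProducts [Finite S] (t : S × Bool) {C : Set (List (S × Bool))}
    {ℓ Λ L : ℕ} (h1 : 1 ≤ ℓ) (hℓ : ℓ ≤ Λ) (hC : ∀ w ∈ C, w.length = ℓ) {τ : ℝ} (hτ : 1 ≤ τ)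
    (hc : τ ^ ℓ ≤ C.ncard) : τ ^ L ≤ τ ^ Λ * (paddedProducts t C ℓ L).ncard := by
  have h2 := pow_le_ncard_blockProducts hC (by positivity) hc (L / ℓ)
  rw [paddedProducts, Set.ncard_image_of_injective _ fun _ _ h => List.append_cancel_left h]
  calc τ ^ L = τ ^ (L % ℓ) * (τ ^ ℓ) ^ (L / ℓ) := by
        rw [← pow_mul, ← pow_add, Nat.mod_add_div]
    _ ≤ τ ^ Λ * (blockProducts C (L / ℓ)).ncard := by
        have := Nat.mod_lt L h1
        gcongr
        omega

/-- If the relators hit all the sets of padded products, then no halfspace is shrunk by many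
blocks. -/
theorem fewContractions_of_relators {s : S × Bool} {t : S} {τ : ℝ} {Λ L : ℕ} (hL : Λ ≤ L)
    {R : Set (List (S × Bool))}
    (hR : ∀ ℓ, 1 ≤ ℓ → ℓ ≤ Λ → ∀ C ⊆ blocks s ℓ, τ ^ ℓ ≤ C.ncard → ∀ e : Bool,
      ∃ w ∈ R, w ∈ paddedProducts (t, e) C ℓ L)
    {V : Type u} [MulAction (FreeGroup S) V] (hact : ∀ w ∈ R, ∀ x : V, mk w • x = x)
    (h : Set V) : FewContractions s τ Λ h := by
  intro ℓ h1 hℓ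
  by_contra! hc
  have hm : 1 ≤ L / ℓ := (Nat.one_le_div_iff h1).2 (hℓ.trans hL)
  -- Since the relator acts trivially, its product of contracting blocks moves `h` as the inverse of
  -- the padding does. Strictness uses that there is at least one block.
  have key : ∀ e : Bool, (mk (List.replicate (L % ℓ) (t, e)))⁻¹ • h ⊂ h := by
    intro e
    obtain ⟨_, hw, v, hv, rfl⟩ := hR ℓ h1 hℓ {w ∈ blocks s ℓ | mk w • h ⊂ h} (fun w hw => hw.1)
      hc e
    have h2 := smul_ssubset_of_mem_blockProducts (fun w hw => hw.2) hm hv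
    have h3 : mk (List.replicate (L % ℓ) (t, e)) • mk v • h = h := by
      rw [← mul_smul, mul_mk]
      ext x
      rw [Set.mem_smul_set_iff_inv_smul_mem, inv_smul_eq_iff.2 (hact _ hw x).symm]
    rwa [← eq_inv_smul_iff.2 h3]
  have h4 : (mk (List.replicate (L % ℓ) (t, true)))⁻¹ = mk (List.replicate (L % ℓ) (t, false)) := by
    simp [inv_mk, FreeGroup.invRev]
  have h5 := key true
  have h6 := smul_ssubset_smul (key false) (mk (List.replicate (L % ℓ) (t, false)))
  rw [smul_inv_smul] at h6
  rw [h4] at h5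
  exact (h6.trans h5).ne rfl

end Relators

/-! ## Counting tuples of relators -/

section Counting

open FreeGroup

/-- A union bound over `I`: independent samples all miss a set of density at least `p` with
probability at most `(1 - p) ^ N ≤ exp (-p * N)`. -/
theorem one_sub_le_probability {A ι : Type*} [Finite A] [Nonempty A] {I : Set ι} (hI : I.Finite)
    (B : ι → Set A) (N : ℕ) {p : ℝ} (hB : ∀ i ∈ I, p * Nat.card A ≤ (B i).ncard)
    (Q : (Fin N → A) → Prop) (hQ : ∀ R, (∀ i ∈ I, ∃ j, R j ∈ B i) → Q R) :
    1 - I.ncard * Real.exp (-(p * N)) ≤ (Nat.card {R // Q R} : ℝ) / Nat.card (Fin N → A) := by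
  classical
  have := Fintype.ofFinite A
  have hA : (0 : ℝ) < Fintype.card A := by exact_mod_cast Fintype.card_pos
  have hcard : (Nat.card (Fin N → A) : ℝ) = (Fintype.card A : ℝ) ^ N := by
    simp
  have hsplit : (Fintype.card A) ^ N = Nat.card {R // Q R} +
      (Finset.univ.filter fun R : Fin N → A => ¬ Q R).card := by
    rw [Nat.card_eq_fintype_card, Fintype.card_subtype, Finset.card_filter_add_card_filter_not,
      Finset.card_univ, Fintype.card_fun, Fintype.card_fin]
  have hbad : ((Finset.univ.filter fun R : Fin N → A => ¬ Q R).card : ℝ) ≤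
      I.ncard * (Real.exp (-(p * N)) * (Fintype.card A : ℝ) ^ N) := by
    have hsub : (Finset.univ.filter fun R : Fin N → A => ¬ Q R) ⊆
        hI.toFinset.biUnion fun i => Fintype.piFinset fun _ => (B i)ᶜ.toFinset := by
      intro R hR
      by_contra hn
      refine (Finset.mem_filter.1 hR).2 (hQ R fun i hi => ?_)
      by_contra! hj
      exact hn (Finset.mem_biUnion.2 ⟨i, hI.mem_toFinset.2 hi, by simpa using hj⟩)
    have h1 := (Finset.card_le_card hsub).trans Finset.card_biUnion_le
    have h2 : ∀ i ∈ hI.toFinset, ((Fintype.piFinset fun _ : Fin N => (B i)ᶜ.toFinset).card : ℝ) ≤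
        Real.exp (-(p * N)) * (Fintype.card A : ℝ) ^ N := by
      intro i hi
      have h3 : (((B i)ᶜ.toFinset.card : ℕ) : ℝ) ≤ (1 - p) * Fintype.card A := by
        have h4 := hB i (hI.mem_toFinset.1 hi)
        have h5 : (B i).ncard + (B i)ᶜ.toFinset.card = Fintype.card A := by
          rw [← Nat.card_eq_fintype_card, ← Set.ncard_add_ncard_compl (B i),
            Set.ncard_eq_toFinset_card' (B i)ᶜ]
        rw [Nat.card_eq_fintype_card] at h4
        have h6 : ((B i).ncard : ℝ) + (B i)ᶜ.toFinset.card = Fintype.card A := by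
          exact_mod_cast h5
        linarith
      have h7 : (((B i)ᶜ.toFinset.card : ℕ) : ℝ) ≤ Real.exp (-p) * Fintype.card A := by
        refine h3.trans ?_
        gcongr
        exact Real.one_sub_le_exp_neg p
      rw [Fintype.card_piFinset, Finset.prod_const, Finset.card_univ, Fintype.card_fin]
      push_cast
      calc _ ≤ (Real.exp (-p) * Fintype.card A) ^ N := by gcongr
        _ = _ := by
          rw [mul_pow, ← Real.exp_nat_mul]
          ring_nf
    have h8 : ((Finset.univ.filter fun R : Fin N → A => ¬ Q R).card : ℝ) ≤
        ∑ i ∈ hI.toFinset, ((Fintype.piFinset fun _ : Fin N => (B i)ᶜ.toFinset).card : ℝ) := by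
      exact_mod_cast h1
    refine h8.trans ((Finset.sum_le_sum h2).trans ?_)
    rw [Finset.sum_const, nsmul_eq_mul, Set.ncard_eq_toFinset_card _ hI]
  have hsplit' : (Fintype.card A : ℝ) ^ N = Nat.card {R // Q R} +
      (Finset.univ.filter fun R : Fin N → A => ¬ Q R).card := by exact_mod_cast hsplit
  rw [hcard, le_div_iff₀ (by positivity), sub_mul, one_mul]
  linarith

variable {S : Type v}

theorem reducedWord_finite [Finite S] (L : ℕ) : Finite (ReducedWord S L) :=
  ((List.finite_length_eq (S × Bool) L).subset fun _ h => h.1 :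
    {w : List (S × Bool) | w.length = L ∧ IsReduced w}.Finite)

theorem reducedWord_nonempty [Nonempty S] (L : ℕ) : Nonempty (ReducedWord S L) := by
  obtain ⟨t⟩ := ‹Nonempty S›
  exact ⟨List.replicate L (t, true), List.length_replicate,
    List.isChain_replicate_of_rel L fun _ => rfl⟩

theorem card_reducedWord_le [Fintype S] [Nonempty S] (L : ℕ) :
    Nat.card (ReducedWord S L) ≤ 2 * Fintype.card S * (2 * Fintype.card S - 1) ^ L := by
  classical
  have hcov : {w : List (S × Bool) | w.length = L ∧ IsReduced w} ⊆
      (Finset.univ.biUnion fun a : S × Bool => continuations L a : Finset (List (S × Bool))) := by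
    rintro w ⟨hl, hw⟩
    simp only [Finset.coe_biUnion, Set.mem_iUnion, Finset.mem_coe, mem_continuations]
    cases w with
    | nil =>
      obtain ⟨t⟩ := ‹Nonempty S›
      exact ⟨(t, true), by simp, hl, by simp⟩
    | cons a w => exact ⟨a, by simp, hl, isReduced_cons_cons.2 ⟨fun _ => rfl, hw⟩⟩
  have h1 := Set.ncard_le_ncard hcov (Finset.finite_toSet _)
  rw [Set.ncard_coe_finset] at h1
  refine (h1.trans Finset.card_biUnion_le).trans ?_
  simp only [card_continuations, Finset.sum_const, Finset.card_univ, Fintype.card_prod,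
    Fintype.card_bool, smul_eq_mul]
  rw [mul_comm (Fintype.card S) 2]

end Counting

/-! ## Fixed points and random groups -/

section Final

open FreeGroup Filter

open scoped Pointwise Topology

variable {V : Type u}

theorem point_half_apply {k : ℕ} {φ : (Fin k → Bool) → V} (hφ : Function.Injective φ) (x : V)
    [Decidable (x ∈ Set.range φ)] :
    CubeComplex.point φ (fun _ => 1 / 2) x = if x ∈ Set.range φ then (1 / 2 : ℝ) ^ k else 0 := by
  classical
  have hprod : ∀ ε : Fin k → Bool, ∏ i, (if ε i then (1 / 2 : ℝ) else 1 - 1 / 2) = (1 / 2) ^ k := by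
    intro ε
    rw [Finset.prod_congr rfl (g := fun _ => (1 / 2 : ℝ)) fun i _ => by split_ifs <;> norm_num]
    simp
  unfold CubeComplex.point
  simp only [hprod]
  split_ifs with h
  · obtain ⟨ε, rfl⟩ := h
    rw [Finset.sum_eq_single ε (fun ε' _ hne => if_neg fun e => hne (hφ e))
      (fun h => absurd (Finset.mem_univ _) h), if_pos rfl]
  · exact Finset.sum_eq_zero fun ε _ => if_neg fun e => h ⟨ε, e⟩

/-- The barycenter of an invariant cube is fixed. -/
theorem CubeComplex.exists_fixed_point {X : CubeComplex V} {K : Type*} [Group K] (f : K →* X.Aut)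
    {c : Set V} (hc : c ∈ X.cubes)
    (hinv : ∀ g : K, ∀ y ∈ c, ((f g : X.Aut) : Equiv.Perm V) y ∈ c) :
    ∃ p : X.Realization, ∀ g : K, f g • p = p := by
  classical
  obtain ⟨k, φ, hφ, rfl⟩ := X.exists_chart c hc
  refine ⟨⟨point φ fun _ => 1 / 2, k, φ, fun _ => 1 / 2, hφ, fun _ => by norm_num, rfl⟩,
    fun g => Subtype.ext (funext fun x => ?_)⟩
  change point φ (fun _ => 1 / 2) (((f g : X.Aut) : Equiv.Perm V)⁻¹ x) = point φ (fun _ => 1 / 2) x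
  rw [point_half_apply hφ.1, point_half_apply hφ.1]
  have : ((f g : X.Aut) : Equiv.Perm V)⁻¹ x ∈ Set.range φ ↔ x ∈ Set.range φ := by
    constructor
    · intro h
      simpa using hinv g _ h
    · intro h
      have := hinv g⁻¹ _ h
      rwa [_root_.map_inv] at this
  simp only [this]

/-- The halfspaces of a two-dimensional `CAT(0)` cube complex. -/
theorem SquareComplexGraph.halfspaceSystem {K : Type v} [Group K] [MulAction K V]
    {Γ : SimpleGraph V} {Sq : V → V → V → V → Prop} (hG : SquareComplexGraph Γ Sq)
    (hadj : ∀ (g : K) (x y : V), Γ.Adj x y → Γ.Adj (g • x) (g • y)) :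
    HalfspaceSystem K (halfspaces Γ) where
  compl_mem h hh := hG.compl_mem_halfspaces hh
  smul_mem g h hh := by
    have := preimage_mem_halfspaces hG.connected hadj g⁻¹ hh
    rwa [Set.preimage_smul, inv_inv] at this
  finite_separating := hG.finite_separating
  exists_separating x y := hG.exists_separating
  not_three_crossing h₁ m₁ h₂ m₂ h₃ m₃ := hG.not_three_crossing m₁ m₂ m₃
  helly T hT hfin hpair := by
    have := hG.connected.nonempty
    obtain ⟨y, -, hy⟩ := hG.helly (C := Set.univ) (fun _ _ _ _ _ _ => Set.mem_univ _)
      Set.univ_nonempty hT (fun y _ => hfin y) (fun h hh k hk => by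
        rw [Set.univ_inter]
        exact hpair h hh k hk)
    exact ⟨y, hy⟩

/-- A group has property `FC_2` if its relators hit all sets of padded products. -/
theorem propertyFC_of_relators {S : Type v} [Fintype S] (hS : 7 ≤ Fintype.card S) {s : S × Bool}
    {t : S} {τ : ℝ} (hτ : 1 ≤ τ) {k : ℕ}
    (hk : 8 * τ ^ (k + 27) ≤ ((2 * Fintype.card S - 1 : ℕ) : ℝ) ^ k) {L : ℕ}
    (hL : 4 * (k + 24) + 6 ≤ L) {R : Set (List (S × Bool))}
    (hR : ∀ ℓ, 1 ≤ ℓ → ℓ ≤ 4 * (k + 24) + 6 → ∀ C ⊆ blocks s ℓ, τ ^ ℓ ≤ C.ncard → ∀ e : Bool,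
      ∃ w ∈ R, w ∈ paddedProducts (t, e) C ℓ L) :
    PropertyFC.{u, v} 2 (PresentedGroup (FreeGroup.mk '' R)) := by
  intro V X hX hd ρ
  let f : FreeGroup S →* X.Aut := ρ.comp (PresentedGroup.mk (FreeGroup.mk '' R))
  let _ : MulAction (FreeGroup S) V := MulAction.compHom V f
  have hsmul : ∀ (g : FreeGroup S) (x : V), g • x = ((f g : X.Aut) : Equiv.Perm V) x :=
    fun _ _ => rfl
  have hG := hX.squareComplexGraph hd
  have hadj : ∀ (g : FreeGroup S) (x y : V), X.graph.Adj x y → X.graph.Adj (g • x) (g • y) := by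
    rintro g x y ⟨hne, hxy⟩
    refine ⟨fun e => hne (MulAction.injective g e), ?_⟩
    have := ((f g).2 {x, y}).2 hxy
    rwa [Set.image_pair] at this
  have hact : ∀ w ∈ R, ∀ x : V, FreeGroup.mk w • x = x := by
    intro w hw x
    have h1 : PresentedGroup.mk (FreeGroup.mk '' R) (FreeGroup.mk w) = 1 :=
      PresentedGroup.one_of_mem ⟨w, hw, rfl⟩
    rw [hsmul, MonoidHom.comp_apply, h1, _root_.map_one]
    rfl
  obtain ⟨y, hy⟩ := (hG.halfspaceSystem hadj).exists_orbit_finite hS hτ hk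
    fun h _ => fewContractions_of_relators hL hR hact h
  obtain ⟨c, hc, hinv⟩ := CubeComplex.exists_invariant_cube hG hadj
    (O := MulAction.orbit (FreeGroup S) y)
    (fun g z hz => MulAction.mem_orbit_of_mem_orbit g hz) ⟨y, MulAction.mem_orbit_self y⟩ hy
  obtain ⟨p, hp⟩ := CubeComplex.exists_fixed_point f hc hinv
  refine ⟨p, fun g => ?_⟩
  obtain ⟨g, rfl⟩ := PresentedGroup.mk_surjective _ g
  exact hp g

theorem exists_const_mul_pow_le {τ q : ℝ} (hτ : 1 ≤ τ) (hq : τ < q) :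
    ∃ k : ℕ, 8 * τ ^ (k + 27) ≤ q ^ k := by
  have h1 : 1 < q / τ := (one_lt_div (by linarith)).2 hq
  obtain ⟨k, hk⟩ := pow_unbounded_of_one_lt (8 * τ ^ 27) h1
  refine ⟨k, ?_⟩
  rw [div_pow, lt_div_iff₀ (by positivity)] at hk
  rw [pow_add]
  linarith

/-- The expected number of relators in a set of words of size about `q ^ ((1 - d / 2) * L)`
tends to infinity. -/
theorem tendsto_expected_hits {q d c : ℝ} (hq : 1 < q) (hd : 0 < d) (hc : 0 < c) :
    Tendsto (fun L : ℕ => c * (q ^ (1 - d / 2) / q) ^ L * (⌊q ^ (d * (L : ℝ))⌋₊ : ℝ))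
      atTop atTop := by
  have hq0 : 0 < q := by linarith
  have h1 : 1 < q ^ (d / 2) := Real.one_lt_rpow hq (by positivity)
  have h2 : Tendsto (fun L : ℕ => c / 2 * (q ^ (d / 2)) ^ L) atTop atTop :=
    (tendsto_pow_atTop_atTop_of_one_lt h1).const_mul_atTop (by positivity)
  refine tendsto_atTop_mono (fun L => ?_) h2
  have h3 : (1 : ℝ) ≤ q ^ (d * (L : ℝ)) := Real.one_le_rpow hq.le (by positivity)
  have h4 : q ^ (d * (L : ℝ)) / 2 ≤ (⌊q ^ (d * (L : ℝ))⌋₊ : ℝ) := by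
    have h5 := Nat.lt_floor_add_one (q ^ (d * (L : ℝ)))
    have h6 : (1 : ℝ) ≤ (⌊q ^ (d * (L : ℝ))⌋₊ : ℝ) := by
      exact_mod_cast Nat.le_floor (by simpa using h3)
    linarith
  have h7 : q ^ (1 - d / 2) / q = q ^ (-(d / 2)) := by
    rw [← Real.rpow_sub_one hq0.ne']
    ring_nf
  have h8 : (q ^ (d / 2)) ^ L = (q ^ (-(d / 2))) ^ L * q ^ (d * (L : ℝ)) := by
    rw [← Real.rpow_natCast, ← Real.rpow_natCast, ← Real.rpow_mul hq0.le, ← Real.rpow_mul hq0.le,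
      ← Real.rpow_add hq0]
    ring_nf
  rw [h7, h8]
  calc c / 2 * ((q ^ (-(d / 2))) ^ L * q ^ (d * (L : ℝ)))
      = c * (q ^ (-(d / 2))) ^ L * (q ^ (d * (L : ℝ)) / 2) := by ring
    _ ≤ _ := by gcongr

theorem mainTheorem1 {S : Type v} [Fintype S] (hS : 7 ≤ Fintype.card S)
    (d : ℝ) (hd : d ∈ Set.Ioo (0 : ℝ) 1) :
    WithOverwhelmingProbability S d (fun G [Group G] => PropertyFC.{u, v} 2 G) := by
  classical
  have hntr : Nontrivial S := Fintype.one_lt_card_iff_nontrivial.1 (by omega)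
  obtain ⟨s₀, t, hst⟩ := exists_pair_ne S
  let s : S × Bool := (s₀, true)
  have hqn : ((2 * Fintype.card S - 1 : ℕ) : ℝ) = 2 * (Fintype.card S : ℝ) - 1 := by
    rw [Nat.cast_sub (by omega)]
    push_cast
    ring
  set q : ℝ := 2 * (Fintype.card S : ℝ) - 1 with hq
  have hn : (7 : ℝ) ≤ Fintype.card S := by exact_mod_cast hS
  have hq1 : 1 < q := by linarith
  have hq0 : 0 < q := by linarith
  -- The exponent lies strictly between `1 - d`, so that relators hit sets of growth `τ`, and `1`,
  -- so that `τ < q` leaves room for `8 * τ ^ (k + 27) ≤ q ^ k`.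
  set τ : ℝ := q ^ (1 - d / 2) with hτdef
  have hτ : 1 ≤ τ := Real.one_le_rpow hq1.le (by linarith [hd.2])
  have hτq : τ < q := by
    conv_rhs => rw [← Real.rpow_one q]
    exact Real.rpow_lt_rpow_of_exponent_lt hq1 (by linarith [hd.1])
  obtain ⟨k, hk⟩ := exists_const_mul_pow_le hτ hτq
  rw [← hqn] at hk
  set Λ := 4 * (k + 24) + 6 with hΛ
  -- The sets to be hit are indexed by data not involving `L`, so the union bound has a fixed number
  -- of terms.
  let I : Set (ℕ × Set (List (S × Bool)) × Bool) :=
    {x | (1 ≤ x.1 ∧ x.1 ≤ Λ) ∧ x.2.1 ⊆ blocks s x.1 ∧ τ ^ x.1 ≤ x.2.1.ncard}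
  have hI : I.Finite := by
    have h1 : (⋃ ℓ ∈ Set.Iic Λ, {ℓ} ×ˢ ({C | C ⊆ blocks s ℓ} ×ˢ (Set.univ : Set Bool))).Finite :=
      (Set.finite_Iic Λ).biUnion fun ℓ _ => (Set.finite_singleton _).prod
        ((blocks_finite s ℓ).finite_subsets.prod Set.finite_univ)
    refine h1.subset ?_
    rintro ⟨ℓ, C, e⟩ ⟨⟨-, h2⟩, h3, -⟩
    exact Set.mem_biUnion (x := ℓ) h2 ⟨rfl, h3, Set.mem_univ _⟩
  -- One factor accounts for the padding, the other for the bound `2 * n * q ^ L` on the number of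
  -- reduced words.
  set c : ℝ := 1 / (τ ^ Λ * (2 * Fintype.card S)) with hc
  have hc0 : 0 < c := by positivity
  have hlow : ∀ L, Λ ≤ L → 1 - I.ncard * Real.exp (-(c * (τ / q) ^ L * (numRelators S d L : ℝ))) ≤
      randomGroupProb S d L (fun G [Group G] => PropertyFC.{u, v} 2 G) := by
    intro L hL
    have := reducedWord_finite (S := S) L
    have := reducedWord_nonempty (S := S) L
    refine one_sub_le_probability hI
      (fun x => {w : ReducedWord S L | w.1 ∈ paddedProducts (t, x.2.2) x.2.1 x.1 L})
      (numRelators S d L) (p := c * (τ / q) ^ L) ?_ _ ?_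
    · rintro ⟨ℓ, C, e⟩ ⟨⟨h1, hℓ⟩, hC, hCc⟩
      have h2 := pow_le_ncard_paddedProducts (L := L) (t, e) h1 hℓ (fun w hw => (hC hw).1) hτ hCc
      have h3 : (paddedProducts (t, e) C ℓ L).ncard ≤
          {w : ReducedWord S L | w.1 ∈ paddedProducts (t, e) C ℓ L}.ncard := by
        refine (Set.ncard_le_ncard ?_ ((Set.toFinite _).image _)).trans
          (Set.ncard_image_le (f := fun w : ReducedWord S L => w.1))
        intro w hw
        exact ⟨⟨w, length_of_mem_paddedProducts (fun w hw => (hC hw).1) hw,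
          isReduced_of_mem_paddedProducts (s := s) hst hC hw⟩, hw, rfl⟩
      have h4 : (Nat.card (ReducedWord S L) : ℝ) ≤ 2 * Fintype.card S * q ^ L := by
        rw [← hqn]
        exact_mod_cast card_reducedWord_le (S := S) L
      have h5 : τ ^ L ≤ τ ^ Λ *
          {w : ReducedWord S L | w.1 ∈ paddedProducts (t, e) C ℓ L}.ncard :=
        h2.trans (by gcongr)
      calc c * (τ / q) ^ L * Nat.card (ReducedWord S L)
          ≤ c * (τ / q) ^ L * (2 * Fintype.card S * q ^ L) := by gcongr
        _ = τ ^ L / τ ^ Λ := by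
          rw [hc, div_pow]
          field_simp
        _ ≤ _ := by
          rw [div_le_iff₀ (by positivity), mul_comm]
          exact h5
    · intro R hR
      have hrange : Set.range (fun i => FreeGroup.mk (R i).1) =
          FreeGroup.mk '' Set.range fun i => (R i).1 := by
        rw [← Set.range_comp]
        rfl
      change PropertyFC.{u, v} 2 (PresentedGroup (Set.range fun i => FreeGroup.mk (R i).1))
      rw [hrange]
      refine propertyFC_of_relators hS (s := s) (t := t) hτ hk hL ?_
      intro ℓ h1 hℓ C hC hCc e
      obtain ⟨j, hj⟩ := hR (ℓ, C, e) ⟨⟨h1, hℓ⟩, hC, hCc⟩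
      exact ⟨_, ⟨j, rfl⟩, hj⟩
  have hlim : Tendsto (fun L : ℕ =>
      1 - I.ncard * Real.exp (-(c * (τ / q) ^ L * (numRelators S d L : ℝ)))) atTop (𝓝 1) := by
    have h1 := Real.tendsto_exp_neg_atTop_nhds_zero.comp (tendsto_expected_hits hq1 hd.1 hc0)
    have h2 := (h1.const_mul (I.ncard : ℝ)).const_sub 1
    rw [mul_zero, sub_zero] at h2
    exact h2
  refine tendsto_of_tendsto_of_tendsto_of_le_of_le' hlim tendsto_const_nhds
    (eventually_atTop.2 ⟨Λ, hlow⟩) (Eventually.of_forall fun L => ?_)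
  have := reducedWord_finite (S := S) L
  refine div_le_one_of_le₀ ?_ (Nat.cast_nonneg _)
  exact_mod_cast Nat.card_le_card_of_injective _ Subtype.val_injective

end Final
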